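/- **Setting.** Let $d\ge 1$, let $\Theta\subset\mathbb R^d$ be compact, and let $\theta$ (the true parameter) lie in the interior of $\Theta$. For each $\gamma\in\Theta$ let $P_\gamma$ be a probability measure under which $X=(X_t)_{t\in\mathbb N}$ is a real-valued, zero-mean, stationary Gaussian process, with autocovariance $c_X(\tau;\gamma)=\mathbb E_\gamma[X_tX_{t+\tau}]$ ($\tau\ge 0$) and spectral density $$S_X(\omega;\gamma)=\frac1{2\pi}\sum_{\tau\in\mathbb Z}c_X(|\tau|;\gamma)e^{-i\omega\tau},\qquad \omega\in\mathbb R .$$ Let $(g_t)_{t\in\mathbb N}$ be a known bounded real sequence, put $\widetilde X_t=g_tX_t$ and $c_g^{(N)}(\tau)=\frac1N\sum_{t=0}^{N-\tau-1}g_tg_{t+\tau}$. Let $\Omega_N=\frac{2\pi}{N}\{-\lceil N/2\rceil+1,\dots,\lfloor N/2\rfloor\}$, $$\hat S^{(N)}(\omega)=\frac1N\Big|\sum_{t=0}^{N-1}\widetilde X_te^{-i\omega t}\Big|^2,\qquad \overline S^{(N)}(\omega;\gamma)=\mathbb E_\gamma\big[\hat S^{(N)}(\omega)\big],$$ $$\ell_N(\gamma)=\frac1N\sum_{\omega\in\Omega_N}\Big\{\log\overline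 S^{(N)}(\omega;\gamma)+\frac{\hat S^{(N)}(\omega)}{\overline S^{(N)}(\omega;\gamma)}\Big\},$$ and let $\hat\theta^{(N)}\in\arg\min_{\gamma\in\Theta}\ell_N(\gamma)$, chosen arbitrarily if there are several minimizers. **Assumptions.** 1. For every $\gamma\in\Theta$, $\sum_{\tau\ge 0}|c_X(\tau;\gamma)|<\infty$ and $S_X(\omega;\gamma)>0$ for all $\omega$; for every $\tau$, $\gamma\mapsto c_X(\tau;\gamma)$ is continuous on $\Theta$. 2. $S_X$ is differentiable in $\omega$ and $\partial_\omega S_X(\omega;\gamma)$ is continuous in $(\omega,\gamma)\in\mathbb R\times\Theta$. 3. $S_X$ is twice continuously differentiable in $\gamma$ on the interior of $\Theta$, with first and second derivatives in $\gamma$ continuous in $(\omega,\gamma)\in\mathbb R\times\operatorname{int}\Theta$. 4. There is a set of $d$ lags $\Gamma=\{\tau_1,\dots,\tau_d\}\subset\mathbb N$ such that $\gamma\mapsto(c_X(\tau;\gamma))_{\tau\in\Gamma}$ is injective on $\Theta$, $\liminf_{N\to\infty}|c_g^{(N)}(\tau)|>0$ for every $\tau\in\Gamma$, and the Jacobian matrix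 $\big(\partial c_X(\tau_i;\gamma)/\partial\gamma_j\big)_{i,j=1}^d$ is nonsingular at $\gamma=\theta$. **Theorem (convergence rate).** Under $P_\theta$, $\hat\theta^{(N)}=\theta+\mathcal O_P(N^{-1/2})$; that is, for every $\varepsilon>0$ there are $M$ and $N_0$ such that $P_\theta\big(\|\hat\theta^{(N)}-\theta\|>M N^{-1/2}\big)\le\varepsilon$ for all $N\ge N_0$. -/

import Mathlib

open MeasureTheory ProbabilityTheory Filter Topology

noncomputable section

namespace ModulatedSeries

variable {Ω : Type*} [MeasurableSpace Ω]

/-- `X` is, under the probability measure `μ`, a real-valued zero-mean stationary Gaussian process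
(for a zero-mean Gaussian process, stationarity means that the autocovariance depends on the
lag only). -/
structure IsStationaryGaussian (X : ℕ → Ω → ℝ) (μ : Measure Ω) : Prop where
  gaussian : IsGaussianProcess X μ
  mean_zero : ∀ t, ∫ x, X t x ∂μ = 0
  stationary : ∀ t τ, ∫ x, X t x * X (t + τ) x ∂μ = ∫ x, X 0 x * X τ x ∂μ

/-- The modulated process `g_t X_t`. -/
def modulate (g : ℕ → ℝ) (X : ℕ → Ω → ℝ) : ℕ → Ω → ℝ := fun t x => g t * X t x

/-- Sample autocovariance of the modulating sequence,
`(1/N) ∑_{t=0}^{N-τ-1} g_t g_{t+τ}` (an empty sum when `τ ≥ N`). -/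
def sampleAutocov (g : ℕ → ℝ) (N τ : ℕ) : ℝ :=
  (1 / (N : ℝ)) * ∑ t ∈ Finset.range (N - τ), g t * g (t + τ)

/-- The periodogram of the length-`N` sample of a process `Y`, at frequency `ω`. -/
def periodogram (Y : ℕ → Ω → ℝ) (N : ℕ) (ω : ℝ) (x : Ω) : ℝ :=
  (1 / (N : ℝ)) *
    ‖∑ t ∈ Finset.range N, (Y t x : ℂ) * Complex.exp (-Complex.I * (ω : ℂ) * (t : ℂ))‖ ^ 2

/-- The indices `-⌈N/2⌉ + 1, …, ⌊N/2⌋` of the Fourier frequencies. -/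
def fourierIndices (N : ℕ) : Finset ℤ :=
  Finset.Icc (-(((N : ℤ) + 1) / 2) + 1) ((N : ℤ) / 2)

/-- The Fourier frequency `2πj/N`. -/
def fourierFreq (N : ℕ) (j : ℤ) : ℝ := 2 * Real.pi / (N : ℝ) * (j : ℝ)

section Model

/-! A parametric model for the latent process: under `P γ` the process `X` has the law with
parameter vector `γ`. -/

variable {d : ℕ}

/-- Autocovariance `c_X(τ; γ)` of the latent process at a lag `τ ≥ 0`, under parameter `γ`. -/
def autocov (P : EuclideanSpace ℝ (Fin d) → Measure Ω) (X : ℕ → Ω → ℝ) (τ : ℕ)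
    (γ : EuclideanSpace ℝ (Fin d)) : ℝ :=
  ∫ x, X 0 x * X τ x ∂(P γ)

/-- Spectral density `S_X(ω; γ) = (1/2π) ∑_{τ ∈ ℤ} c_X(|τ|; γ) e^{-iωτ}`; by symmetry of the
autocovariance the exponential may be replaced by its real part. -/
def spectralDensity (P : EuclideanSpace ℝ (Fin d) → Measure Ω) (X : ℕ → Ω → ℝ) (ω : ℝ)
    (γ : EuclideanSpace ℝ (Fin d)) : ℝ :=
  (1 / (2 * Real.pi)) * ∑' τ : ℤ, autocov P X τ.natAbs γ * Real.cos (ω * (τ : ℝ))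

/-- Expected periodogram of the modulated process under parameter `γ`. -/
def expectedPeriodogram (P : EuclideanSpace ℝ (Fin d) → Measure Ω) (X : ℕ → Ω → ℝ)
    (g : ℕ → ℝ) (N : ℕ) (ω : ℝ) (γ : EuclideanSpace ℝ (Fin d)) : ℝ :=
  ∫ x, periodogram (modulate g X) N ω x ∂(P γ)

/-- The spectral pseudo-likelihood `ℓ_M(γ)` computed from the length-`N` sample at outcome `x`. -/
def pseudoLikelihood (P : EuclideanSpace ℝ (Fin d) → Measure Ω) (X : ℕ → Ω → ℝ)
    (g : ℕ → ℝ) (N : ℕ) (x : Ω) (γ : EuclideanSpace ℝ (Fin d)) : ℝ :=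
  (1 / (N : ℝ)) * ∑ j ∈ fourierIndices N,
    (Real.log (expectedPeriodogram P X g N (fourierFreq N j) γ)
      + periodogram (modulate g X) N (fourierFreq N j) x
        / expectedPeriodogram P X g N (fourierFreq N j) γ)

/-- `θhat N` is a (possibly non-unique, arbitrarily chosen) minimizer over `Θ` of the
pseudo-likelihood of the length-`N` sample. -/
def IsSpectralEstimator (P : EuclideanSpace ℝ (Fin d) → Measure Ω) (X : ℕ → Ω → ℝ)
    (g : ℕ → ℝ) (Θ : Set (EuclideanSpace ℝ (Fin d)))
    (θhat : ℕ → Ω → EuclideanSpace ℝ (Fin d)) : Prop :=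
  ∀ N x, θhat N x ∈ Θ ∧ IsMinOn (pseudoLikelihood P X g N x) Θ (θhat N x)

/-- The modulated process has a significant correlation contribution, with set of lags `Γ`. -/
structure SignificantCorrelation (P : EuclideanSpace ℝ (Fin d) → Measure Ω) (X : ℕ → Ω → ℝ)
    (g : ℕ → ℝ) (Θ : Set (EuclideanSpace ℝ (Fin d))) (Γ : Finset ℕ) : Prop where
  injective : Set.InjOn (fun γ => fun τ : Γ => autocov P X τ γ) Θ
  liminf_pos : ∀ τ ∈ Γ, 0 < liminf (fun N : ℕ => |sampleAutocov g N τ|) atTop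

/-- The Jacobian matrix at `θ` of `γ ↦ (c_X(τ₁; γ), …, c_X(τ_d; γ))`, with entries
`∂c_X(τ_i; ·)/∂θ_j`. -/
def autocovJacobian (P : EuclideanSpace ℝ (Fin d) → Measure Ω) (X : ℕ → Ω → ℝ)
    (τ : Fin d → ℕ) (θ : EuclideanSpace ℝ (Fin d)) : Matrix (Fin d) (Fin d) ℝ :=
  Matrix.of fun i j => lineDeriv ℝ (autocov P X (τ i)) θ (EuclideanSpace.single j 1)

end Model

/-- `Z N = O_P(r N)` under `μ`, i.e. `Z N / r N` is bounded in probability. (`μ` of a set that is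
not measurable is its outer measure.) -/
def IsBigOInProbability {E : Type*} [Norm E] (μ : Measure Ω) (Z : ℕ → Ω → E) (r : ℕ → ℝ) : Prop :=
  ∀ ε : ℝ, 0 < ε → ∃ M : ℝ, ∀ᶠ N in atTop, μ {x | M * r N < ‖Z N x‖} ≤ ENNReal.ofReal ε

end ModulatedSeries

end

/-! Write s_γ for the expected periodogram under γ and D(h) for the mean over the Fourier
frequencies of (periodogram - s_θ) h. By `pseudoLikelihood_sub`, ℓ_N(γ) - ℓ_N(θ) is the mean of
log(s_γ/s_θ) + s_θ/s_γ - 1 plus D(1/s_γ - 1/s_θ). As long as all s lie in a fixed interval [lo, hi]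
with lo > 0, the first mean dominates a multiple of the mean of (s_γ - s_θ)²
(`whittle_divergence_ge`). Once the s_γ separate parameters in mean square, a minimizer γ therefore
satisfies c‖γ - θ‖² ≤ |D(1/s_γ - 1/s_θ)| (`exists_basic_inequality`).

Separation (`exists_mean_sq_separation`) is read off from discrete Fourier coefficients: at lag τ
the coefficient of s_γ - s_θ is c_g(τ) times the difference of autocovariances, plus an aliasing
term of order ‖γ - θ‖/N. On the compact Θ, injectivity and the nonsingular Jacobian make the
autocovariance differences at the lags of Γ at least κ‖γ - θ‖. Bounds and expansions pass from the
spectral density to s_γ with constants free of N, because s_γ is the integral of the spectral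
density against a nonnegative kernel of mass 2π c_g(0), and c_g(0) ≥ |c_g(τ)|.

For deterministic bounded h, D(h) is a centred Gaussian quadratic form. Isserlis' formula, Schur's
bound and Bessel's inequality give it variance O(1/N). The weights at the estimator are random,
which is handled in two stages. A finite net in Θ, together with the mean absolute deviation of the
periodogram being O_P(1), puts the estimator within a fixed δ of θ with high probability. There
1/s_γ has a second-order expansion in u = γ - θ with deterministic coefficients, so D can be applied
coefficient by coefficient: the linear part is O_P(N^{-1/2})‖u‖, and the quadratic part and
remainder are at most (c/2)‖u‖². Absorbing and dividing by ‖u‖ gives the rate. The derivatives of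
ℓ_N are never formed, and the estimator need not be measurable. -/

namespace ModulatedSeries

/-! ### Finite Fourier sums -/

/-- Orthogonality of the discrete cosines over a block of `N` consecutive integers. -/
lemma sum_range_cos_eq {N : ℕ} (hN : 0 < N) (m a : ℤ) :
    ∑ n ∈ Finset.range N, Real.cos (2 * Real.pi / N * m * (a + n)) =
      if (N : ℤ) ∣ m then (N : ℝ) else 0 := by
  have hN' : (N : ℝ) ≠ 0 := by positivity
  have hNC : (N : ℂ) ≠ 0 := by exact_mod_cast hN.ne'
  split_ifs with h
  · obtain ⟨q, rfl⟩ := h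
    have : ∀ n ∈ Finset.range N,
        Real.cos (2 * Real.pi / N * ((N * q : ℤ) : ℝ) * (a + n)) = 1 := by
      intro n _
      have : 2 * Real.pi / N * ((N * q : ℤ) : ℝ) * (a + n)
          = ((q * (a + n) : ℤ) : ℝ) * (2 * Real.pi) := by
        push_cast; field_simp
      rw [this, Real.cos_int_mul_two_pi]
    rw [Finset.sum_congr rfl this]; simp
  -- ζ is an N-th root of unity other than 1, so its powers sum to zero; each cosine is the real
  -- part of a fixed phase times ζ ^ n.
  · set ζ : ℂ := Complex.exp (2 * Real.pi * Complex.I * (m / N)) with hζ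
    have hζ1 : ζ ≠ 1 := by
      intro h1
      obtain ⟨n, hn⟩ := Complex.exp_eq_one_iff.1 h1
      have hpi : (2 * Real.pi * Complex.I : ℂ) ≠ 0 := Complex.two_pi_I_ne_zero
      rw [mul_comm] at hn
      have h2 := mul_right_cancel₀ hpi hn
      rw [div_eq_iff hNC] at h2
      exact h ⟨n, by rw [mul_comm]; exact_mod_cast h2⟩
    have hζN : ζ ^ N = 1 := by
      rw [hζ, ← Complex.exp_nat_mul, Complex.exp_eq_one_iff]
      exact ⟨m, by field_simp⟩
    have hgeom : ∑ n ∈ Finset.range N, ζ ^ n = 0 := by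
      have := geom_sum_mul ζ N
      rw [hζN, sub_self] at this
      exact (mul_eq_zero.1 this).resolve_right (sub_ne_zero.2 hζ1)
    have key : ∀ n ∈ Finset.range N, Real.cos (2 * Real.pi / N * m * (a + n)) =
        (Complex.exp (((2 * Real.pi / N * m * a : ℝ) : ℂ) * Complex.I) * ζ ^ n).re := by
      intro n _
      rw [hζ, ← Complex.exp_nat_mul, ← Complex.exp_add, ← Complex.exp_ofReal_mul_I_re]
      congr 2
      push_cast
      field_simp
    rw [Finset.sum_congr rfl key, ← Complex.re_sum, ← Finset.mul_sum, hgeom]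
    simp

lemma sum_fourierIndices_eq (N : ℕ) (f : ℤ → ℝ) :
    ∑ j ∈ fourierIndices N, f j =
      ∑ n ∈ Finset.range N, f ((-(((N : ℤ) + 1) / 2) + 1) + n) := by
  symm
  refine Finset.sum_bij' (fun n _ => (-(((N : ℤ) + 1) / 2) + 1) + (n : ℤ))
    (fun j _ => (j - (-(((N : ℤ) + 1) / 2) + 1)).toNat) ?_ ?_ ?_ ?_ ?_
  · intro n hn
    simp only [fourierIndices, Finset.mem_Icc, Finset.mem_range] at *
    omega
  · intro j hj
    simp only [fourierIndices, Finset.mem_Icc, Finset.mem_range] at *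
    omega
  · intro n hn
    simp
  · intro j hj
    simp only [fourierIndices, Finset.mem_Icc] at *
    omega
  · intro n hn; rfl

lemma card_fourierIndices (N : ℕ) : (fourierIndices N).card = N := by
  simp only [fourierIndices, Int.card_Icc]
  omega

/-- A sum over the Fourier frequencies of terms bounded by `C` is at most `N * C`. -/
lemma sum_fourierIndices_le {N : ℕ} {f : ℤ → ℝ} {C : ℝ} (h : ∀ j, f j ≤ C) :
    ∑ j ∈ fourierIndices N, f j ≤ N * C := by
  calc _ ≤ ∑ j ∈ fourierIndices N, C := Finset.sum_le_sum fun j _ => h j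
    _ = N * C := by simp [card_fourierIndices]

lemma sum_cos_fourierFreq {N : ℕ} (hN : 0 < N) (k : ℤ) :
    ∑ j ∈ fourierIndices N, Real.cos (fourierFreq N j * k) =
      if (N : ℤ) ∣ k then (N : ℝ) else 0 := by
  rw [sum_fourierIndices_eq, ← sum_range_cos_eq hN k (-(((N : ℤ) + 1) / 2) + 1)]
  refine Finset.sum_congr rfl fun n _ => ?_
  congr 1
  simp only [fourierFreq]
  push_cast
  ring

/-- The indices are N consecutive integers, so two of them differ by less than N. -/
lemma dvd_sub_fourierIndices_iff {N : ℕ} {j k : ℤ} (hj : j ∈ fourierIndices N)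
    (hk : k ∈ fourierIndices N) : (N : ℤ) ∣ k - j ↔ j = k := by
  constructor
  · intro h
    have := Int.eq_zero_of_abs_lt_dvd h (by
      simp only [fourierIndices, Finset.mem_Icc] at hj hk
      rw [abs_lt]; omega)
    omega
  · rintro rfl; simp

/-- Bessel's inequality for the cosine transform over the Fourier frequencies. -/
lemma sum_sq_cosTransform_le {N : ℕ} (hN : 0 < N) (h : ℤ → ℝ) (s : ℕ) :
    ∑ t ∈ Finset.range N,
      (∑ j ∈ fourierIndices N, h j * Real.cos (fourierFreq N j * ((s : ℝ) - t))) ^ 2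
      ≤ N * ∑ j ∈ fourierIndices N, h j ^ 2 := by
  -- Adding the square of the sine transform produces a squared modulus, whose expansion involves
  -- only the differences k - j; the cosines alone would also bring in k + j.
  have h1 : ∀ t : ℕ,
      (∑ j ∈ fourierIndices N, h j * Real.cos (fourierFreq N j * ((s : ℝ) - t))) ^ 2 ≤
      ∑ j ∈ fourierIndices N, ∑ k ∈ fourierIndices N, h j * h k *
        Real.cos (2 * Real.pi / N * ((k - j : ℤ) : ℝ) * (((-s : ℤ) : ℝ) + t)) := by
    intro t
    have : ∑ j ∈ fourierIndices N, ∑ k ∈ fourierIndices N, h j * h k *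
        Real.cos (2 * Real.pi / N * ((k - j : ℤ) : ℝ) * (((-s : ℤ) : ℝ) + t)) =
        (∑ j ∈ fourierIndices N, h j * Real.cos (fourierFreq N j * ((s : ℝ) - t))) ^ 2 +
        (∑ j ∈ fourierIndices N, h j * Real.sin (fourierFreq N j * ((s : ℝ) - t))) ^ 2 := by
      rw [sq, sq, Finset.sum_mul_sum, Finset.sum_mul_sum, ← Finset.sum_add_distrib]
      refine Finset.sum_congr rfl fun j _ => ?_
      rw [← Finset.sum_add_distrib]
      refine Finset.sum_congr rfl fun k _ => ?_
      have : 2 * Real.pi / N * ((k - j : ℤ) : ℝ) * (((-s : ℤ) : ℝ) + t) =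
          fourierFreq N j * ((s : ℝ) - t) - fourierFreq N k * ((s : ℝ) - t) := by
        simp only [fourierFreq]; push_cast; ring
      rw [this, Real.cos_sub]
      ring
    rw [this]
    nlinarith [sq_nonneg
      (∑ j ∈ fourierIndices N, h j * Real.sin (fourierFreq N j * ((s : ℝ) - t)))]
  refine (Finset.sum_le_sum fun t _ => h1 t).trans (le_of_eq ?_)
  rw [Finset.sum_comm, Finset.mul_sum]
  refine Finset.sum_congr rfl fun j hj => ?_
  rw [Finset.sum_comm]
  have h2 : ∀ k ∈ fourierIndices N, ∑ t ∈ Finset.range N, h j * h k *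
        Real.cos (2 * Real.pi / N * ((k - j : ℤ) : ℝ) * (((-s : ℤ) : ℝ) + t)) =
        if j = k then N * h j ^ 2 else 0 := by
    intro k hk
    rw [← Finset.mul_sum, sum_range_cos_eq hN (k - j) (-s)]
    simp only [dvd_sub_fourierIndices_iff hj hk]
    split_ifs with hjk
    · subst hjk; ring
    · simp
  rw [Finset.sum_congr rfl h2, Finset.sum_ite_eq, if_pos hj]

/-- The coefficient of `Y_s Y_t` in the weighted mean of the periodogram over the Fourier
frequencies. -/
noncomputable def periodogramWeight (N : ℕ) (h : ℤ → ℝ) (s t : ℕ) : ℝ :=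
  (1 / (N : ℝ) ^ 2) * ∑ j ∈ fourierIndices N, h j * Real.cos (fourierFreq N j * ((s : ℝ) - t))

/-- This is the source of the 1/N in the variance: by Bessel each of the N rows contributes at most
N⁻⁴ · N · N C². -/
lemma sum_sq_periodogramWeight_le {N : ℕ} (hN : 0 < N) {h : ℤ → ℝ} {C : ℝ}
    (hC : ∀ j, |h j| ≤ C) :
    ∑ s ∈ Finset.range N, ∑ t ∈ Finset.range N, periodogramWeight N h s t ^ 2 ≤ C ^ 2 / N := by
  have hN' : (0 : ℝ) < N := by positivity
  have h2 : ∑ j ∈ fourierIndices N, h j ^ 2 ≤ N * C ^ 2 :=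
    sum_fourierIndices_le fun j => sq_le_sq' (by linarith [neg_abs_le (h j), hC j])
      ((le_abs_self _).trans (hC j))
  calc _ ≤ ∑ s ∈ Finset.range N, C ^ 2 / (N : ℝ) ^ 2 := by
        refine Finset.sum_le_sum fun s _ => ?_
        simp only [periodogramWeight, mul_pow]
        rw [← Finset.mul_sum]
        calc _ ≤ (1 / (N : ℝ) ^ 2) ^ 2 * (N * (N * C ^ 2)) := by
              gcongr
              exact (sum_sq_cosTransform_le hN h s).trans (by gcongr)
          _ = C ^ 2 / (N : ℝ) ^ 2 := by field_simp
    _ = C ^ 2 / N := by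
        rw [Finset.sum_const, Finset.card_range, nsmul_eq_mul]; field_simp

/-- The squared modulus of a trigonometric sum as a double cosine sum. -/
lemma norm_sq_sum_mul_exp (y : ℕ → ℝ) (N : ℕ) (ω : ℝ) :
    ‖∑ t ∈ Finset.range N, (y t : ℂ) * Complex.exp (-Complex.I * (ω : ℂ) * (t : ℂ))‖ ^ 2 =
      ∑ s ∈ Finset.range N, ∑ t ∈ Finset.range N, y s * y t * Real.cos (ω * ((s : ℝ) - t)) := by
  have h1 : ∀ t : ℕ, (y t : ℂ) * Complex.exp (-Complex.I * (ω : ℂ) * (t : ℂ)) =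
      ((y t * Real.cos (ω * t) : ℝ) : ℂ) + ((-(y t * Real.sin (ω * t)) : ℝ) : ℂ) * Complex.I := by
    intro t
    have : -Complex.I * (ω : ℂ) * (t : ℂ) = ((-(ω * t) : ℝ) : ℂ) * Complex.I := by
      push_cast; ring
    rw [this, Complex.exp_mul_I, ← Complex.ofReal_cos, ← Complex.ofReal_sin, Real.cos_neg,
      Real.sin_neg]
    push_cast; ring
  simp_rw [h1]
  rw [Finset.sum_add_distrib, ← Finset.sum_mul, ← Complex.ofReal_sum, ← Complex.ofReal_sum,
    Complex.sq_norm, Complex.normSq_add_mul_I, sq, sq, Finset.sum_mul_sum, Finset.sum_mul_sum,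
    ← Finset.sum_add_distrib]
  refine Finset.sum_congr rfl fun s _ => ?_
  rw [← Finset.sum_add_distrib]
  refine Finset.sum_congr rfl fun t _ => ?_
  rw [mul_sub, Real.cos_sub]
  ring

end ModulatedSeries

namespace ModulatedSeries

variable {Ω : Type*} [MeasurableSpace Ω]

/-! ### Fourth moments of Gaussian vectors -/

/-- The fourth moment of a centred real Gaussian distribution. -/
lemma integral_pow_four_gaussianReal (v : NNReal) :
    ∫ x, x ^ 4 ∂(gaussianReal 0 v) = 3 * (v : ℝ) ^ 2 := by
  have h4 : ∫ x, x ^ 4 ∂(gaussianReal 0 v)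
      = iteratedDeriv 4 (mgf (fun x ↦ x) (gaussianReal 0 v)) 0 := by
    rw [iteratedDeriv_mgf_zero] <;> simp
  have hE : ∀ t : ℝ, HasDerivAt (fun t : ℝ => Real.exp (v * t ^ 2 / 2))
      (Real.exp (v * t ^ 2 / 2) * (v * t)) t := by
    intro t
    have : HasDerivAt (fun t : ℝ => (v : ℝ) * t ^ 2 / 2) (v * t) t := by
      have := (((hasDerivAt_id t).pow 2).const_mul (v : ℝ)).div_const 2
      convert! this using 1
      simp; ring
    exact this.exp
  -- Differentiation preserves the form p(t) exp(v t²/2), sending p to p' + v t p; four rounds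
  -- starting from p = 1 leave the constant term 3v².
  have hd : ∀ {p p' : ℝ → ℝ}, (∀ t, HasDerivAt p (p' t) t) →
      deriv (fun t => p t * Real.exp (v * t ^ 2 / 2)) =
        fun t => (p' t + p t * (v * t)) * Real.exp (v * t ^ 2 / 2) := by
    intro p p' hp
    ext t
    refine ((hp t).mul (hE t)).deriv.trans ?_
    ring
  rw [h4, mgf_fun_id_gaussianReal, iteratedDeriv_eq_iterate]
  have e0 : (fun t : ℝ => Real.exp ((0 : ℝ) * t + v * t ^ 2 / 2)) =
      fun t => (fun _ => (1 : ℝ)) t * Real.exp (v * t ^ 2 / 2) := by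
    ext t; simp
  have e1 := hd (p := fun _ => (1 : ℝ)) (p' := fun _ => 0) (fun t => hasDerivAt_const t 1)
  -- The polynomials are kept in the unsimplified shape left by the preceding round, so that the
  -- rewrites chain.
  have e2 := hd (p := fun t : ℝ => 0 + 1 * (v * t)) (p' := fun _ => (v : ℝ)) (fun t => by
    simpa using (hasDerivAt_id t).const_mul (v : ℝ))
  have e3 := hd (p := fun t : ℝ => v + (0 + 1 * (v * t)) * (v * t))
    (p' := fun t => 2 * (v : ℝ) ^ 2 * t) (fun t => by
      have := (((hasDerivAt_id t).pow 2).const_mul ((v : ℝ) ^ 2)).const_add (v : ℝ)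
      convert! this using 1
      · ext x; simp; ring
      · simp; ring)
  have e4 := hd (p := fun t : ℝ => 2 * (v : ℝ) ^ 2 * t + (v + (0 + 1 * (v * t)) * (v * t)) * (v * t))
    (p' := fun t => 3 * (v : ℝ) ^ 2 + 3 * (v : ℝ) ^ 3 * t ^ 2) (fun t => by
      have := ((hasDerivAt_id t).const_mul (3 * (v : ℝ) ^ 2)).add
        (((hasDerivAt_id t).pow 3).const_mul ((v : ℝ) ^ 3))
      convert! this using 1
      · ext x; simp; ring
      · simp; ring)
  simp only [Function.iterate_succ, Function.iterate_zero, Function.comp, id]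
  rw [e0, e1, e2, e3, e4]
  simp

/-- The fourth moment of a centred real Gaussian variable. -/
lemma HasGaussianLaw.integral_pow_four {μ : Measure Ω} {Z : Ω → ℝ} (hZ : HasGaussianLaw Z μ)
    (h0 : ∫ x, Z x ∂μ = 0) : ∫ x, Z x ^ 4 ∂μ = 3 * (∫ x, Z x ^ 2 ∂μ) ^ 2 := by
  have hlaw := hZ.map_eq_gaussianReal
  have hm := hZ.aemeasurable
  have hvar : Var[Z; μ] = ∫ x, Z x ^ 2 ∂μ := variance_of_integral_eq_zero hm h0
  rw [h0, hvar] at hlaw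
  have h4 := integral_pow_four_gaussianReal (∫ x, Z x ^ 2 ∂μ).toNNReal
  rw [← hlaw, integral_map hm (by fun_prop),
    Real.coe_toNNReal _ (integral_nonneg fun x => sq_nonneg _)] at h4
  exact h4

/-- A linear combination of four values of a Gaussian process is Gaussian. -/
lemma hasGaussianLaw_linearCombination {X : ℕ → Ω → ℝ} {μ : Measure Ω}
    (hX : IsGaussianProcess X μ) (t : Fin 4 → ℕ) (u : Fin 4 → ℝ) :
    HasGaussianLaw (fun x => ∑ i, u i * X (t i) x) μ := by
  have h1 := (hX.comp_right t).smul u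
  have h2 := h1.hasGaussianLaw_fun_sum (I := Finset.univ)
  simpa using h2

/-- Isserlis' formula for the fourth-order moments of a centred Gaussian process. -/
lemma integral_mul_four {X : ℕ → Ω → ℝ} {μ : Measure Ω}
    (hX : IsGaussianProcess X μ) (h0 : ∀ t, ∫ x, X t x ∂μ = 0) (a b c d : ℕ) :
    ∫ x, X a x * X b x * (X c x * X d x) ∂μ =
      (∫ x, X a x * X b x ∂μ) * (∫ x, X c x * X d x ∂μ) +
      (∫ x, X a x * X c x ∂μ) * (∫ x, X b x * X d x ∂μ) +
      (∫ x, X a x * X d x ∂μ) * (∫ x, X b x * X c x ∂μ) := by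
  have hP := hX.isProbabilityMeasure
  have hLp : ∀ (t : ℕ) (p : ENNReal), p ≠ ⊤ → MemLp (X t) p μ :=
    fun t p hp => (hX.hasGaussianLaw_eval t).memLp hp
  have hint2 : ∀ s t, Integrable (fun x => X s x * X t x) μ :=
    fun s t => (hLp s 2 (by simp)).integrable_mul (hLp t 2 (by simp))
  have hcomb : ∀ u : Fin 4 → ℝ, ∃ Z : Ω → ℝ, (∀ x, Z x =
      u 0 * X a x + u 1 * X b x + u 2 * X c x + u 3 * X d x) ∧ Integrable (fun x => Z x ^ 4) μ ∧
      ∫ x, Z x ^ 4 ∂μ = 3 * (u 0 ^ 2 * (∫ x, X a x * X a x ∂μ) + u 1 ^ 2 * (∫ x, X b x * X b x ∂μ)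
        + u 2 ^ 2 * (∫ x, X c x * X c x ∂μ) + u 3 ^ 2 * (∫ x, X d x * X d x ∂μ)
        + 2 * (u 0 * u 1) * (∫ x, X a x * X b x ∂μ) + 2 * (u 0 * u 2) * (∫ x, X a x * X c x ∂μ)
        + 2 * (u 0 * u 3) * (∫ x, X a x * X d x ∂μ) + 2 * (u 1 * u 2) * (∫ x, X b x * X c x ∂μ)
        + 2 * (u 1 * u 3) * (∫ x, X b x * X d x ∂μ)
        + 2 * (u 2 * u 3) * (∫ x, X c x * X d x ∂μ)) ^ 2 := by
    intro u
    have hG := hasGaussianLaw_linearCombination hX ![a, b, c, d] u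
    simp only [Fin.sum_univ_four, Matrix.cons_val] at hG
    refine ⟨_, fun x => rfl, ?_, ?_⟩
    · have := (hG.memLp (p := 4) (by simp)).integrable_norm_pow (by norm_num)
      refine this.congr (Eventually.of_forall fun x => ?_)
      simp only [Real.norm_eq_abs]
      exact Even.pow_abs (by decide) _
    · have hint1 : ∀ s, Integrable (X s) μ := fun s => (hX.hasGaussianLaw_eval s).integrable
      rw [HasGaussianLaw.integral_pow_four hG ?_]
      · congr 2
        have : ∀ x, (u 0 * X a x + u 1 * X b x + u 2 * X c x + u 3 * X d x) ^ 2 =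
            u 0 ^ 2 * (X a x * X a x) + u 1 ^ 2 * (X b x * X b x)
            + u 2 ^ 2 * (X c x * X c x) + u 3 ^ 2 * (X d x * X d x)
            + 2 * (u 0 * u 1) * (X a x * X b x) + 2 * (u 0 * u 2) * (X a x * X c x)
            + 2 * (u 0 * u 3) * (X a x * X d x) + 2 * (u 1 * u 2) * (X b x * X c x)
            + 2 * (u 1 * u 3) * (X b x * X d x) + 2 * (u 2 * u 3) * (X c x * X d x) := by
          intro x; ring
        simp_rw [this]
        have hc : ∀ (r : ℝ) s t, Integrable (fun x => r * (X s x * X t x)) μ :=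
          fun r s t => (hint2 s t).const_mul r
        rw [integral_add (by fun_prop) (hc _ _ _), integral_add (by fun_prop) (hc _ _ _),
          integral_add (by fun_prop) (hc _ _ _), integral_add (by fun_prop) (hc _ _ _),
          integral_add (by fun_prop) (hc _ _ _), integral_add (by fun_prop) (hc _ _ _),
          integral_add (by fun_prop) (hc _ _ _), integral_add (by fun_prop) (hc _ _ _),
          integral_add (hc _ _ _) (hc _ _ _)]
        simp only [integral_const_mul]
      · have hc : ∀ (r : ℝ) s, Integrable (fun x => r * X s x) μ := fun r s => (hint1 s).const_mul r
        rw [integral_add (by fun_prop) (hc _ _), integral_add (by fun_prop) (hc _ _),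
          integral_add (hc _ _) (hc _ _)]
        simp [integral_const_mul, h0]
  -- Polarization: summing the fourth powers over the eight sign patterns with first sign +, each
  -- weighted by the product of its signs, leaves 8 · 24 = 192 times the product of the four
  -- variables.
  obtain ⟨Z0, hZ0, hi0, hv0⟩ := hcomb ![1, 1, 1, 1]
  obtain ⟨Z1, hZ1, hi1, hv1⟩ := hcomb ![1, 1, 1, -1]
  obtain ⟨Z2, hZ2, hi2, hv2⟩ := hcomb ![1, 1, -1, 1]
  obtain ⟨Z3, hZ3, hi3, hv3⟩ := hcomb ![1, -1, 1, 1]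
  obtain ⟨Z4, hZ4, hi4, hv4⟩ := hcomb ![1, 1, -1, -1]
  obtain ⟨Z5, hZ5, hi5, hv5⟩ := hcomb ![1, -1, 1, -1]
  obtain ⟨Z6, hZ6, hi6, hv6⟩ := hcomb ![1, -1, -1, 1]
  obtain ⟨Z7, hZ7, hi7, hv7⟩ := hcomb ![1, -1, -1, -1]
  have hpol : ∀ x, X a x * X b x * (X c x * X d x) = (1 / 192) *
      (Z0 x ^ 4 - Z1 x ^ 4 - Z2 x ^ 4 - Z3 x ^ 4 + Z4 x ^ 4 + Z5 x ^ 4 + Z6 x ^ 4 - Z7 x ^ 4) := by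
    intro x
    rw [hZ0, hZ1, hZ2, hZ3, hZ4, hZ5, hZ6, hZ7]
    simp only [Matrix.cons_val]
    ring
  simp_rw [hpol]
  rw [integral_const_mul, integral_sub (by fun_prop) hi7, integral_add (by fun_prop) hi6,
    integral_add (by fun_prop) hi5, integral_add (by fun_prop) hi4, integral_sub (by fun_prop) hi3,
    integral_sub (by fun_prop) hi2, integral_sub hi0 hi1, hv0, hv1, hv2, hv3, hv4, hv5, hv6, hv7]
  simp only [Matrix.cons_val]
  ring

/-! ### Quadratic forms of Gaussian processes -/

/-- Schur's bound for a symmetric quadratic form. -/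
lemma sum_mul_mul_le_of_sum_abs_le {ι : Type*} (I : Finset ι) (m : ι → ℝ) (A : ι → ι → ℝ) {B : ℝ}
    (hsymm : ∀ p q, A p q = A q p) (hB : ∀ p ∈ I, ∑ q ∈ I, |A p q| ≤ B) :
    ∑ p ∈ I, ∑ q ∈ I, m p * m q * A p q ≤ B * ∑ p ∈ I, m p ^ 2 := by
  have h1 : ∑ p ∈ I, ∑ q ∈ I, m p * m q * A p q ≤
      ∑ p ∈ I, ∑ q ∈ I, (m p ^ 2 * |A p q| / 2 + m q ^ 2 * |A q p| / 2) := by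
    refine Finset.sum_le_sum fun p _ => Finset.sum_le_sum fun q _ => ?_
    rw [hsymm q p]
    have h2 : m p * m q * A p q ≤ |m p * m q| * |A p q| := by
      rw [← abs_mul]; exact le_abs_self _
    have h3 : |m p * m q| ≤ (m p ^ 2 + m q ^ 2) / 2 := by
      rw [abs_le]; constructor <;> nlinarith [sq_nonneg (m p + m q), sq_nonneg (m p - m q)]
    nlinarith [abs_nonneg (A p q)]
  refine h1.trans ?_
  simp_rw [Finset.sum_add_distrib]
  rw [Finset.sum_comm (f := fun p q => m q ^ 2 * |A q p| / 2), ← Finset.sum_add_distrib,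
    Finset.mul_sum]
  refine Finset.sum_le_sum fun p hp => ?_
  rw [← Finset.sum_add_distrib]
  calc ∑ q ∈ I, (m p ^ 2 * |A p q| / 2 + m p ^ 2 * |A p q| / 2)
      = m p ^ 2 * ∑ q ∈ I, |A p q| := by
        rw [Finset.mul_sum]; exact Finset.sum_congr rfl fun q _ => by ring
    _ ≤ B * m p ^ 2 := by nlinarith [hB p hp, sq_nonneg (m p)]

/-- A centred quadratic form of a process. -/
noncomputable def centredQuadForm (μ : Measure Ω) (Y : ℕ → Ω → ℝ) (N : ℕ) (m : ℕ → ℕ → ℝ)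
    (x : Ω) : ℝ :=
  ∑ s ∈ Finset.range N, ∑ t ∈ Finset.range N, m s t * (Y s x * Y t x - ∫ y, Y s y * Y t y ∂μ)

lemma integrable_mul_of_isGaussianProcess {Y : ℕ → Ω → ℝ} {μ : Measure Ω}
    (hY : IsGaussianProcess Y μ) (s t : ℕ) : Integrable (fun x => Y s x * Y t x) μ :=
  have := hY.isProbabilityMeasure
  ((hY.hasGaussianLaw_eval s).memLp (p := 2) (by simp)).integrable_mul
    ((hY.hasGaussianLaw_eval t).memLp (p := 2) (by simp))

lemma memLp_mul_of_isGaussianProcess {Y : ℕ → Ω → ℝ} {μ : Measure Ω}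
    (hY : IsGaussianProcess Y μ) (s t : ℕ) : MemLp (fun x => Y s x * Y t x) 2 μ := by
  have h4 : ENNReal.HolderTriple 4 4 2 := ⟨by
    have : (4 : ENNReal) = 2 * 2 := by norm_num
    rw [this, ENNReal.mul_inv (by simp) (by simp), ← mul_two, mul_assoc,
      ENNReal.inv_mul_cancel (by simp) (by simp), mul_one]⟩
  exact MemLp.mul' (p := 4) (q := 4) ((hY.hasGaussianLaw_eval t).memLp (by simp))
    ((hY.hasGaussianLaw_eval s).memLp (by simp))

lemma memLp_centredQuadForm {Y : ℕ → Ω → ℝ} {μ : Measure Ω}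
    (hY : IsGaussianProcess Y μ) (N : ℕ) (m : ℕ → ℕ → ℝ) :
    MemLp (centredQuadForm μ Y N m) 2 μ := by
  have := hY.isProbabilityMeasure
  refine memLp_finsetSum _ fun s _ => memLp_finsetSum _ fun t _ => MemLp.const_mul ?_ _
  refine MemLp.sub ?_ (memLp_const _)
  exact memLp_mul_of_isGaussianProcess hY s t

lemma integral_centredQuadForm {Y : ℕ → Ω → ℝ} {μ : Measure Ω}
    (hY : IsGaussianProcess Y μ) (N : ℕ) (m : ℕ → ℕ → ℝ) :
    ∫ x, centredQuadForm μ Y N m x ∂μ = 0 := by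
  have := hY.isProbabilityMeasure
  have hi := integrable_mul_of_isGaussianProcess hY
  have hi' : ∀ s t, Integrable (fun x => m s t * (Y s x * Y t x - ∫ y, Y s y * Y t y ∂μ)) μ :=
    fun s t => ((hi s t).sub (integrable_const _)).const_mul _
  unfold centredQuadForm
  rw [integral_finsetSum _ fun s _ => integrable_finsetSum _ fun t _ => hi' s t]
  refine Finset.sum_eq_zero fun s _ => ?_
  rw [integral_finsetSum _ fun t _ => hi' s t]
  refine Finset.sum_eq_zero fun t _ => ?_
  rw [integral_const_mul, integral_sub (hi s t) (integrable_const _)]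
  simp

/-- Variance bound for a quadratic form of a Gaussian process with absolutely summable
covariances. -/
lemma integral_sq_centredQuadForm_le {Y : ℕ → Ω → ℝ} {μ : Measure Ω}
    (hY : IsGaussianProcess Y μ) (h0 : ∀ t, ∫ x, Y t x ∂μ = 0) (N : ℕ) (m : ℕ → ℕ → ℝ) {K : ℝ}
    (hK : ∀ s ∈ Finset.range N, ∑ t ∈ Finset.range N, |∫ x, Y s x * Y t x ∂μ| ≤ K) :
    ∫ x, centredQuadForm μ Y N m x ^ 2 ∂μ ≤
      2 * K ^ 2 * ∑ s ∈ Finset.range N, ∑ t ∈ Finset.range N, m s t ^ 2 := by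
  have := hY.isProbabilityMeasure
  have hi := integrable_mul_of_isGaussianProcess hY
  set σ : ℕ → ℕ → ℝ := fun s t => ∫ x, Y s x * Y t x ∂μ with hσ
  have hσs : ∀ s t, σ s t = σ t s := fun s t => by simp only [hσ, mul_comm]
  set W : ℕ × ℕ → Ω → ℝ := fun p x => Y p.1 x * Y p.2 x - σ p.1 p.2 with hW
  set I := Finset.range N ×ˢ Finset.range N with hI
  have hWL : ∀ p, MemLp (W p) 2 μ := by
    intro p
    refine MemLp.sub ?_ (memLp_const _)
    exact memLp_mul_of_isGaussianProcess hY p.1 p.2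
  have hWW : ∀ p q, Integrable (fun x => W p x * W q x) μ := fun p q =>
    (hWL p).integrable_mul (hWL q)
  have hWi : ∀ p, ∫ x, W p x ∂μ = 0 := by
    intro p
    simp only [hW]
    rw [integral_sub (hi _ _) (integrable_const _)]
    simp [hσ]
  -- Centring removes exactly the pairing σ p.1 p.2 * σ q.1 q.2 of Isserlis' formula, leaving the
  -- two cross pairings.
  have hcov : ∀ p q, ∫ x, W p x * W q x ∂μ =
      σ p.1 q.1 * σ p.2 q.2 + σ p.1 q.2 * σ p.2 q.1 := by
    intro p q
    have h1 : ∀ x, Y p.1 x * Y p.2 x * (Y q.1 x * Y q.2 x) =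
        W p x * W q x + (σ q.1 q.2 * W p x + σ p.1 p.2 * W q x + σ p.1 p.2 * σ q.1 q.2) := by
      intro x; simp only [hW]; ring
    have h2 := integral_mul_four hY h0 p.1 p.2 q.1 q.2
    have hWint : ∀ p, Integrable (W p) μ := fun p => (hWL p).integrable (by norm_num)
    simp_rw [h1] at h2
    have hA : Integrable (fun x => σ q.1 q.2 * W p x) μ := (hWint p).const_mul _
    have hB : Integrable (fun x => σ p.1 p.2 * W q x) μ := (hWint q).const_mul _
    have hAB : Integrable (fun x => σ q.1 q.2 * W p x + σ p.1 p.2 * W q x) μ := hA.add hB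
    have hABC : Integrable (fun x => σ q.1 q.2 * W p x + σ p.1 p.2 * W q x
        + σ p.1 p.2 * σ q.1 q.2) μ := hAB.add (integrable_const _)
    rw [integral_add (hWW p q) hABC,
      integral_add hAB (integrable_const _), integral_add hA hB, integral_const_mul,
      integral_const_mul, hWi, hWi] at h2
    simp only [mul_zero, zero_add, integral_const, probReal_univ, one_smul] at h2
    linarith
  have hsq : ∀ x, centredQuadForm μ Y N m x ^ 2 =
      ∑ p ∈ I, ∑ q ∈ I, m p.1 p.2 * m q.1 q.2 * (W p x * W q x) := by
    intro x
    have : centredQuadForm μ Y N m x = ∑ p ∈ I, m p.1 p.2 * W p x := by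
      rw [hI, Finset.sum_product]; rfl
    rw [this, sq, Finset.sum_mul_sum]
    exact Finset.sum_congr rfl fun p _ => Finset.sum_congr rfl fun q _ => by ring
  simp_rw [hsq]
  rw [integral_finsetSum _ fun p _ => integrable_finsetSum _ fun q _ => (hWW p q).const_mul _]
  have h1 : ∀ p ∈ I, ∫ x, ∑ q ∈ I, m p.1 p.2 * m q.1 q.2 * (W p x * W q x) ∂μ =
      ∑ q ∈ I, m p.1 p.2 * m q.1 q.2 * (σ p.1 q.1 * σ p.2 q.2 + σ p.1 q.2 * σ p.2 q.1) := by
    intro p _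
    rw [integral_finsetSum _ fun q _ => (hWW p q).const_mul _]
    exact Finset.sum_congr rfl fun q _ => by rw [integral_const_mul, hcov]
  rw [Finset.sum_congr rfl h1, ← Finset.sum_product' (f := fun s t => m s t ^ 2)]
  refine sum_mul_mul_le_of_sum_abs_le I (fun p => m p.1 p.2)
    (fun p q => σ p.1 q.1 * σ p.2 q.2 + σ p.1 q.2 * σ p.2 q.1) ?_ ?_
  · intro p q
    rw [hσs p.1 q.1, hσs p.2 q.2, hσs p.1 q.2, hσs p.2 q.1]; ring
  · intro p hp
    obtain ⟨hp1, hp2⟩ := Finset.mem_product.1 hp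
    have hS0 : ∀ s, 0 ≤ ∑ t ∈ Finset.range N, |σ s t| :=
      fun s => Finset.sum_nonneg fun _ _ => abs_nonneg _
    -- Summed over q, each cross pairing factors into a product of two row sums of σ; two pairings
    -- give the Schur constant 2 K ^ 2.
    have hprod : (∑ t ∈ Finset.range N, |σ p.1 t|) * (∑ t ∈ Finset.range N, |σ p.2 t|) ≤ K ^ 2 := by
      rw [sq]
      exact mul_le_mul (hK _ hp1) (hK _ hp2) (hS0 _) ((hS0 _).trans (hK _ hp1))
    calc ∑ q ∈ I, |σ p.1 q.1 * σ p.2 q.2 + σ p.1 q.2 * σ p.2 q.1|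
        ≤ ∑ q ∈ I, (|σ p.1 q.1| * |σ p.2 q.2| + |σ p.1 q.2| * |σ p.2 q.1|) :=
          Finset.sum_le_sum fun q _ => by
            rw [← abs_mul, ← abs_mul]; exact abs_add_le _ _
      _ = 2 * ((∑ t ∈ Finset.range N, |σ p.1 t|) * (∑ t ∈ Finset.range N, |σ p.2 t|)) := by
          rw [Finset.sum_add_distrib, hI, Finset.sum_product, Finset.sum_product, two_mul,
            Finset.sum_mul_sum]
          congr 1
          rw [Finset.sum_comm]
      _ ≤ 2 * K ^ 2 := by linarith

end ModulatedSeries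

namespace ModulatedSeries

/-! ### Cosine series -/

lemma integral_cos_int_mul (n : ℤ) :
    ∫ y in (-Real.pi)..Real.pi, Real.cos (y * n) = if n = 0 then 2 * Real.pi else 0 := by
  split_ifs with h
  · subst h; simp; ring
  · have hn : (n : ℝ) ≠ 0 := by exact_mod_cast h
    have : ∀ y : ℝ, Real.cos (y * n) = Real.cos (n * y) := fun y => by rw [mul_comm]
    simp_rw [this]
    rw [intervalIntegral.integral_comp_mul_left (fun y => Real.cos y) hn, integral_cos,
      Real.sin_int_mul_pi, mul_neg, Real.sin_neg, Real.sin_int_mul_pi]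
    simp

lemma integral_cos_mul_cos (n k : ℤ) :
    ∫ y in (-Real.pi)..Real.pi, Real.cos (y * n) * Real.cos (y * k) =
      (if n = k then Real.pi else 0) + (if n = -k then Real.pi else 0) := by
  have h : ∀ y : ℝ, Real.cos (y * n) * Real.cos (y * k) =
      (1 / 2) * Real.cos (y * (n - k : ℤ)) + (1 / 2) * Real.cos (y * (n + k : ℤ)) := by
    intro y
    push_cast
    rw [mul_sub, mul_add, Real.cos_sub, Real.cos_add]; ring
  simp_rw [h]
  rw [intervalIntegral.integral_add (Continuous.intervalIntegrable (by fun_prop) _ _)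
    (Continuous.intervalIntegrable (by fun_prop) _ _), intervalIntegral.integral_const_mul,
    intervalIntegral.integral_const_mul, integral_cos_int_mul, integral_cos_int_mul]
  simp only [sub_eq_zero, ← eq_neg_iff_add_eq_zero]
  split_ifs <;> ring

/-- The spectral density with autocovariance sequence `c`. -/
noncomputable def cosSeries (c : ℕ → ℝ) (ω : ℝ) : ℝ :=
  (1 / (2 * Real.pi)) * ∑' τ : ℤ, c τ.natAbs * Real.cos (ω * (τ : ℝ))

lemma summable_natAbs {c : ℕ → ℝ} (hc : Summable fun τ => |c τ|) :
    Summable fun τ : ℤ => |c τ.natAbs| :=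
  .of_nat_of_neg (by simpa using hc) (by simpa using hc)

/-- Termwise integration of a cosine series against a continuous function. -/
lemma hasSum_integral_cosSeries {c : ℕ → ℝ} (hc : Summable fun τ => |c τ|) {φ : ℝ → ℝ}
    (hφ : Continuous φ) (a b : ℝ) :
    HasSum (fun τ : ℤ => c τ.natAbs * ∫ y in a..b, Real.cos (y * τ) * φ y)
      (2 * Real.pi * ∫ y in a..b, cosSeries c y * φ y) := by
  have hc' := summable_natAbs hc
  have h := intervalIntegral.hasSum_integral_of_dominated_convergence (μ := volume) (a := a) (b := b)
    (F := fun (τ : ℤ) y => c τ.natAbs * (Real.cos (y * τ) * φ y))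
    (f := fun y => 2 * Real.pi * (cosSeries c y * φ y))
    (fun (τ : ℤ) y => |c τ.natAbs| * |φ y|)
    (fun τ => Continuous.aestronglyMeasurable (by fun_prop)) ?_ ?_ ?_ ?_
  · rw [intervalIntegral.integral_const_mul] at h
    simpa only [intervalIntegral.integral_const_mul] using h
  · intro τ
    refine Eventually.of_forall fun y _ => ?_
    rw [Real.norm_eq_abs, abs_mul, abs_mul]
    gcongr
    exact mul_le_of_le_one_left (abs_nonneg _) (Real.abs_cos_le_one _)
  · exact Eventually.of_forall fun y _ => hc'.mul_right _
  · simp_rw [tsum_mul_right]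
    exact Continuous.intervalIntegrable (by fun_prop) _ _
  · refine Eventually.of_forall fun y _ => ?_
    have hs : Summable fun τ : ℤ => c τ.natAbs * Real.cos (y * τ) := by
      refine Summable.of_norm_bounded hc' fun τ => ?_
      rw [Real.norm_eq_abs, abs_mul]
      exact mul_le_of_le_one_right (abs_nonneg _) (Real.abs_cos_le_one _)
    have := hs.hasSum.mul_right (φ y)
    convert! this using 1
    · ext τ; ring
    · simp only [cosSeries]
      field_simp

/-- Fourier inversion for cosine series. -/
lemma integral_cosSeries_mul_cos {c : ℕ → ℝ} (hc : Summable fun τ => |c τ|) (k : ℤ) :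
    ∫ y in (-Real.pi)..Real.pi, cosSeries c y * Real.cos (y * k) = c k.natAbs := by
  have h := hasSum_integral_cosSeries hc (φ := fun y => Real.cos (y * k)) (by fun_prop)
    (-Real.pi) Real.pi
  have h2 : HasSum (fun τ : ℤ => c τ.natAbs *
      ∫ y in (-Real.pi)..Real.pi, Real.cos (y * τ) * Real.cos (y * k))
      (Real.pi * c k.natAbs + Real.pi * c k.natAbs) := by
    -- The indices k and -k contribute π c each. For k = 0 they coincide and that one term counts
    -- twice, so no case split is needed.
    have := (hasSum_ite_eq k (Real.pi * c k.natAbs)).add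
      (hasSum_ite_eq (-k) (Real.pi * c k.natAbs))
    convert! this using 1
    ext τ
    rw [integral_cos_mul_cos]
    rw [mul_add]
    congr 1
    · split_ifs with h1
      · rw [h1, mul_comm]
      · simp
    · split_ifs with h1
      · rw [h1, Int.natAbs_neg, mul_comm]
      · simp
  have h3 := h.unique h2
  have := Real.pi_pos
  nlinarith

/-- The Fourier coefficients of a continuously differentiable function decay. -/
lemma mul_abs_integral_mul_cos_le {S : ℝ → ℝ} (hS : Differentiable ℝ S)
    (hS' : ContinuousOn (deriv S) (Set.Icc (-Real.pi) Real.pi)) {L : ℝ}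
    (hL : ∀ y ∈ Set.Icc (-Real.pi) Real.pi, |deriv S y| ≤ L) (k : ℤ) :
    |(k : ℝ)| * |∫ y in (-Real.pi)..Real.pi, S y * Real.cos (y * k)| ≤ 2 * Real.pi * L := by
  have hpi := Real.pi_pos
  have huIcc : Set.uIcc (-Real.pi) Real.pi = Set.Icc (-Real.pi) Real.pi :=
    Set.uIcc_of_le (by linarith)
  have hv : ∀ y : ℝ, HasDerivAt (fun y => Real.sin (y * k)) (Real.cos (y * k) * k) y := by
    intro y
    simpa using ((hasDerivAt_id y).mul_const (k : ℝ)).sin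
  -- Integration by parts against sin(k y): the boundary terms vanish because the sine does at ±π,
  -- so periodicity of S is not used.
  have h := intervalIntegral.integral_mul_deriv_eq_deriv_mul (a := -Real.pi) (b := Real.pi)
    (u := S) (u' := deriv S) (v := fun y => Real.sin (y * k)) (v' := fun y => Real.cos (y * k) * k)
    (fun y _ => (hS y).hasDerivAt) (fun y _ => hv y)
    (ContinuousOn.intervalIntegrable (huIcc ▸ hS'))
    (Continuous.intervalIntegrable (by fun_prop) _ _)
  have e1 : Real.sin (Real.pi * k) = 0 := by rw [mul_comm]; exact Real.sin_int_mul_pi k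
  have e2 : Real.sin (-Real.pi * k) = 0 := by rw [neg_mul, Real.sin_neg, e1, neg_zero]
  simp only [e1, e2, mul_zero, sub_zero, zero_sub] at h
  have h2 : ∫ y in (-Real.pi)..Real.pi, S y * (Real.cos (y * k) * k) =
      (∫ y in (-Real.pi)..Real.pi, S y * Real.cos (y * k)) * k := by
    rw [← intervalIntegral.integral_mul_const]
    congr 1; ext y; ring
  rw [h2] at h
  rw [mul_comm, ← abs_mul, h, abs_neg]
  have := intervalIntegral.norm_integral_le_of_norm_le_const (a := -Real.pi) (b := Real.pi)
    (f := fun y => deriv S y * Real.sin (y * k)) (C := L) (fun y hy => by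
      rw [Set.uIoc_of_le (by linarith)] at hy
      rw [Real.norm_eq_abs, abs_mul]
      exact (mul_le_of_le_one_right (abs_nonneg _) (Real.abs_sin_le_one _)).trans
        (hL y ⟨hy.1.le, hy.2⟩))
  rw [Real.norm_eq_abs] at this
  refine this.trans (le_of_eq ?_)
  rw [abs_of_pos (by linarith)]; ring

/-- A parametric cosine series whose coefficients are continuous in the parameter, and whose
frequency derivative is continuous, is jointly continuous. -/
lemma continuousOn_cosSeries {E : Type*} [TopologicalSpace E] {K : Set E} (hK : IsCompact K)
    {c : ℕ → E → ℝ} (hsum : ∀ γ ∈ K, Summable fun τ => |c τ γ|)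
    (hcont : ∀ τ, ContinuousOn (c τ) K)
    (hdiff : ∀ γ ∈ K, Differentiable ℝ (cosSeries fun τ => c τ γ))
    (hderiv : ContinuousOn (fun p : ℝ × E => deriv (cosSeries fun τ => c τ p.2) p.1)
      (Set.univ ×ˢ K)) :
    ContinuousOn (fun p : ℝ × E => cosSeries (fun τ => c τ p.2) p.1)
      (Set.Icc (-Real.pi) Real.pi ×ˢ K) := by
  have hpi := Real.pi_pos
  have hpi4 := Real.pi_lt_four
  -- Since π < 4, the interval [-5, 5] contains [-π, π + 1], which leaves room for difference
  -- quotients with step at most 1.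
  obtain ⟨L, hL⟩ := (isCompact_Icc (a := (-5 : ℝ)) (b := 5)).prod hK |>.exists_bound_of_continuousOn
    (hderiv.mono (Set.prod_mono (Set.subset_univ _) subset_rfl))
  have hL' : ∀ γ ∈ K, ∀ y ∈ Set.Icc (-5 : ℝ) 5, ‖deriv (cosSeries fun τ => c τ γ) y‖ ≤ L :=
    fun γ hγ y hy => hL (y, γ) ⟨hy, hγ⟩
  obtain ⟨L', hLL', hL'0⟩ : ∃ L' : NNReal, L ≤ L' ∧ 0 < L' :=
    ⟨L.toNNReal + 1, by push_cast; linarith [Real.le_coe_toNNReal L], by positivity⟩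
  have hlip : ∀ γ ∈ K, LipschitzOnWith L' (cosSeries fun τ => c τ γ) (Set.Icc (-5 : ℝ) 5) := by
    intro γ hγ
    refine Convex.lipschitzOnWith_of_nnnorm_deriv_le (𝕜 := ℝ) (fun y _ => hdiff γ hγ y) ?_
      (convex_Icc _ _)
    intro y hy
    exact_mod_cast (hL' γ hγ y hy).trans hLL'
  -- the primitives are continuous in the parameter
  have hprim : ∀ a b : ℝ,
      ContinuousOn (fun γ => ∫ y in a..b, cosSeries (fun τ => c τ γ) y) K := by
    intro a b
    obtain ⟨C, hC⟩ := hK.exists_bound_of_continuousOn (hcont 0)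
    have hdecay : ∀ γ ∈ K, ∀ k : ℤ, |(k : ℝ)| * |c k.natAbs γ| ≤ 2 * Real.pi * L := by
      intro γ hγ k
      have hsub : Set.Icc (-Real.pi) Real.pi ⊆ Set.Icc (-5 : ℝ) 5 :=
        Set.Icc_subset_Icc (by linarith) (by linarith)
      have hcd : ContinuousOn (deriv (cosSeries fun τ => c τ γ)) (Set.Icc (-Real.pi) Real.pi) :=
        hderiv.comp (f := fun y : ℝ => (y, γ)) (by fun_prop) (fun y _ => ⟨trivial, hγ⟩)
      have := mul_abs_integral_mul_cos_le (hdiff γ hγ) hcd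
        (fun y hy => hL' γ hγ y (hsub hy)) k
      rwa [integral_cosSeries_mul_cos (hsum γ hγ)] at this
    have heq : ∀ γ ∈ K, ∫ y in a..b, cosSeries (fun τ => c τ γ) y =
        (1 / (2 * Real.pi)) * ∑' τ : ℤ, c τ.natAbs γ * ∫ y in a..b, Real.cos (y * τ) := by
      intro γ hγ
      have := (hasSum_integral_cosSeries (hsum γ hγ) (φ := fun _ => 1) continuous_const a b).tsum_eq
      simp only [mul_one] at this
      rw [this]; field_simp
    refine ContinuousOn.congr ?_ heq
    -- Weierstrass test: for τ ≠ 0 the coefficient is at most 2πL/|τ| and the integral of the cosine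
    -- at most 2/|τ|. At τ = 0 the second summand of the majorant is 1/0 = 0, and the first takes
    -- over.
    refine continuousOn_const.mul (continuousOn_tsum
      (u := fun τ : ℤ => (if τ = 0 then C * |b - a| else 0) + 4 * Real.pi * L * (1 / (τ : ℝ) ^ 2))
      (fun τ => (hcont _).mul continuousOn_const) ?_ ?_)
    · refine Summable.add (hasSum_ite_eq 0 _).summable ?_
      exact (Real.summable_one_div_int_pow.2 one_lt_two).mul_left _
    · intro τ γ hγ
      rw [norm_mul]
      by_cases hτ : τ = 0
      · subst hτ
        simp only [Int.natAbs_zero, Int.cast_zero, mul_zero, Real.cos_zero,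
          intervalIntegral.integral_const, smul_eq_mul, mul_one, if_true, ne_eq,
          OfNat.ofNat_ne_zero, not_false_eq_true, zero_pow, div_zero, add_zero]
        exact mul_le_mul_of_nonneg_right (hC γ hγ) (norm_nonneg _)
      · have hτ' : (τ : ℝ) ≠ 0 := by exact_mod_cast hτ
        have hτp : 0 < |(τ : ℝ)| := abs_pos.2 hτ'
        rw [if_neg hτ, zero_add]
        have hint : ‖∫ y in a..b, Real.cos (y * τ)‖ ≤ 2 / |(τ : ℝ)| := by
          have : ∀ y : ℝ, Real.cos (y * τ) = Real.cos (τ * y) := fun y => by rw [mul_comm]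
          simp_rw [this]
          rw [intervalIntegral.integral_comp_mul_left (fun y => Real.cos y) hτ', integral_cos,
            smul_eq_mul, norm_mul, norm_inv, Real.norm_eq_abs, Real.norm_eq_abs, div_eq_inv_mul]
          gcongr
          have h1 := Real.abs_sin_le_one (τ * b)
          have h2 := Real.abs_sin_le_one (τ * a)
          exact (abs_sub _ _).trans (by linarith)
        have hc1 : ‖c τ.natAbs γ‖ ≤ 2 * Real.pi * L / |(τ : ℝ)| := by
          rw [le_div_iff₀ hτp, mul_comm]; exact hdecay γ hγ τ
        calc _ ≤ (2 * Real.pi * L / |(τ : ℝ)|) * (2 / |(τ : ℝ)|) :=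
              mul_le_mul hc1 hint (norm_nonneg _) ((norm_nonneg _).trans hc1)
          _ = 4 * Real.pi * L * (1 / (τ : ℝ) ^ 2) := by
              rw [← sq_abs (τ : ℝ)]; field_simp; ring
  -- difference quotients of the primitives approximate the series uniformly
  have hpt : ∀ ω ∈ Set.Icc (-Real.pi) Real.pi,
      ContinuousOn (fun γ => cosSeries (fun τ => c τ γ) ω) K := by
    intro ω hω
    refine continuousOn_of_uniform_approx_of_continuousOn fun u hu => ?_
    obtain ⟨ε, hε, hεu⟩ := Metric.mem_uniformity_dist.1 hu
    -- The mean of the series over [ω, ω + h] differs from its value at ω by at most L' h ≤ ε / 2,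
    -- uniformly in γ.
    set h : ℝ := min 1 (ε / (2 * L')) with hh
    have hL'p : (0 : ℝ) < L' := by exact_mod_cast hL'0
    have hhp : 0 < h := by positivity
    have hh1 : h ≤ 1 := min_le_left _ _
    refine ⟨fun γ => h⁻¹ * ∫ y in ω..(ω + h), cosSeries (fun τ => c τ γ) y,
      continuousOn_const.mul (hprim _ _), fun γ hγ => hεu ?_⟩
    have hcS : Continuous (cosSeries fun τ => c τ γ) := (hdiff γ hγ).continuous
    have e1 : cosSeries (fun τ => c τ γ) ω - h⁻¹ * ∫ y in ω..(ω + h), cosSeries (fun τ => c τ γ) y =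
        h⁻¹ * ∫ y in ω..(ω + h),
          (cosSeries (fun τ => c τ γ) ω - cosSeries (fun τ => c τ γ) y) := by
      rw [intervalIntegral.integral_sub (by simp) (hcS.intervalIntegrable _ _)]
      simp only [intervalIntegral.integral_const, add_sub_cancel_left, smul_eq_mul]
      field_simp
    have e2 : ‖∫ y in ω..(ω + h),
          (cosSeries (fun τ => c τ γ) ω - cosSeries (fun τ => c τ γ) y)‖ ≤ L' * h * |ω + h - ω| := by
      refine intervalIntegral.norm_integral_le_of_norm_le_const fun y hy => ?_
      rw [Set.uIoc_of_le (by linarith)] at hy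
      have := (hlip γ hγ).dist_le_mul ω ⟨by linarith [hω.1], by linarith [hω.2]⟩ y
        ⟨by linarith [hω.1, hy.1], by linarith [hω.2, hy.2]⟩
      rw [Real.dist_eq, Real.dist_eq] at this
      refine this.trans ?_
      gcongr
      rw [abs_sub_comm, abs_of_pos (by linarith [hy.1])]
      linarith [hy.2]
    rw [add_sub_cancel_left, abs_of_pos hhp] at e2
    rw [Real.dist_eq, e1, abs_mul, abs_inv, abs_of_pos hhp]
    rw [Real.norm_eq_abs] at e2
    calc _ ≤ h⁻¹ * (L' * h * h) := by gcongr
      _ = L' * h := by field_simp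
      _ ≤ L' * (ε / (2 * L')) := by gcongr; exact min_le_right _ _
      _ = ε / 2 := by field_simp
      _ < ε := by linarith
  -- Continuity in γ at each fixed ω becomes joint continuity because the Lipschitz constant in ω is
  -- common to all γ.
  exact continuousOn_prod_of_continuousOn_lipschitzOnWith _ L' hpt fun γ hγ =>
    (hlip γ hγ).mono (Set.Icc_subset_Icc (by linarith) (by linarith))

end ModulatedSeries

namespace ModulatedSeries

variable {Ω : Type*} [MeasurableSpace Ω]

/-! ### Smoothing kernel of a modulating sequence -/

/-- The kernel through which the expected periodogram smooths an even spectral density. -/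
noncomputable def modKernel (g : ℕ → ℝ) (N : ℕ) (ω y : ℝ) : ℝ :=
  (1 / (N : ℝ)) * ∑ s ∈ Finset.range N, ∑ t ∈ Finset.range N,
    g s * g t * Real.cos (ω * ((s : ℝ) - t)) * Real.cos (y * ((s : ℝ) - t))

lemma continuous_modKernel (g : ℕ → ℝ) (N : ℕ) (ω : ℝ) : Continuous (modKernel g N ω) := by
  unfold modKernel; fun_prop

/-- The product of cosines is the average of the cosines at ω + y and ω - y, and each resulting
double sum is the squared modulus of a trigonometric sum. -/
lemma modKernel_nonneg (g : ℕ → ℝ) (N : ℕ) (ω y : ℝ) : 0 ≤ modKernel g N ω y := by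
  refine mul_nonneg (by positivity) ?_
  have h1 := norm_sq_sum_mul_exp g N (ω + y)
  have h2 := norm_sq_sum_mul_exp g N (ω - y)
  have h3 : ∑ s ∈ Finset.range N, ∑ t ∈ Finset.range N,
      g s * g t * Real.cos (ω * ((s : ℝ) - t)) * Real.cos (y * ((s : ℝ) - t)) =
      (1 / 2) * (∑ s ∈ Finset.range N, ∑ t ∈ Finset.range N,
        g s * g t * Real.cos ((ω + y) * ((s : ℝ) - t)) +
      ∑ s ∈ Finset.range N, ∑ t ∈ Finset.range N,
        g s * g t * Real.cos ((ω - y) * ((s : ℝ) - t))) := by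
    rw [← Finset.sum_add_distrib, Finset.mul_sum]
    refine Finset.sum_congr rfl fun s _ => ?_
    rw [← Finset.sum_add_distrib, Finset.mul_sum]
    refine Finset.sum_congr rfl fun t _ => ?_
    rw [add_mul, sub_mul, Real.cos_add, Real.cos_sub]; ring
  rw [h3, ← h1, ← h2]
  positivity

/-- The smoothing of a function by the kernel of the modulating sequence. -/
noncomputable def kernelAvg (g : ℕ → ℝ) (N : ℕ) (f : ℝ → ℝ) (ω : ℝ) : ℝ :=
  ∫ y in (-Real.pi)..Real.pi, f y * modKernel g N ω y

lemma kernelAvg_eq_sum (g : ℕ → ℝ) (N : ℕ) {f : ℝ → ℝ} (hf : Continuous f) (ω : ℝ) :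
    kernelAvg g N f ω = (1 / (N : ℝ)) * ∑ s ∈ Finset.range N, ∑ t ∈ Finset.range N,
      g s * g t * Real.cos (ω * ((s : ℝ) - t)) *
        ∫ y in (-Real.pi)..Real.pi, f y * Real.cos (y * ((s : ℤ) - t : ℤ)) := by
  have h : ∀ y, f y * modKernel g N ω y = (1 / (N : ℝ)) * ∑ s ∈ Finset.range N,
      ∑ t ∈ Finset.range N, g s * g t * Real.cos (ω * ((s : ℝ) - t)) *
        (f y * Real.cos (y * ((s : ℤ) - t : ℤ))) := by
    intro y
    simp only [modKernel, Finset.mul_sum]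
    refine Finset.sum_congr rfl fun s _ => Finset.sum_congr rfl fun t _ => ?_
    push_cast
    ring
  unfold kernelAvg
  simp_rw [h]
  rw [intervalIntegral.integral_const_mul, intervalIntegral.integral_finsetSum]
  · congr 1
    refine Finset.sum_congr rfl fun s _ => ?_
    rw [intervalIntegral.integral_finsetSum]
    · simp_rw [intervalIntegral.integral_const_mul]
    · exact fun t _ => Continuous.intervalIntegrable (by fun_prop) _ _
  · exact fun s _ => Continuous.intervalIntegrable (by fun_prop) _ _

/-- Only the diagonal s = t survives integration over a period, so the mass of the kernel does not
depend on ω. -/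
lemma kernelAvg_const (g : ℕ → ℝ) (N : ℕ) (C ω : ℝ) :
    kernelAvg g N (fun _ => C) ω = C * (2 * Real.pi * sampleAutocov g N 0) := by
  rw [kernelAvg_eq_sum g N continuous_const]
  have : ∀ s ∈ Finset.range N, ∑ t ∈ Finset.range N,
      g s * g t * Real.cos (ω * ((s : ℝ) - t)) *
        ∫ y in (-Real.pi)..Real.pi, C * Real.cos (y * ((s : ℤ) - t : ℤ)) =
      C * (2 * Real.pi) * (g s * g (s + 0)) := by
    intro s hs
    rw [Finset.sum_eq_single s]
    · rw [intervalIntegral.integral_const_mul, integral_cos_int_mul]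
      simp; ring
    · intro t _ hts
      rw [intervalIntegral.integral_const_mul, integral_cos_int_mul, if_neg (by omega)]
      simp
    · exact fun h => absurd hs h
  rw [Finset.sum_congr rfl this, ← Finset.mul_sum]
  simp only [sampleAutocov, Nat.sub_zero]
  ring

lemma kernelAvg_mono (g : ℕ → ℝ) (N : ℕ) {f f' : ℝ → ℝ} (hf : Continuous f) (hf' : Continuous f')
    (h : ∀ y ∈ Set.Icc (-Real.pi) Real.pi, f y ≤ f' y) (ω : ℝ) :
    kernelAvg g N f ω ≤ kernelAvg g N f' ω := by
  have hk := continuous_modKernel g N ω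
  refine intervalIntegral.integral_mono_on (by linarith [Real.pi_pos])
    (Continuous.intervalIntegrable (by fun_prop) _ _)
    (Continuous.intervalIntegrable (by fun_prop) _ _) fun y hy => ?_
  exact mul_le_mul_of_nonneg_right (h y hy) (modKernel_nonneg g N ω y)

lemma kernelAvg_sub (g : ℕ → ℝ) (N : ℕ) {f f' : ℝ → ℝ} (hf : Continuous f) (hf' : Continuous f')
    (ω : ℝ) : kernelAvg g N (fun y => f y - f' y) ω = kernelAvg g N f ω - kernelAvg g N f' ω := by
  have hk := continuous_modKernel g N ω
  unfold kernelAvg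
  simp_rw [sub_mul]
  exact intervalIntegral.integral_sub (Continuous.intervalIntegrable (by fun_prop) _ _)
    (Continuous.intervalIntegrable (by fun_prop) _ _)

lemma kernelAvg_const_mul (g : ℕ → ℝ) (N : ℕ) (r : ℝ) (f : ℝ → ℝ) (ω : ℝ) :
    kernelAvg g N (fun y => r * f y) ω = r * kernelAvg g N f ω := by
  unfold kernelAvg
  simp_rw [mul_assoc]
  exact intervalIntegral.integral_const_mul _ _

lemma kernelAvg_sum {ι : Type*} (I : Finset ι) (g : ℕ → ℝ) (N : ℕ) {f : ι → ℝ → ℝ}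
    (hf : ∀ i, Continuous (f i)) (ω : ℝ) :
    kernelAvg g N (fun y => ∑ i ∈ I, f i y) ω = ∑ i ∈ I, kernelAvg g N (f i) ω := by
  have hk := continuous_modKernel g N ω
  unfold kernelAvg
  simp_rw [Finset.sum_mul]
  exact intervalIntegral.integral_finsetSum fun i _ =>
    Continuous.intervalIntegrable ((hf i).mul hk) _ _

lemma sampleAutocov_zero_le {g : ℕ → ℝ} {G : ℝ} (hg : ∀ t, |g t| ≤ G) (N : ℕ) :
    sampleAutocov g N 0 ≤ G ^ 2 := by
  have hG : 0 ≤ G := (abs_nonneg _).trans (hg 0)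
  rcases Nat.eq_zero_or_pos N with rfl | hN
  · simp [sampleAutocov]; positivity
  have hN' : (0 : ℝ) < N := by positivity
  calc _ ≤ (1 / (N : ℝ)) * ∑ t ∈ Finset.range N, G ^ 2 := by
        simp only [sampleAutocov, Nat.sub_zero, add_zero]
        gcongr with t _
        rw [← sq]
        exact sq_le_sq' (by linarith [neg_abs_le (g t), hg t]) ((le_abs_self _).trans (hg t))
    _ = G ^ 2 := by simp; field_simp

/-- Monotonicity compares f with the constants ±C, and the kernel has mass at most 2π G ^ 2. The
constant is free of N and ω: every uniform estimate on spectral densities passes to expected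
periodograms through this bound. -/
lemma abs_kernelAvg_le {g : ℕ → ℝ} {G : ℝ} (hg : ∀ t, |g t| ≤ G) (N : ℕ) {f : ℝ → ℝ}
    (hf : Continuous f) {C : ℝ} (hC : ∀ y ∈ Set.Icc (-Real.pi) Real.pi, |f y| ≤ C) (ω : ℝ) :
    |kernelAvg g N f ω| ≤ 2 * Real.pi * G ^ 2 * C := by
  have hpi := Real.pi_pos
  have hC0 : 0 ≤ C := (abs_nonneg _).trans (hC 0 ⟨by linarith, by linarith⟩)
  have h1 := kernelAvg_mono g N hf continuous_const (fun y hy => (abs_le.1 (hC y hy)).2) ω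
  have h2 := kernelAvg_mono g N continuous_const hf (fun y hy => (abs_le.1 (hC y hy)).1) ω
  rw [kernelAvg_const] at h1 h2
  have h3 : C * (2 * Real.pi * sampleAutocov g N 0) ≤ 2 * Real.pi * G ^ 2 * C := by
    have := sampleAutocov_zero_le hg N
    calc _ ≤ C * (2 * Real.pi * G ^ 2) := by gcongr
      _ = _ := by ring
  rw [abs_le]
  constructor <;> linarith

/-- The lag-zero sample autocovariance dominates the others. -/
lemma abs_sampleAutocov_le (g : ℕ → ℝ) (N τ : ℕ) :
    |sampleAutocov g N τ| ≤ sampleAutocov g N 0 := by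
  simp only [sampleAutocov, Nat.sub_zero, add_zero]
  rw [abs_mul, abs_of_nonneg (by positivity : (0 : ℝ) ≤ 1 / N)]
  gcongr
  have h1 : ∑ t ∈ Finset.range (N - τ), g t ^ 2 ≤ ∑ t ∈ Finset.range N, g t ^ 2 :=
    Finset.sum_le_sum_of_subset_of_nonneg (Finset.range_mono (Nat.sub_le _ _))
      fun _ _ _ => sq_nonneg _
  have h2 : ∑ t ∈ Finset.range (N - τ), g (t + τ) ^ 2 ≤ ∑ t ∈ Finset.range N, g t ^ 2 := by
    rcases le_total N τ with h | h
    · rw [Nat.sub_eq_zero_of_le h]; simp; exact Finset.sum_nonneg fun _ _ => sq_nonneg _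
    · have := Finset.sum_range_add_sum_Ico (fun t => g t ^ 2) h
      rw [Finset.sum_Ico_eq_sum_range] at this
      simp_rw [add_comm τ] at this
      linarith [Finset.sum_nonneg fun t (_ : t ∈ Finset.range τ) => sq_nonneg (g t)]
  calc _ ≤ ∑ t ∈ Finset.range (N - τ), |g t * g (t + τ)| := Finset.abs_sum_le_sum_abs _ _
    _ ≤ ∑ t ∈ Finset.range (N - τ), (g t ^ 2 / 2 + g (t + τ) ^ 2 / 2) := by
        refine Finset.sum_le_sum fun t _ => ?_
        rw [abs_le]
        constructor <;> nlinarith [sq_nonneg (g t + g (t + τ)), sq_nonneg (g t - g (t + τ))]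
    _ = (∑ t ∈ Finset.range (N - τ), g t ^ 2) / 2
        + (∑ t ∈ Finset.range (N - τ), g (t + τ) ^ 2) / 2 := by
        rw [Finset.sum_add_distrib, Finset.sum_div, Finset.sum_div]
    _ ≤ ∑ t ∈ Finset.range N, g t ^ 2 := by linarith
    _ = _ := Finset.sum_congr rfl fun t _ => by ring

/-! ### Moments of the periodogram -/

lemma periodogram_eq_sum {Ω : Type*} (Y : ℕ → Ω → ℝ) (N : ℕ) (ω : ℝ) (x : Ω) :
    periodogram Y N ω x = (1 / (N : ℝ)) * ∑ s ∈ Finset.range N, ∑ t ∈ Finset.range N,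
      Real.cos (ω * ((s : ℝ) - t)) * (Y s x * Y t x) := by
  rw [periodogram, norm_sq_sum_mul_exp (fun t => Y t x)]
  congr 1
  exact Finset.sum_congr rfl fun s _ => Finset.sum_congr rfl fun t _ => by ring

lemma periodogram_nonneg {Ω : Type*} (Y : ℕ → Ω → ℝ) (N : ℕ) (ω : ℝ) (x : Ω) : 0 ≤ periodogram Y N ω x := by
  unfold periodogram; positivity

lemma integrable_periodogram {Y : ℕ → Ω → ℝ} {μ : Measure Ω} (hY : IsGaussianProcess Y μ) (N : ℕ)
    (ω : ℝ) : Integrable (periodogram Y N ω) μ := by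
  have : periodogram Y N ω = fun x => (1 / (N : ℝ)) * ∑ s ∈ Finset.range N, ∑ t ∈ Finset.range N,
      Real.cos (ω * ((s : ℝ) - t)) * (Y s x * Y t x) := funext fun x => periodogram_eq_sum Y N ω x
  rw [this]
  exact (integrable_finsetSum _ fun s _ => integrable_finsetSum _ fun t _ =>
    (integrable_mul_of_isGaussianProcess hY s t).const_mul _).const_mul _

lemma integral_periodogram {Y : ℕ → Ω → ℝ} {μ : Measure Ω} (hY : IsGaussianProcess Y μ) (N : ℕ)
    (ω : ℝ) : ∫ x, periodogram Y N ω x ∂μ =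
      (1 / (N : ℝ)) * ∑ s ∈ Finset.range N, ∑ t ∈ Finset.range N,
        Real.cos (ω * ((s : ℝ) - t)) * ∫ x, Y s x * Y t x ∂μ := by
  have hi : ∀ s t : ℕ, Integrable (fun x => Real.cos (ω * ((s : ℝ) - t)) * (Y s x * Y t x)) μ :=
    fun s t => (integrable_mul_of_isGaussianProcess hY s t).const_mul _
  simp_rw [periodogram_eq_sum]
  rw [integral_const_mul, integral_finsetSum _ fun s _ => integrable_finsetSum _ fun t _ => hi s t]
  congr 1
  refine Finset.sum_congr rfl fun s _ => ?_
  rw [integral_finsetSum _ fun t _ => hi s t]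
  exact Finset.sum_congr rfl fun t _ => integral_const_mul _ _

lemma isGaussianProcess_modulate {X : ℕ → Ω → ℝ} {μ : Measure Ω} (hX : IsGaussianProcess X μ)
    (g : ℕ → ℝ) : IsGaussianProcess (modulate g X) μ :=
  hX.smul g

/-- The weighted mean of the centred periodogram over the Fourier frequencies. -/
noncomputable def periodogramDeviation (μ : Measure Ω) (Y : ℕ → Ω → ℝ) (N : ℕ) (h : ℤ → ℝ)
    (x : Ω) : ℝ :=
  (1 / (N : ℝ)) * ∑ j ∈ fourierIndices N,
    (periodogram Y N (fourierFreq N j) x - ∫ y, periodogram Y N (fourierFreq N j) y ∂μ) * h j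

lemma periodogramDeviation_eq {Y : ℕ → Ω → ℝ} {μ : Measure Ω} (hY : IsGaussianProcess Y μ) (N : ℕ)
    (h : ℤ → ℝ) (x : Ω) : periodogramDeviation μ Y N h x =
      centredQuadForm μ Y N (periodogramWeight N h) x := by
  have h1 : ∀ j ∈ fourierIndices N,
      (periodogram Y N (fourierFreq N j) x - ∫ y, periodogram Y N (fourierFreq N j) y ∂μ) * h j =
      ∑ s ∈ Finset.range N, ∑ t ∈ Finset.range N, (1 / (N : ℝ)) *
        (h j * Real.cos (fourierFreq N j * ((s : ℝ) - t))) *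
          (Y s x * Y t x - ∫ y, Y s y * Y t y ∂μ) := by
    intro j _
    rw [integral_periodogram hY, periodogram_eq_sum, ← mul_sub, ← Finset.sum_sub_distrib,
      Finset.mul_sum, Finset.sum_mul]
    refine Finset.sum_congr rfl fun s _ => ?_
    rw [← Finset.sum_sub_distrib, Finset.mul_sum, Finset.sum_mul]
    exact Finset.sum_congr rfl fun t _ => by ring
  rw [periodogramDeviation, Finset.sum_congr rfl h1, Finset.sum_comm, Finset.mul_sum]
  refine Finset.sum_congr rfl fun s _ => ?_
  rw [Finset.sum_comm, Finset.mul_sum]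
  refine Finset.sum_congr rfl fun t _ => ?_
  rw [← Finset.sum_mul, ← Finset.mul_sum, periodogramWeight]
  ring

/-- Chebyshev's inequality for the weighted mean of the centred periodogram. -/
lemma measure_le_abs_periodogramDeviation_le {Y : ℕ → Ω → ℝ} {μ : Measure Ω}
    (hY : IsGaussianProcess Y μ) (h0 : ∀ t, ∫ x, Y t x ∂μ = 0) {N : ℕ} (hN : 0 < N) {K : ℝ}
    (hK : ∀ s ∈ Finset.range N, ∑ t ∈ Finset.range N, |∫ x, Y s x * Y t x ∂μ| ≤ K)
    {h : ℤ → ℝ} {C : ℝ} (hC : ∀ j, |h j| ≤ C) {a : ℝ} (ha : 0 < a) :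
    μ {x | a ≤ |periodogramDeviation μ Y N h x|} ≤
      ENNReal.ofReal (2 * K ^ 2 * C ^ 2 / (N * a ^ 2)) := by
  have := hY.isProbabilityMeasure
  simp_rw [periodogramDeviation_eq hY]
  have hm := memLp_centredQuadForm hY N (periodogramWeight N h)
  have hch := meas_ge_le_variance_div_sq hm ha
  rw [integral_centredQuadForm hY] at hch
  simp only [sub_zero] at hch
  refine hch.trans (ENNReal.ofReal_le_ofReal ?_)
  rw [variance_of_integral_eq_zero hm.aemeasurable (integral_centredQuadForm hY _ _)]
  have h1 := integral_sq_centredQuadForm_le hY h0 N (periodogramWeight N h) hK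
  have h2 := sum_sq_periodogramWeight_le hN hC
  calc _ ≤ (2 * K ^ 2 * (C ^ 2 / N)) / a ^ 2 := by
        gcongr
        exact h1.trans (by gcongr)
    _ = _ := by
        have : (N : ℝ) ≠ 0 := by positivity
        field_simp

/-- The mean absolute deviation of the periodogram over the Fourier frequencies. -/
noncomputable def periodogramAbsDeviation (μ : Measure Ω) (Y : ℕ → Ω → ℝ) (N : ℕ) (x : Ω) : ℝ :=
  (1 / (N : ℝ)) * ∑ j ∈ fourierIndices N,
    |periodogram Y N (fourierFreq N j) x - ∫ y, periodogram Y N (fourierFreq N j) y ∂μ|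

lemma periodogramAbsDeviation_nonneg (μ : Measure Ω) (Y : ℕ → Ω → ℝ) (N : ℕ) (x : Ω) :
    0 ≤ periodogramAbsDeviation μ Y N x :=
  mul_nonneg (by positivity) (Finset.sum_nonneg fun _ _ => abs_nonneg _)

/-- Being pathwise, this bound also covers weights that depend on the outcome, where the variance
bound does not apply. -/
lemma abs_periodogramDeviation_le (μ : Measure Ω) (Y : ℕ → Ω → ℝ) (N : ℕ) {h : ℤ → ℝ} {C : ℝ}
    (hC : ∀ j, |h j| ≤ C) (x : Ω) :
    |periodogramDeviation μ Y N h x| ≤ C * periodogramAbsDeviation μ Y N x := by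
  rw [periodogramDeviation, periodogramAbsDeviation, abs_mul,
    abs_of_nonneg (by positivity : (0 : ℝ) ≤ 1 / N), mul_left_comm]
  gcongr
  refine (Finset.abs_sum_le_sum_abs _ _).trans ?_
  rw [Finset.mul_sum]
  refine Finset.sum_le_sum fun j _ => ?_
  rw [abs_mul, mul_comm C]
  gcongr
  exact hC j

lemma periodogramDeviation_add (μ : Measure Ω) (Y : ℕ → Ω → ℝ) (N : ℕ) (h h' : ℤ → ℝ) (x : Ω) :
    periodogramDeviation μ Y N (fun j => h j + h' j) x =
      periodogramDeviation μ Y N h x + periodogramDeviation μ Y N h' x := by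
  simp only [periodogramDeviation, mul_add, Finset.sum_add_distrib]

lemma periodogramDeviation_const_mul (μ : Measure Ω) (Y : ℕ → Ω → ℝ) (N : ℕ) (r : ℝ) (h : ℤ → ℝ)
    (x : Ω) : periodogramDeviation μ Y N (fun j => r * h j) x =
      r * periodogramDeviation μ Y N h x := by
  simp only [periodogramDeviation, Finset.mul_sum]
  exact Finset.sum_congr rfl fun j _ => by ring

lemma periodogramDeviation_sum {ι : Type*} (I : Finset ι) (μ : Measure Ω) (Y : ℕ → Ω → ℝ) (N : ℕ)
    (h : ι → ℤ → ℝ) (x : Ω) : periodogramDeviation μ Y N (fun j => ∑ i ∈ I, h i j) x =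
      ∑ i ∈ I, periodogramDeviation μ Y N (h i) x := by
  simp only [periodogramDeviation, Finset.mul_sum]
  rw [Finset.sum_comm]

/-- Markov's inequality for the mean absolute deviation of the periodogram. -/
lemma measure_le_periodogramAbsDeviation_le {Y : ℕ → Ω → ℝ} {μ : Measure Ω}
    (hY : IsGaussianProcess Y μ) {N : ℕ} (hN : 0 < N) {C : ℝ}
    (hC : ∀ ω, ∫ x, periodogram Y N ω x ∂μ ≤ C) {a : ℝ} (ha : 0 < a) :
    μ {x | a ≤ periodogramAbsDeviation μ Y N x} ≤ ENNReal.ofReal (2 * C / a) := by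
  have := hY.isProbabilityMeasure
  have hN' : (0 : ℝ) < N := by positivity
  have hi : ∀ ω, Integrable (fun x => |periodogram Y N ω x - ∫ y, periodogram Y N ω y ∂μ|) μ :=
    fun ω => ((integrable_periodogram hY N ω).sub (integrable_const _)).abs
  -- A nonnegative variable has mean absolute deviation at most twice its mean, so no second moment
  -- is needed.
  have hE : ∀ ω, ∫ x, |periodogram Y N ω x - ∫ y, periodogram Y N ω y ∂μ| ∂μ ≤ 2 * C := by
    intro ω
    calc _ ≤ ∫ x, (periodogram Y N ω x + ∫ y, periodogram Y N ω y ∂μ) ∂μ := by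
          refine integral_mono (hi ω) ((integrable_periodogram hY N ω).add (integrable_const _))
            fun x => ?_
          have h1 := periodogram_nonneg Y N ω x
          have h2 : 0 ≤ ∫ y, periodogram Y N ω y ∂μ := integral_nonneg (periodogram_nonneg Y N ω)
          rw [abs_le]; constructor <;> simp <;> linarith
      _ = 2 * ∫ y, periodogram Y N ω y ∂μ := by
          rw [integral_add (integrable_periodogram hY N ω) (integrable_const _)]
          simp; ring
      _ ≤ 2 * C := by linarith [hC ω]
  have hint : Integrable (periodogramAbsDeviation μ Y N) μ :=
    (integrable_finsetSum _ fun j _ => hi _).const_mul _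
  have hEint : ∫ x, periodogramAbsDeviation μ Y N x ∂μ ≤ 2 * C := by
    unfold periodogramAbsDeviation
    rw [integral_const_mul, integral_finsetSum _ fun j _ => hi _]
    calc _ ≤ (1 / (N : ℝ)) * (N * (2 * C)) := by
          gcongr
          exact sum_fourierIndices_le fun j => hE _
      _ = 2 * C := by field_simp
  have hmk := mul_meas_ge_le_integral_of_nonneg
    (Eventually.of_forall (periodogramAbsDeviation_nonneg μ Y N)) hint a
  rw [ENNReal.le_ofReal_iff_toReal_le (measure_ne_top _ _)
    (div_nonneg ((integral_nonneg (periodogramAbsDeviation_nonneg μ Y N)).trans hEint) ha.le),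
    le_div_iff₀ ha, mul_comm]
  exact hmk.trans hEint

/-! ### Stationary latent process -/

section Model

variable {d : ℕ} {P : EuclideanSpace ℝ (Fin d) → Measure Ω} {X : ℕ → Ω → ℝ}
  {γ : EuclideanSpace ℝ (Fin d)}

lemma IsStationaryGaussian.integral_mul (hX : IsStationaryGaussian X (P γ)) (s t : ℕ) :
    ∫ x, X s x * X t x ∂(P γ) = autocov P X ((s : ℤ) - t).natAbs γ := by
  rcases le_total s t with h | h
  · obtain ⟨k, rfl⟩ := Nat.exists_eq_add_of_le h
    rw [hX.stationary, autocov]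
    congr 3; simp
  · obtain ⟨k, rfl⟩ := Nat.exists_eq_add_of_le h
    simp_rw [mul_comm (X (t + k) _)]
    rw [hX.stationary, autocov]
    congr 3; simp

lemma IsStationaryGaussian.integral_modulate_mul (hX : IsStationaryGaussian X (P γ)) (g : ℕ → ℝ)
    (s t : ℕ) : ∫ x, modulate g X s x * modulate g X t x ∂(P γ) =
      g s * g t * autocov P X ((s : ℤ) - t).natAbs γ := by
  rw [← hX.integral_mul, ← integral_const_mul]
  congr 1; ext x; simp only [modulate]; ring

lemma IsStationaryGaussian.integral_modulate (hX : IsStationaryGaussian X (P γ)) (g : ℕ → ℝ)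
    (t : ℕ) : ∫ x, modulate g X t x ∂(P γ) = 0 := by
  simp only [modulate]
  rw [integral_const_mul, hX.mean_zero, mul_zero]

lemma sum_abs_natAbs_le_tsum {c : ℕ → ℝ} (hc : Summable fun τ => |c τ|) (s N : ℕ) :
    ∑ t ∈ Finset.range N, |c ((s : ℤ) - t).natAbs| ≤ ∑' τ : ℤ, |c τ.natAbs| := by
  have hinj : Set.InjOn (fun t : ℕ => (s : ℤ) - t) (Finset.range N) := by
    intro a _ b _ h; simp at h; exact h
  rw [← Finset.sum_image (f := fun τ : ℤ => |c τ.natAbs|) hinj]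
  exact (summable_natAbs hc).sum_le_tsum _ fun _ _ => abs_nonneg _

/-- Short memory supplies the row-sum constant K of the variance bound, independent of N: along a
row the lags s - t are distinct integers. -/
lemma sum_abs_integral_modulate_le (hX : IsStationaryGaussian X (P γ))
    (hsum : Summable fun τ : ℕ => |autocov P X τ γ|) {g : ℕ → ℝ} {G : ℝ} (hg : ∀ t, |g t| ≤ G)
    (N s : ℕ) : ∑ t ∈ Finset.range N, |∫ x, modulate g X s x * modulate g X t x ∂(P γ)| ≤
      G ^ 2 * ∑' τ : ℤ, |autocov P X τ.natAbs γ| := by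
  have hG : 0 ≤ G := (abs_nonneg _).trans (hg 0)
  calc _ ≤ ∑ t ∈ Finset.range N, G ^ 2 * |autocov P X ((s : ℤ) - t).natAbs γ| := by
        refine Finset.sum_le_sum fun t _ => ?_
        rw [hX.integral_modulate_mul, abs_mul, abs_mul, sq]
        gcongr <;> exact hg _
    _ ≤ _ := by
        rw [← Finset.mul_sum]
        gcongr
        exact sum_abs_natAbs_le_tsum (c := fun τ => autocov P X τ γ) hsum s N

lemma expectedPeriodogram_eq_sum (hX : IsStationaryGaussian X (P γ)) (g : ℕ → ℝ) (N : ℕ) (ω : ℝ) :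
    expectedPeriodogram P X g N ω γ = (1 / (N : ℝ)) * ∑ s ∈ Finset.range N,
      ∑ t ∈ Finset.range N, g s * g t * Real.cos (ω * ((s : ℝ) - t)) *
        autocov P X ((s : ℤ) - t).natAbs γ := by
  rw [expectedPeriodogram, integral_periodogram (isGaussianProcess_modulate hX.gaussian g)]
  simp_rw [hX.integral_modulate_mul]
  congr 1
  exact Finset.sum_congr rfl fun s _ => Finset.sum_congr rfl fun t _ => by ring

/-- `spectralDensity` unfolds to `cosSeries` of the autocovariances, so this is Fourier inversion.
-/
lemma autocov_eq_integral (hsum : Summable fun τ : ℕ => |autocov P X τ γ|) (k : ℤ) :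
    autocov P X k.natAbs γ =
      ∫ y in (-Real.pi)..Real.pi, spectralDensity P X y γ * Real.cos (y * k) :=
  (integral_cosSeries_mul_cos (c := fun τ => autocov P X τ γ) hsum k).symm

/-- The expected periodogram is the spectral density smoothed by the kernel of the modulating
sequence. -/
lemma expectedPeriodogram_eq_kernelAvg (hX : IsStationaryGaussian X (P γ))
    (hsum : Summable fun τ : ℕ => |autocov P X τ γ|)
    (hS : Continuous fun y => spectralDensity P X y γ) (g : ℕ → ℝ) (N : ℕ) (ω : ℝ) :
    expectedPeriodogram P X g N ω γ = kernelAvg g N (fun y => spectralDensity P X y γ) ω := by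
  rw [expectedPeriodogram_eq_sum hX, kernelAvg_eq_sum g N hS]
  simp_rw [← autocov_eq_integral hsum]

end Model

end ModulatedSeries

namespace ModulatedSeries

/-! ### Uniform Taylor expansion and quantitative injectivity -/

/-- Continuity at a parameter value, uniformly over a compact set of frequencies. -/
lemma exists_forall_norm_sub_lt_of_continuousOn {E F : Type*} [NormedAddCommGroup E]
    [ProperSpace E] [SeminormedAddCommGroup F] {Φ : ℝ × E → F} {U : Set E} (hU : IsOpen U) {θ : E}
    (hθ : θ ∈ U) (hΦ : ContinuousOn Φ (Set.univ ×ˢ U)) {ε : ℝ} (hε : 0 < ε) :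
    ∃ δ > 0, Metric.ball θ δ ⊆ U ∧ ∀ y ∈ Set.Icc (-Real.pi) Real.pi, ∀ γ ∈ Metric.ball θ δ,
      ‖Φ (y, γ) - Φ (y, θ)‖ < ε := by
  obtain ⟨r, hr, hrU⟩ := Metric.nhds_basis_closedBall.mem_iff.1 (hU.mem_nhds hθ)
  have hK : IsCompact (Set.Icc (-Real.pi) Real.pi ×ˢ Metric.closedBall θ r) :=
    isCompact_Icc.prod (isCompact_closedBall θ r)
  have huc := hK.uniformContinuousOn_of_continuous
    (hΦ.mono (Set.prod_mono (Set.subset_univ _) hrU))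
  obtain ⟨δ, hδ, h⟩ := Metric.uniformContinuousOn_iff.1 huc ε hε
  refine ⟨min δ r, lt_min hδ hr,
    ((Metric.ball_subset_ball (min_le_right _ _)).trans Metric.ball_subset_closedBall).trans hrU,
    fun y hy γ hγ => ?_⟩
  have hγr : γ ∈ Metric.closedBall θ r :=
    Metric.ball_subset_closedBall (Metric.ball_subset_ball (min_le_right _ _) hγ)
  rw [← dist_eq_norm]
  refine h (y, γ) ⟨hy, hγr⟩ (y, θ) ⟨hy, Metric.mem_closedBall_self hr.le⟩ ?_
  rw [Prod.dist_eq, dist_self]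
  exact max_lt hδ ((Metric.mem_ball.1 hγ).trans_le (min_le_left _ _))

/-- Second-order Taylor expansion along a segment. -/
lemma abs_sub_taylor_two_le {E : Type*} [NormedAddCommGroup E] [NormedSpace ℝ E] {f : E → ℝ}
    {θ u : E} {f' : E → E →L[ℝ] ℝ} {f'' : E → E →L[ℝ] E →L[ℝ] ℝ} {ε : ℝ}
    (h1 : ∀ t ∈ Set.Icc (0 : ℝ) 1, HasFDerivAt f (f' (θ + t • u)) (θ + t • u))
    (h2 : ∀ t ∈ Set.Icc (0 : ℝ) 1, HasFDerivAt f' (f'' (θ + t • u)) (θ + t • u))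
    (hε : ∀ t ∈ Set.Icc (0 : ℝ) 1, ‖f'' (θ + t • u) - f'' θ‖ ≤ ε) :
    |f (θ + u) - f θ - f' θ u - (1 / 2) * f'' θ u u| ≤ ε * ‖u‖ ^ 2 := by
  have hε0 : 0 ≤ ε := (norm_nonneg (f'' (θ + (0 : ℝ) • u) - f'' θ)).trans
    (hε 0 ⟨le_rfl, zero_le_one⟩)
  have hline : ∀ t : ℝ, HasDerivAt (fun t : ℝ => θ + t • u) u t := by
    intro t
    simpa using ((hasDerivAt_id t).smul_const u).const_add θ
  -- The mean value inequality is applied twice: to χ₁, whose derivative is bounded by ε‖u‖², and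
  -- then to χ, whose derivative is χ₁. The factor 1/2 this loses in the remainder is immaterial.
  set χ₁ : ℝ → ℝ := fun t => f' (θ + t • u) u - f' θ u - t * f'' θ u u with hχ₁
  have hd1 : ∀ t ∈ Set.Icc (0 : ℝ) 1,
      HasDerivWithinAt χ₁ (f'' (θ + t • u) u u - f'' θ u u) (Set.Icc 0 1) t := by
    intro t ht
    have e1 : HasDerivAt (fun t : ℝ => f' (θ + t • u)) (f'' (θ + t • u) u) t :=
      (h2 t ht).comp_hasDerivAt t (hline t)
    have e2 : HasDerivAt (fun t : ℝ => f' (θ + t • u) u) (f'' (θ + t • u) u u) t := by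
      simpa using e1.clm_apply (hasDerivAt_const t u)
    have e3 : HasDerivAt (fun t : ℝ => t * f'' θ u u) (f'' θ u u) t := by
      simpa using (hasDerivAt_id t).mul_const (f'' θ u u)
    exact ((e2.sub_const _).sub e3).hasDerivWithinAt
  have hb1 : ∀ t ∈ Set.Icc (0 : ℝ) 1, ‖f'' (θ + t • u) u u - f'' θ u u‖ ≤ ε * ‖u‖ ^ 2 := by
    intro t ht
    have : f'' (θ + t • u) u u - f'' θ u u = (f'' (θ + t • u) - f'' θ) u u := by simp
    rw [this]
    calc _ ≤ ‖f'' (θ + t • u) - f'' θ‖ * ‖u‖ * ‖u‖ := ContinuousLinearMap.le_opNorm₂ _ _ _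
      _ ≤ ε * ‖u‖ * ‖u‖ := by gcongr; exact hε t ht
      _ = _ := by ring
  have hχ₁0 : χ₁ 0 = 0 := by simp [hχ₁]
  have hχ₁b : ∀ t ∈ Set.Icc (0 : ℝ) 1, ‖χ₁ t‖ ≤ ε * ‖u‖ ^ 2 := by
    intro t ht
    have := (convex_Icc (0 : ℝ) 1).norm_image_sub_le_of_norm_hasDerivWithin_le hd1 hb1
      (Set.left_mem_Icc.2 zero_le_one) ht
    rw [hχ₁0, sub_zero, sub_zero, Real.norm_eq_abs t, abs_of_nonneg ht.1] at this
    exact this.trans (mul_le_of_le_one_right (by positivity) ht.2)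
  set χ : ℝ → ℝ := fun t => f (θ + t • u) - t * f' θ u - t ^ 2 * ((1 / 2) * f'' θ u u) with hχ
  have hd : ∀ t ∈ Set.Icc (0 : ℝ) 1, HasDerivWithinAt χ (χ₁ t) (Set.Icc 0 1) t := by
    intro t ht
    have e1 : HasDerivAt (fun t : ℝ => f (θ + t • u)) (f' (θ + t • u) u) t :=
      (h1 t ht).comp_hasDerivAt t (hline t)
    have e2 : HasDerivAt (fun t : ℝ => t * f' θ u) (f' θ u) t := by
      simpa using (hasDerivAt_id t).mul_const (f' θ u)
    have e3 : HasDerivAt (fun t : ℝ => t ^ 2 * ((1 / 2) * f'' θ u u)) (t * f'' θ u u) t := by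
      have := ((hasDerivAt_id t).pow 2).mul_const ((1 / 2) * f'' θ u u)
      convert! this using 1
      simp; ring
    exact ((e1.sub e2).sub e3).hasDerivWithinAt
  have := (convex_Icc (0 : ℝ) 1).norm_image_sub_le_of_norm_hasDerivWithin_le hd hχ₁b
    (Set.left_mem_Icc.2 zero_le_one) (Set.right_mem_Icc.2 zero_le_one)
  simp only [hχ, one_smul, zero_smul, add_zero, zero_mul, sub_zero, one_mul, one_pow, ne_eq,
    OfNat.ofNat_ne_zero, not_false_eq_true, zero_pow, norm_one, mul_one, Real.norm_eq_abs] at this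
  convert! this using 2
  ring

/-- Second-order Taylor expansion in the parameter, uniformly over the frequencies. -/
lemma exists_uniform_taylor_two {E : Type*} [NormedAddCommGroup E] [NormedSpace ℝ E]
    [ProperSpace E] {S : ℝ → E → ℝ} {U : Set E} (hU : IsOpen U) {θ : E} (hθ : θ ∈ U)
    (hC2 : ∀ y, ContDiffOn ℝ 2 (S y) U)
    (hS2 : ContinuousOn (fun p : ℝ × E => fderiv ℝ (fderiv ℝ (S p.1)) p.2) (Set.univ ×ˢ U))
    {ε : ℝ} (hε : 0 < ε) :
    ∃ δ > 0, Metric.ball θ δ ⊆ U ∧ ∀ y ∈ Set.Icc (-Real.pi) Real.pi, ∀ u : E, ‖u‖ < δ →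
      |S y (θ + u) - S y θ - fderiv ℝ (S y) θ u - (1 / 2) * fderiv ℝ (fderiv ℝ (S y)) θ u u|
        ≤ ε * ‖u‖ ^ 2 := by
  obtain ⟨δ, hδ, hδU, h⟩ := exists_forall_norm_sub_lt_of_continuousOn
    (F := E →L[ℝ] E →L[ℝ] ℝ) hU hθ hS2 hε
  refine ⟨δ, hδ, hδU, fun y hy u hu => ?_⟩
  have hmem : ∀ t ∈ Set.Icc (0 : ℝ) 1, θ + t • u ∈ Metric.ball θ δ := by
    intro t ht
    rw [mem_ball_iff_norm, add_sub_cancel_left, norm_smul, Real.norm_eq_abs, abs_of_nonneg ht.1]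
    exact (mul_le_of_le_one_left (norm_nonneg _) ht.2).trans_lt hu
  refine abs_sub_taylor_two_le (f' := fderiv ℝ (S y)) (f'' := fderiv ℝ (fderiv ℝ (S y))) ?_ ?_ ?_
  · intro t ht
    exact (((hC2 y).differentiableOn (by norm_num)).differentiableAt
      (hU.mem_nhds (hδU (hmem t ht)))).hasFDerivAt
  · intro t ht
    have h1 : ContDiffOn ℝ 1 (fderiv ℝ (S y)) U :=
      (hC2 y).fderiv_of_isOpen hU (by norm_num)
    exact ((h1.differentiableOn (by norm_num)).differentiableAt
      (hU.mem_nhds (hδU (hmem t ht)))).hasFDerivAt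
  · intro t ht
    exact (h y hy _ (hmem t ht)).le

/-- An injective continuous map on a compact set with injective derivative at a point is bounded
below, at that point, by a multiple of the distance. -/
lemma exists_mul_norm_sub_le_of_injOn {E F : Type*} [NormedAddCommGroup E] [NormedSpace ℝ E]
    [FiniteDimensional ℝ E] [NormedAddCommGroup F] [NormedSpace ℝ F] {K : Set E}
    (hK : IsCompact K) {f : E → F} (hf : ContinuousOn f K) (hinj : Set.InjOn f K) {θ : E}
    (hθ : θ ∈ K) {f' : E →L[ℝ] F} (hf' : HasFDerivAt f f' θ) (hf'inj : Function.Injective f') :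
    ∃ κ > 0, ∀ γ ∈ K, κ * ‖γ - θ‖ ≤ ‖f γ - f θ‖ := by
  obtain ⟨C, hC, hanti⟩ := LinearMap.exists_antilipschitzWith (f' : E →ₗ[ℝ] F)
    (LinearMap.ker_eq_bot.2 hf'inj)
  have hCp : (0 : ℝ) < C := by exact_mod_cast hC
  have hlow : ∀ u, ‖u‖ ≤ C * ‖f' u‖ := fun u => by
    simpa using hanti.le_mul_dist u 0
  -- The derivative expands lengths by at least 1/C; a linearization error of half that leaves
  -- 1/(2C).
  have hev := (hasFDerivAt_iff_isLittleO.1 hf').def (c := 1 / (2 * C)) (by positivity)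
  obtain ⟨δ, hδ, hnear⟩ := Metric.eventually_nhds_iff.1 hev
  have hnear' : ∀ γ, dist γ θ < δ → 1 / (2 * C) * ‖γ - θ‖ ≤ ‖f γ - f θ‖ := by
    intro γ hγ
    have h1 := hnear hγ
    have h2 := hlow (γ - θ)
    have h3 : ‖f' (γ - θ)‖ ≤ ‖f γ - f θ‖ + ‖f γ - f θ - f' (γ - θ)‖ := by
      calc _ = ‖(f γ - f θ) - (f γ - f θ - f' (γ - θ))‖ := by congr 1; abel
        _ ≤ _ := norm_sub_le _ _
    have h4 : 1 / C * ‖γ - θ‖ ≤ ‖f' (γ - θ)‖ := by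
      rw [one_div, inv_mul_le_iff₀ hCp]; exact h2
    have h5 : 1 / C * ‖γ - θ‖ = 2 * (1 / (2 * C) * ‖γ - θ‖) := by field_simp
    linarith
  -- Away from θ, injectivity and compactness give ‖f γ - f θ‖ a positive minimum, which is compared
  -- with the bound 2R + 1 on ‖γ - θ‖; the 1 keeps the divisor positive.
  have hK' : IsCompact (K \ Metric.ball θ δ) := hK.diff Metric.isOpen_ball
  obtain ⟨R, hR⟩ := hK.isBounded.exists_norm_le
  have hRθ : ∀ γ ∈ K, ‖γ - θ‖ ≤ 2 * R + 1 := fun γ hγ =>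
    (norm_sub_le _ _).trans (by linarith [hR γ hγ, hR θ hθ])
  have hRp : 0 < 2 * R + 1 := by linarith [(norm_nonneg _).trans (hR θ hθ)]
  rcases (K \ Metric.ball θ δ).eq_empty_or_nonempty with he | hne
  · refine ⟨1 / (2 * C), by positivity, fun γ hγ => hnear' γ ?_⟩
    by_contra hcon
    exact Set.notMem_empty γ (he ▸ ⟨hγ, hcon⟩)
  · obtain ⟨γ₀, hγ₀, hmin⟩ := hK'.exists_isMinOn hne
      (f := fun γ => ‖f γ - f θ‖) ((hf.mono Set.sdiff_subset).sub continuousOn_const).norm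
    have hpos : 0 < ‖f γ₀ - f θ‖ := by
      rw [norm_pos_iff, sub_ne_zero]
      intro h
      have := hinj hγ₀.1 hθ h
      exact hγ₀.2 (this ▸ Metric.mem_ball_self hδ)
    refine ⟨min (1 / (2 * C)) (‖f γ₀ - f θ‖ / (2 * R + 1)), by positivity, fun γ hγ => ?_⟩
    by_cases h : dist γ θ < δ
    · exact (mul_le_mul_of_nonneg_right (min_le_left _ _) (norm_nonneg _)).trans (hnear' γ h)
    · calc _ ≤ ‖f γ₀ - f θ‖ / (2 * R + 1) * (2 * R + 1) := by
            gcongr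
            · exact min_le_right _ _
            · exact hRθ γ hγ
        _ = ‖f γ₀ - f θ‖ := by field_simp
        _ ≤ ‖f γ - f θ‖ := hmin ⟨hγ, h⟩

/-! ### Scalar inequalities -/

/-- Apply log x ≤ x - 1 at x = √r and double. Unlike a Taylor bound at r = 1, this holds for all r >
0. -/
lemma sub_one_sub_log_ge {r : ℝ} (hr : 0 < r) : (Real.sqrt r - 1) ^ 2 ≤ r - 1 - Real.log r := by
  have h1 : Real.log r = 2 * Real.log (Real.sqrt r) := by
    rw [Real.log_sqrt hr.le]; ring
  have h2 := Real.log_le_sub_one_of_pos (Real.sqrt_pos.2 hr)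
  have h3 := Real.sq_sqrt hr.le
  nlinarith

/-- The Whittle divergence dominates the squared distance. -/
lemma whittle_divergence_ge {lo hi s s₀ : ℝ} (hlo : 0 < lo) (hs : lo ≤ s) (hs' : s ≤ hi)
    (hs₀ : lo ≤ s₀) (hs₀' : s₀ ≤ hi) :
    1 / (hi ^ 2 * (Real.sqrt (hi / lo) + 1) ^ 2) * (s - s₀) ^ 2 ≤
      Real.log s - Real.log s₀ + s₀ / s - 1 := by
  have hsp : 0 < s := hlo.trans_le hs
  have hs₀p : 0 < s₀ := hlo.trans_le hs₀
  have hr : 0 < s₀ / s := by positivity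
  have h1 := sub_one_sub_log_ge hr
  rw [Real.log_div hs₀p.ne' hsp.ne'] at h1
  have hsq := Real.sq_sqrt hr.le
  -- This factorization converts (√(s₀/s) - 1)² back into (s - s₀)², at the cost of the factors
  -- bounded by hi and √(hi/lo) + 1.
  have h2 : s₀ / s - 1 = (Real.sqrt (s₀ / s) - 1) * (Real.sqrt (s₀ / s) + 1) := by
    nlinarith
  have h3 : Real.sqrt (s₀ / s) ≤ Real.sqrt (hi / lo) := by
    apply Real.sqrt_le_sqrt
    gcongr
    linarith
  have h4 : (s - s₀) ^ 2 = s ^ 2 * ((Real.sqrt (s₀ / s) - 1) ^ 2 * (Real.sqrt (s₀ / s) + 1) ^ 2) := by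
    rw [← mul_pow, ← h2]; field_simp; ring
  have hhi : 0 < hi := hsp.trans_le hs'
  have h5 : (s - s₀) ^ 2 ≤
      hi ^ 2 * ((Real.sqrt (s₀ / s) - 1) ^ 2 * (Real.sqrt (hi / lo) + 1) ^ 2) := by
    rw [h4]; gcongr
  have h6 : 1 / (hi ^ 2 * (Real.sqrt (hi / lo) + 1) ^ 2) * (s - s₀) ^ 2 ≤
      (Real.sqrt (s₀ / s) - 1) ^ 2 := by
    rw [one_div, inv_mul_le_iff₀ (by positivity)]
    linarith
  linarith

/-- Second-order expansion of the reciprocal. -/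
lemma abs_inv_sub_inv_sub_le {lo s s₀ l q C η : ℝ} (hlo : 0 < lo) (hs : lo ≤ s) (hs₀ : lo ≤ s₀)
    (hC : 0 ≤ C) (hη : 0 ≤ η) (hη1 : η ≤ 1) (ρ : ℝ)
    (hl : |l| ≤ C * η) (hq : |q| ≤ C * η ^ 2) (hR : |s - s₀ - l - q| ≤ ρ * η ^ 2) (hρ : ρ ≤ C) :
    |1 / s - 1 / s₀ - (-(l / s₀ ^ 2)) - (-(q / s₀ ^ 2) + l ^ 2 / s₀ ^ 3)| ≤
      (ρ / lo ^ 2 + 8 * C ^ 2 / lo ^ 3 * η + 27 * C ^ 3 / lo ^ 4 * η) * η ^ 2 := by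
  have hsp : 0 < s := hlo.trans_le hs
  have hs₀p : 0 < s₀ := hlo.trans_le hs₀
  set D := s - s₀ with hD
  have hη2 : η ^ 2 ≤ η := by nlinarith
  have hR' : |D - l - q| ≤ C * η ^ 2 := hR.trans (by gcongr)
  have hDl : |D - l| ≤ 2 * C * η ^ 2 := by
    calc |D - l| = |(D - l - q) + q| := by congr 1; ring
      _ ≤ _ := (abs_add_le _ _).trans (by linarith)
  have hDb : |D| ≤ 3 * C * η := by
    calc |D| = |(D - l) + l| := by congr 1; ring
      _ ≤ 2 * C * η ^ 2 + C * η := (abs_add_le _ _).trans (by linarith)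
      _ ≤ 2 * C * η + C * η := by gcongr
      _ = _ := by ring
  have hDl' : |D + l| ≤ 4 * C * η := (abs_add_le _ _).trans (by linarith)
  -- Exact geometric expansion 1/s = 1/s₀ - D/s₀² + D²/s₀³ - D³/(s₀³ s), with D² - l² written as (D
  -- - l)(D + l). The constants 8 = 2 · 4 and 27 = 3³ come from the bounds on D - l, D + l and D.
  have hid : 1 / s - 1 / s₀ - (-(l / s₀ ^ 2)) - (-(q / s₀ ^ 2) + l ^ 2 / s₀ ^ 3) =
      -((D - l - q) / s₀ ^ 2) + (D - l) * (D + l) / s₀ ^ 3 - D ^ 3 / (s₀ ^ 3 * s) := by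
    have : s = s₀ + D := by rw [hD]; ring
    have hne : s₀ + D ≠ 0 := this ▸ hsp.ne'
    rw [this]
    field_simp
    ring
  rw [hid]
  have t1 : |(D - l - q) / s₀ ^ 2| ≤ ρ * η ^ 2 / lo ^ 2 := by
    rw [abs_div, abs_of_pos (by positivity : 0 < s₀ ^ 2)]
    exact div_le_div₀ ((abs_nonneg _).trans hR) hR (by positivity) (by gcongr)
  have t2 : |(D - l) * (D + l) / s₀ ^ 3| ≤ (2 * C * η ^ 2) * (4 * C * η) / lo ^ 3 := by
    rw [abs_div, abs_mul, abs_of_pos (by positivity : 0 < s₀ ^ 3)]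
    gcongr
  have t3 : |D ^ 3 / (s₀ ^ 3 * s)| ≤ (3 * C * η) ^ 3 / (lo ^ 3 * lo) := by
    rw [abs_div, abs_pow, abs_of_pos (by positivity : 0 < s₀ ^ 3 * s)]
    gcongr
  calc _ ≤ |(D - l - q) / s₀ ^ 2| + |(D - l) * (D + l) / s₀ ^ 3| + |D ^ 3 / (s₀ ^ 3 * s)| := by
        refine (abs_sub _ _).trans ?_
        gcongr
        refine (abs_add_le _ _).trans ?_
        rw [abs_neg]
    _ ≤ ρ * η ^ 2 / lo ^ 2 + (2 * C * η ^ 2) * (4 * C * η) / lo ^ 3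
        + (3 * C * η) ^ 3 / (lo ^ 3 * lo) := by gcongr
    _ = _ := by field_simp; ring

end ModulatedSeries

namespace ModulatedSeries

/-! ### Discrete Fourier coefficients of expected periodograms -/

lemma sum_cos_mul_cos_fourierFreq {N : ℕ} (hN : 0 < N) (k l : ℤ) :
    ∑ j ∈ fourierIndices N, Real.cos (fourierFreq N j * k) * Real.cos (fourierFreq N j * l) =
      (1 / 2) * (if (N : ℤ) ∣ k - l then (N : ℝ) else 0)
        + (1 / 2) * (if (N : ℤ) ∣ k + l then (N : ℝ) else 0) := by
  rw [← sum_cos_fourierFreq hN, ← sum_cos_fourierFreq hN, Finset.mul_sum, Finset.mul_sum,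
    ← Finset.sum_add_distrib]
  refine Finset.sum_congr rfl fun j _ => ?_
  push_cast
  rw [mul_sub, mul_add, Real.cos_sub, Real.cos_add]
  ring

/-- The discrete Fourier coefficient at lag `τ` of a modulated expected periodogram; the last
term is due to aliasing. -/
lemma fourierCoeff_modulated (g a : ℕ → ℝ) {N τ : ℕ} (hτ : τ < N) :
    (1 / (N : ℝ)) * ∑ j ∈ fourierIndices N, ((1 / (N : ℝ)) * ∑ s ∈ Finset.range N,
      ∑ t ∈ Finset.range N, g s * g t * Real.cos (fourierFreq N j * ((s : ℝ) - t)) *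
        a ((s : ℤ) - t).natAbs) * Real.cos (fourierFreq N j * τ) =
    sampleAutocov g N τ * a τ +
      (1 / (N : ℝ)) * ∑ s ∈ Finset.Ico (N - τ) N, g s * g (s + τ - N) * a (N - τ) := by
  have hN : 0 < N := by omega
  have hN' : (N : ℝ) ≠ 0 := by positivity
  set b : ℕ → ℕ → ℝ := fun s t => g s * g t * a ((s : ℤ) - t).natAbs with hb
  have hbs : ∀ s t, b s t = b t s := by
    intro s t
    simp only [hb]
    rw [show ((s : ℤ) - t).natAbs = ((t : ℤ) - s).natAbs by omega]; ring
  have h1 : ∑ j ∈ fourierIndices N, ((1 / (N : ℝ)) * ∑ s ∈ Finset.range N,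
      ∑ t ∈ Finset.range N, g s * g t * Real.cos (fourierFreq N j * ((s : ℝ) - t)) *
        a ((s : ℤ) - t).natAbs) * Real.cos (fourierFreq N j * τ) =
      (1 / (N : ℝ)) * ∑ s ∈ Finset.range N, ∑ t ∈ Finset.range N, b s t *
        ∑ j ∈ fourierIndices N, Real.cos (fourierFreq N j * ((s : ℤ) - t : ℤ)) *
          Real.cos (fourierFreq N j * (τ : ℤ)) := by
    simp_rw [Finset.mul_sum, Finset.sum_mul]
    rw [Finset.sum_comm]
    refine Finset.sum_congr rfl fun s _ => ?_
    rw [Finset.sum_comm]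
    refine Finset.sum_congr rfl fun t _ => Finset.sum_congr rfl fun j _ => ?_
    simp only [hb]
    push_cast
    ring
  have h2 : ∑ s ∈ Finset.range N, ∑ t ∈ Finset.range N, b s t *
        ∑ j ∈ fourierIndices N, Real.cos (fourierFreq N j * ((s : ℤ) - t : ℤ)) *
          Real.cos (fourierFreq N j * (τ : ℤ)) =
      N * ∑ s ∈ Finset.range N, ∑ t ∈ Finset.range N,
        if (N : ℤ) ∣ (s : ℤ) - t + τ then b s t else 0 := by
    simp_rw [sum_cos_mul_cos_fourierFreq hN]
    -- Symmetry of b makes the congruences s - t ≡ τ and s - t ≡ -τ modulo N contribute equally, so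
    -- the two halves combine.
    have e1 : ∑ s ∈ Finset.range N, ∑ t ∈ Finset.range N, b s t *
        ((1 / 2) * (if (N : ℤ) ∣ (s : ℤ) - t - τ then (N : ℝ) else 0)) =
        ∑ s ∈ Finset.range N, ∑ t ∈ Finset.range N, b s t *
        ((1 / 2) * (if (N : ℤ) ∣ (s : ℤ) - t + τ then (N : ℝ) else 0)) := by
      rw [Finset.sum_comm]
      refine Finset.sum_congr rfl fun s _ => Finset.sum_congr rfl fun t _ => ?_
      rw [hbs t s]
      congr 2
      have : (N : ℤ) ∣ (t : ℤ) - s - τ ↔ (N : ℤ) ∣ (s : ℤ) - t + τ := by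
        rw [← dvd_neg]; ring_nf
      simp only [this]
    simp_rw [mul_add, Finset.sum_add_distrib]
    rw [e1, ← Finset.sum_add_distrib, Finset.mul_sum]
    refine Finset.sum_congr rfl fun s _ => ?_
    rw [← Finset.sum_add_distrib, Finset.mul_sum]
    refine Finset.sum_congr rfl fun t _ => ?_
    split_ifs <;> ring
  -- Exactly one t in the range meets the congruence: s + τ, or s + τ - N once that leaves the
  -- range. The wrapped pair sits at lag N - τ and is the aliasing term; truncated subtraction is
  -- harmless there because s ≥ N - τ.
  have h3 : ∀ s ∈ Finset.range N, (∑ t ∈ Finset.range N,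
      if (N : ℤ) ∣ (s : ℤ) - t + τ then b s t else 0) =
      if s < N - τ then b s (s + τ) else b s (s + τ - N) := by
    intro s hs
    have hsN := Finset.mem_range.1 hs
    have hdvd : ∀ t ∈ Finset.range N, (N : ℤ) ∣ (s : ℤ) - t + τ →
        (t : ℤ) = s + τ ∨ (t : ℤ) = s + τ - N := by
      intro t ht h
      have htN := Finset.mem_range.1 ht
      obtain ⟨q, hq⟩ := h
      have hq1 : q < 2 := by
        by_contra hcon
        have : (N : ℤ) * 2 ≤ N * q := by gcongr; omega
        omega
      have hq2 : -1 < q := by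
        by_contra hcon
        have : (N : ℤ) * q ≤ N * (-1) := by gcongr; omega
        omega
      have : q = 0 ∨ q = 1 := by omega
      rcases this with rfl | rfl
      · left; linarith
      · right; linarith
    split_ifs with hlt
    · rw [Finset.sum_eq_single (s + τ)]
      · rw [if_pos]; simp
      · intro t ht htne
        rw [if_neg]
        intro h
        have := hdvd t ht h
        have htN := Finset.mem_range.1 ht
        omega
      · intro h; simp at h; omega
    · rw [Finset.sum_eq_single (s + τ - N)]
      · rw [if_pos]
        rw [Nat.cast_sub (by omega)]
        exact ⟨1, by push_cast; ring⟩
      · intro t ht htne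
        rw [if_neg]
        intro h
        have := hdvd t ht h
        have htN := Finset.mem_range.1 ht
        omega
      · intro h; simp at h; omega
  rw [h1, h2, Finset.sum_congr rfl h3, ← Finset.sum_range_add_sum_Ico _ (Nat.sub_le N τ)]
  have h4 : ∀ s ∈ Finset.range (N - τ),
      (if s < N - τ then b s (s + τ) else b s (s + τ - N)) = g s * g (s + τ) * a τ := by
    intro s hs
    rw [if_pos (Finset.mem_range.1 hs)]
    simp only [hb]
    congr 2; push_cast; omega
  have h5 : ∀ s ∈ Finset.Ico (N - τ) N,
      (if s < N - τ then b s (s + τ) else b s (s + τ - N)) =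
        g s * g (s + τ - N) * a (N - τ) := by
    intro s hs
    have := Finset.mem_Ico.1 hs
    rw [if_neg (by omega)]
    simp only [hb]
    congr 2; omega
  rw [Finset.sum_congr rfl h4, Finset.sum_congr rfl h5, ← Finset.sum_mul, sampleAutocov]
  generalize ∑ s ∈ Finset.Ico (N - τ) N, g s * g (s + τ - N) * a (N - τ) = B
  field_simp

/-- The mean square over the Fourier frequencies dominates each discrete Fourier coefficient. -/
lemma sq_fourierCoeff_le {N : ℕ} (hN : 0 < N) (f : ℤ → ℝ) (τ : ℕ) :
    ((1 / (N : ℝ)) * ∑ j ∈ fourierIndices N, f j * Real.cos (fourierFreq N j * τ)) ^ 2 ≤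
      (1 / (N : ℝ)) * ∑ j ∈ fourierIndices N, f j ^ 2 := by
  have hN' : (0 : ℝ) < N := by positivity
  have h1 := sq_sum_le_card_mul_sum_sq (s := fourierIndices N)
    (f := fun j => f j * Real.cos (fourierFreq N j * τ))
  rw [card_fourierIndices] at h1
  have h2 : ∑ j ∈ fourierIndices N, (f j * Real.cos (fourierFreq N j * τ)) ^ 2 ≤
      ∑ j ∈ fourierIndices N, f j ^ 2 := by
    refine Finset.sum_le_sum fun j _ => ?_
    rw [mul_pow]
    exact mul_le_of_le_one_right (sq_nonneg _) (Real.cos_sq_le_one _)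
  calc _ = (1 / (N : ℝ)) ^ 2 *
        (∑ j ∈ fourierIndices N, f j * Real.cos (fourierFreq N j * τ)) ^ 2 := by rw [mul_pow]
    _ ≤ (1 / (N : ℝ)) ^ 2 * (N * ∑ j ∈ fourierIndices N, f j ^ 2) := by
        gcongr
        exact h1.trans (by gcongr)
    _ = _ := by field_simp

/-- Lower bound for the mean square of a modulated expected periodogram with coefficients `a`. -/
lemma mul_le_sqrt_mean_sq {g a : ℕ → ℝ} {G A b : ℝ} (hg : ∀ t, |g t| ≤ G) (hA : ∀ k, |a k| ≤ A)
    {N τ : ℕ} (hτ : τ < N) (hb : b ≤ |sampleAutocov g N τ|) {f : ℤ → ℝ}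
    (hf : ∀ j, f j = (1 / (N : ℝ)) * ∑ s ∈ Finset.range N,
      ∑ t ∈ Finset.range N, g s * g t * Real.cos (fourierFreq N j * ((s : ℝ) - t)) *
        a ((s : ℤ) - t).natAbs) :
    b * |a τ| - G ^ 2 * τ / N * A ≤
      Real.sqrt ((1 / (N : ℝ)) * ∑ j ∈ fourierIndices N, f j ^ 2) := by
  have hN : 0 < N := by omega
  have hN' : (0 : ℝ) < N := by positivity
  have hG : 0 ≤ G := (abs_nonneg _).trans (hg 0)
  have h1 := sq_fourierCoeff_le hN f τ
  have h2 := fourierCoeff_modulated g a hτ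
  simp_rw [← hf] at h2
  rw [h2] at h1
  have h3 := Real.abs_le_sqrt h1
  -- Only τ of the N indices wrap around, so aliasing is of order 1/N.
  have h4 : |(1 / (N : ℝ)) * ∑ s ∈ Finset.Ico (N - τ) N, g s * g (s + τ - N) * a (N - τ)| ≤
      G ^ 2 * τ / N * A := by
    rw [abs_mul, abs_of_pos (by positivity : 0 < 1 / (N : ℝ))]
    calc _ ≤ (1 / (N : ℝ)) * ∑ s ∈ Finset.Ico (N - τ) N, G * G * A := by
          gcongr
          refine (Finset.abs_sum_le_sum_abs _ _).trans (Finset.sum_le_sum fun s _ => ?_)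
          rw [abs_mul, abs_mul]
          gcongr
          · exact hg _
          · exact hg _
          · exact hA _
      _ = _ := by
          rw [Finset.sum_const, Nat.card_Ico, Nat.sub_sub_self hτ.le, nsmul_eq_mul]
          ring
  have h5 : b * |a τ| ≤ |sampleAutocov g N τ * a τ| := by
    rw [abs_mul]; gcongr
  have h6 : |sampleAutocov g N τ * a τ| ≤
      |sampleAutocov g N τ * a τ +
        (1 / (N : ℝ)) * ∑ s ∈ Finset.Ico (N - τ) N, g s * g (s + τ - N) * a (N - τ)| +
      |(1 / (N : ℝ)) * ∑ s ∈ Finset.Ico (N - τ) N, g s * g (s + τ - N) * a (N - τ)| := by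
    refine le_trans (le_of_eq ?_) (abs_sub _ _)
    congr 1; ring
  linarith

end ModulatedSeries

namespace ModulatedSeries

variable {Ω : Type*} [MeasurableSpace Ω] {d : ℕ}

/-! ### Regular parametric models -/

/-- A parametric model of stationary Gaussian processes with short memory whose spectral densities
are positive, continuously differentiable in the frequency, and twice continuously differentiable
in the parameter. -/
structure RegularModel (P : EuclideanSpace ℝ (Fin d) → Measure Ω) (X : ℕ → Ω → ℝ)
    (Θ : Set (EuclideanSpace ℝ (Fin d))) : Prop where
  isCompact : IsCompact Θ
  stationary : ∀ γ ∈ Θ, IsStationaryGaussian X (P γ)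
  summable : ∀ γ ∈ Θ, Summable fun τ : ℕ => |autocov P X τ γ|
  continuousOn_autocov : ∀ τ : ℕ, ContinuousOn (autocov P X τ) Θ
  pos : ∀ γ ∈ Θ, ∀ ω : ℝ, 0 < spectralDensity P X ω γ
  differentiable : ∀ γ ∈ Θ, Differentiable ℝ fun ω : ℝ => spectralDensity P X ω γ
  continuousOn_deriv : ContinuousOn
    (fun p : ℝ × EuclideanSpace ℝ (Fin d) => deriv (fun ω : ℝ => spectralDensity P X ω p.2) p.1)
    (Set.univ ×ˢ Θ)
  contDiffOn : ∀ ω : ℝ, ContDiffOn ℝ 2 (spectralDensity P X ω) (interior Θ)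
  continuousOn_fderiv : ContinuousOn
    (fun p : ℝ × EuclideanSpace ℝ (Fin d) => fderiv ℝ (spectralDensity P X p.1) p.2)
    (Set.univ ×ˢ interior Θ)
  continuousOn_fderiv_two : ContinuousOn
    (fun p : ℝ × EuclideanSpace ℝ (Fin d) => fderiv ℝ (fderiv ℝ (spectralDensity P X p.1)) p.2)
    (Set.univ ×ˢ interior Θ)

namespace RegularModel

variable {P : EuclideanSpace ℝ (Fin d) → Measure Ω} {X : ℕ → Ω → ℝ}
  {Θ : Set (EuclideanSpace ℝ (Fin d))} {θ : EuclideanSpace ℝ (Fin d)}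

lemma continuous_spectralDensity (M : RegularModel P X Θ) {γ : EuclideanSpace ℝ (Fin d)}
    (hγ : γ ∈ Θ) : Continuous fun y => spectralDensity P X y γ :=
  (M.differentiable γ hγ).continuous

/-- Joint continuity up to the boundary of Θ is not a field of `RegularModel`; it has to be
recovered from the autocovariances and the frequency derivative. -/
lemma continuousOn_spectralDensity (M : RegularModel P X Θ) :
    ContinuousOn (fun p : ℝ × EuclideanSpace ℝ (Fin d) => spectralDensity P X p.1 p.2)
      (Set.Icc (-Real.pi) Real.pi ×ˢ Θ) :=
  continuousOn_cosSeries (c := fun τ γ => autocov P X τ γ) M.isCompact M.summable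
    M.continuousOn_autocov M.differentiable M.continuousOn_deriv

lemma exists_bounds (M : RegularModel P X Θ) (hθ : θ ∈ Θ) :
    ∃ m > 0, ∃ B > 0, ∀ γ ∈ Θ, ∀ y ∈ Set.Icc (-Real.pi) Real.pi,
      m ≤ spectralDensity P X y γ ∧ spectralDensity P X y γ ≤ B := by
  have hpi := Real.pi_pos
  have hK := (isCompact_Icc (a := -Real.pi) (b := Real.pi)).prod M.isCompact
  have hne : (Set.Icc (-Real.pi) Real.pi ×ˢ Θ).Nonempty :=
    ⟨(0, θ), ⟨by linarith, by linarith⟩, hθ⟩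
  obtain ⟨p, hp, hmin⟩ := hK.exists_isMinOn hne M.continuousOn_spectralDensity
  obtain ⟨q, hq, hmax⟩ := hK.exists_isMaxOn hne M.continuousOn_spectralDensity
  exact ⟨_, M.pos p.2 hp.2 p.1, _, M.pos q.2 hq.2 q.1, fun γ hγ y hy =>
    ⟨hmin (Set.mk_mem_prod hy hγ), hmax (Set.mk_mem_prod hy hγ)⟩⟩

lemma exists_uniform_modulus (M : RegularModel P X Θ) {ε : ℝ} (hε : 0 < ε) :
    ∃ δ > 0, ∀ γ ∈ Θ, ∀ γ' ∈ Θ, dist γ γ' < δ → ∀ y ∈ Set.Icc (-Real.pi) Real.pi,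
      |spectralDensity P X y γ - spectralDensity P X y γ'| ≤ ε := by
  have huc := ((isCompact_Icc (a := -Real.pi) (b := Real.pi)).prod
    M.isCompact).uniformContinuousOn_of_continuous M.continuousOn_spectralDensity
  obtain ⟨δ, hδ, h⟩ := Metric.uniformContinuousOn_iff.1 huc ε hε
  refine ⟨δ, hδ, fun γ hγ γ' hγ' hd y hy => ?_⟩
  refine (h (y, γ) ⟨hy, hγ⟩ (y, γ') ⟨hy, hγ'⟩ ?_).le
  rw [Prod.dist_eq, dist_self]
  exact max_lt hδ hd

lemma continuous_fderiv (M : RegularModel P X Θ) (hθ : θ ∈ interior Θ) :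
    Continuous fun y => fderiv ℝ (spectralDensity P X y) θ :=
  continuousOn_univ.1 (M.continuousOn_fderiv.comp (f := fun y : ℝ => (y, θ)) (by fun_prop)
    fun _ _ => ⟨trivial, hθ⟩)

lemma continuous_fderiv_two (M : RegularModel P X Θ) (hθ : θ ∈ interior Θ) :
    Continuous fun y => fderiv ℝ (fderiv ℝ (spectralDensity P X y)) θ :=
  continuousOn_univ.1 (M.continuousOn_fderiv_two.comp (f := fun y : ℝ => (y, θ)) (by fun_prop)
    fun _ _ => ⟨trivial, hθ⟩)

/-- A common bound for the first two derivatives in the parameter. -/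
lemma exists_derivative_bound (M : RegularModel P X Θ) (hθ : θ ∈ interior Θ) :
    ∃ C > 0, ∀ y ∈ Set.Icc (-Real.pi) Real.pi, ‖fderiv ℝ (spectralDensity P X y) θ‖ ≤ C ∧
      ‖fderiv ℝ (fderiv ℝ (spectralDensity P X y)) θ‖ ≤ C := by
  obtain ⟨C₁, h₁⟩ := (isCompact_Icc (a := -Real.pi) (b := Real.pi)).exists_bound_of_continuousOn
    (M.continuous_fderiv hθ).continuousOn
  obtain ⟨C₂, h₂⟩ := (isCompact_Icc (a := -Real.pi) (b := Real.pi)).exists_bound_of_continuousOn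
    (E := EuclideanSpace ℝ (Fin d) →L[ℝ] EuclideanSpace ℝ (Fin d) →L[ℝ] ℝ)
    (M.continuous_fderiv_two hθ).continuousOn
  exact ⟨max 1 (max C₁ C₂), by positivity, fun y hy =>
    ⟨(h₁ y hy).trans (by simp), (h₂ y hy).trans (by simp)⟩⟩

lemma exists_taylor (M : RegularModel P X Θ) (hθ : θ ∈ interior Θ) {ε : ℝ} (hε : 0 < ε) :
    ∃ δ > 0, Metric.ball θ δ ⊆ interior Θ ∧ ∀ y ∈ Set.Icc (-Real.pi) Real.pi,
      ∀ u : EuclideanSpace ℝ (Fin d), ‖u‖ < δ →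
      |spectralDensity P X y (θ + u) - spectralDensity P X y θ
        - fderiv ℝ (spectralDensity P X y) θ u
        - (1 / 2) * fderiv ℝ (fderiv ℝ (spectralDensity P X y)) θ u u| ≤ ε * ‖u‖ ^ 2 :=
  exists_uniform_taylor_two isOpen_interior hθ M.contDiffOn M.continuousOn_fderiv_two hε

/-- First-order expansion in the parameter with quadratic remainder. -/
lemma exists_taylor_one (M : RegularModel P X Θ) (hθ : θ ∈ interior Θ) :
    ∃ δ > 0, ∃ C > 0, Metric.ball θ δ ⊆ interior Θ ∧ ∀ y ∈ Set.Icc (-Real.pi) Real.pi,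
      ∀ u : EuclideanSpace ℝ (Fin d), ‖u‖ < δ →
      |spectralDensity P X y (θ + u) - spectralDensity P X y θ
        - fderiv ℝ (spectralDensity P X y) θ u| ≤ C * ‖u‖ ^ 2 := by
  obtain ⟨δ, hδ, hsub, h⟩ := M.exists_taylor hθ one_pos
  obtain ⟨C, hC, hCb⟩ := M.exists_derivative_bound hθ
  refine ⟨δ, hδ, C + 1, by positivity, hsub, fun y hy u hu => ?_⟩
  have h1 := h y hy u hu
  have h2 : |fderiv ℝ (fderiv ℝ (spectralDensity P X y)) θ u u| ≤ C * ‖u‖ ^ 2 := by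
    calc _ ≤ ‖fderiv ℝ (fderiv ℝ (spectralDensity P X y)) θ‖ * ‖u‖ * ‖u‖ :=
          ContinuousLinearMap.le_opNorm₂ _ _ _
      _ ≤ C * ‖u‖ * ‖u‖ := by gcongr; exact (hCb y hy).2
      _ = _ := by ring
  have h3 : 0 ≤ C * ‖u‖ ^ 2 := by positivity
  rw [abs_le] at h1 h2 ⊢
  constructor <;> nlinarith [h1.1, h1.2, h2.1, h2.2]

/-- Within δ of θ the Taylor expansion gives slope Cδ + C'. Farther away the difference is at most B
≤ (B/δ)‖γ - θ‖, so neither convexity of Θ nor smoothness up to its boundary is needed. -/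
lemma exists_lipschitz (M : RegularModel P X Θ) (hθ : θ ∈ interior Θ) :
    ∃ C > 0, ∀ γ ∈ Θ, ∀ y ∈ Set.Icc (-Real.pi) Real.pi,
      |spectralDensity P X y γ - spectralDensity P X y θ| ≤ C * ‖γ - θ‖ := by
  obtain ⟨δ, hδ, C, hC, -, h⟩ := M.exists_taylor_one hθ
  obtain ⟨C', hC', hCb⟩ := M.exists_derivative_bound hθ
  obtain ⟨m, hm, B, hB, hmB⟩ := M.exists_bounds (interior_subset hθ)
  refine ⟨C * δ + C' + B / δ, by positivity, fun γ hγ y hy => ?_⟩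
  have hn := norm_nonneg (γ - θ)
  by_cases hd : ‖γ - θ‖ < δ
  · have h1 := h y hy (γ - θ) hd
    rw [add_sub_cancel] at h1
    have h2 : |fderiv ℝ (spectralDensity P X y) θ (γ - θ)| ≤ C' * ‖γ - θ‖ :=
      (ContinuousLinearMap.le_opNorm _ _).trans 
        (mul_le_mul_of_nonneg_right (hCb y hy).1 hn)
    calc _ = |(spectralDensity P X y γ - spectralDensity P X y θ
          - fderiv ℝ (spectralDensity P X y) θ (γ - θ))
          + fderiv ℝ (spectralDensity P X y) θ (γ - θ)| := by congr 1; ring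
      _ ≤ C * ‖γ - θ‖ ^ 2 + C' * ‖γ - θ‖ := (abs_add_le _ _).trans (by linarith)
      _ ≤ C * (δ * ‖γ - θ‖) + C' * ‖γ - θ‖ := by rw [sq]; gcongr
      _ = (C * δ + C') * ‖γ - θ‖ := by ring
      _ ≤ _ := mul_le_mul_of_nonneg_right (le_add_of_nonneg_right (by positivity)) hn
  · push Not at hd
    have h1 := hmB γ hγ y hy
    have h2 := hmB θ (interior_subset hθ) y hy
    calc |spectralDensity P X y γ - spectralDensity P X y θ| ≤ B := by
          rw [abs_le]; constructor <;> linarith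
      _ = B / δ * δ := by field_simp
      _ ≤ B / δ * ‖γ - θ‖ := by gcongr
      _ ≤ _ := mul_le_mul_of_nonneg_right (le_add_of_nonneg_left (by positivity)) hn

/-! ### Autocovariances as functions of the parameter -/

/-- Autocovariances inherit uniform bounds on spectral densities. -/
lemma abs_autocov_sub_le (M : RegularModel P X Θ) {γ γ' : EuclideanSpace ℝ (Fin d)} (hγ : γ ∈ Θ)
    (hγ' : γ' ∈ Θ) {C : ℝ} (hC : ∀ y ∈ Set.Icc (-Real.pi) Real.pi,
      |spectralDensity P X y γ - spectralDensity P X y γ'| ≤ C) (k : ℕ) :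
    |autocov P X k γ - autocov P X k γ'| ≤ 2 * Real.pi * C := by
  have hpi := Real.pi_pos
  have h1 := autocov_eq_integral (M.summable γ hγ) (k : ℤ)
  have h2 := autocov_eq_integral (M.summable γ' hγ') (k : ℤ)
  have c1 := M.continuous_spectralDensity hγ
  have c2 := M.continuous_spectralDensity hγ'
  rw [Int.natAbs_natCast] at h1 h2
  rw [h1, h2, ← intervalIntegral.integral_sub (Continuous.intervalIntegrable (by fun_prop) _ _)
    (Continuous.intervalIntegrable (by fun_prop) _ _)]
  have := intervalIntegral.norm_integral_le_of_norm_le_const (a := -Real.pi) (b := Real.pi)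
    (f := fun y => spectralDensity P X y γ * Real.cos (y * (k : ℤ))
      - spectralDensity P X y γ' * Real.cos (y * (k : ℤ))) (C := C) (fun y hy => by
      rw [Set.uIoc_of_le (by linarith)] at hy
      rw [← sub_mul, Real.norm_eq_abs, abs_mul]
      exact (mul_le_of_le_one_right (abs_nonneg _) (Real.abs_cos_le_one _)).trans
        (hC y ⟨hy.1.le, hy.2⟩))
  rw [Real.norm_eq_abs] at this
  refine this.trans (le_of_eq ?_)
  rw [abs_of_pos (by linarith)]; ring

/-- The autocovariances are differentiable in the parameter. -/
lemma exists_hasFDerivAt_autocov (M : RegularModel P X Θ) (hθ : θ ∈ interior Θ) (k : ℕ) :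
    ∃ J : EuclideanSpace ℝ (Fin d) →L[ℝ] ℝ, HasFDerivAt (autocov P X k) J θ := by
  have hpi := Real.pi_pos
  obtain ⟨δ, hδ, C, hC, hsub, h⟩ := M.exists_taylor_one hθ
  have hcA := M.continuous_fderiv hθ
  -- Differentiation under the Fourier inversion integral; the remainder is O(‖u‖²) uniformly in y,
  -- hence also after integration.
  refine ⟨∫ y in (-Real.pi)..Real.pi, Real.cos (y * (k : ℤ)) • fderiv ℝ (spectralDensity P X y) θ,
    ?_⟩
  have hint : IntervalIntegrable (fun y : ℝ => Real.cos (y * (k : ℤ)) •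
      fderiv ℝ (spectralDensity P X y) θ) volume (-Real.pi) Real.pi :=
    Continuous.intervalIntegrable ((by fun_prop : Continuous fun y : ℝ =>
      Real.cos (y * (k : ℤ))).smul hcA) _ _
  rw [hasFDerivAt_iff_isLittleO_nhds_zero]
  refine Asymptotics.IsBigO.trans_isLittleO (g := fun u : EuclideanSpace ℝ (Fin d) => ‖u‖ ^ 2) ?_ ?_
  · refine Asymptotics.IsBigO.of_bound (2 * Real.pi * C) ?_
    filter_upwards [Metric.ball_mem_nhds (0 : EuclideanSpace ℝ (Fin d)) hδ] with u hu
    rw [mem_ball_zero_iff] at hu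
    have hmem : θ + u ∈ Θ := interior_subset (hsub (by simpa using hu))
    have c1 := M.continuous_spectralDensity hmem
    have c2 := M.continuous_spectralDensity (interior_subset hθ)
    have c3 : Continuous fun y => fderiv ℝ (spectralDensity P X y) θ u :=
      hcA.clm_apply continuous_const
    have h1 := autocov_eq_integral (M.summable _ hmem) (k : ℤ)
    have h2 := autocov_eq_integral (M.summable θ (interior_subset hθ)) (k : ℤ)
    rw [Int.natAbs_natCast] at h1 h2
    rw [ContinuousLinearMap.intervalIntegral_apply hint, h1, h2,
      ← intervalIntegral.integral_sub (Continuous.intervalIntegrable (by fun_prop) _ _)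
        (Continuous.intervalIntegrable (by fun_prop) _ _),
      ← intervalIntegral.integral_sub (Continuous.intervalIntegrable (by fun_prop) _ _)
        (Continuous.intervalIntegrable (by
          simp only [smul_apply, smul_eq_mul]; fun_prop) _ _)]
    have := intervalIntegral.norm_integral_le_of_norm_le_const (a := -Real.pi) (b := Real.pi)
      (f := fun y => spectralDensity P X y (θ + u) * Real.cos (y * (k : ℤ))
        - spectralDensity P X y θ * Real.cos (y * (k : ℤ))
        - (Real.cos (y * (k : ℤ)) • fderiv ℝ (spectralDensity P X y) θ) u)
      (C := C * ‖u‖ ^ 2) (fun y hy => by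
        rw [Set.uIoc_of_le (by linarith)] at hy
        have e : spectralDensity P X y (θ + u) * Real.cos (y * (k : ℤ))
          - spectralDensity P X y θ * Real.cos (y * (k : ℤ))
          - (Real.cos (y * (k : ℤ)) • fderiv ℝ (spectralDensity P X y) θ) u =
          (spectralDensity P X y (θ + u) - spectralDensity P X y θ
            - fderiv ℝ (spectralDensity P X y) θ u) * Real.cos (y * (k : ℤ)) := by
          simp only [smul_apply, smul_eq_mul]; ring
        rw [e, Real.norm_eq_abs, abs_mul]
        exact (mul_le_of_le_one_right (abs_nonneg _) (Real.abs_cos_le_one _)).trans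
          (h y ⟨hy.1.le, hy.2⟩ u hu))
    refine this.trans (le_of_eq ?_)
    rw [abs_of_pos (by linarith), Real.norm_of_nonneg (by positivity)]; ring
  · have := Asymptotics.isLittleO_pow_id (𝕜 := ℝ) one_lt_two
    have h2 := this.comp_tendsto (tendsto_norm_zero (E := EuclideanSpace ℝ (Fin d)))
    exact h2.trans_isBigO (Asymptotics.isBigO_norm_left.2 (Asymptotics.isBigO_refl _ _))

lemma euclidean_eq_sum_single (u : EuclideanSpace ℝ (Fin d)) :
    u = ∑ j, u j • EuclideanSpace.single j (1 : ℝ) := by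
  ext k; simp [Finset.sum_apply, Pi.single_apply]

/-- Quantitative identifiability from the autocovariances. -/
lemma exists_separation (M : RegularModel P X Θ) (hθ : θ ∈ interior Θ) {τ : Fin d → ℕ}
    (hinj : Set.InjOn (fun γ => fun i => autocov P X (τ i) γ) Θ)
    (hJ : (autocovJacobian P X τ θ).det ≠ 0) :
    ∃ κ > 0, ∀ γ ∈ Θ, κ * ‖γ - θ‖ ≤ ‖fun i => autocov P X (τ i) γ - autocov P X (τ i) θ‖ := by
  choose J hJd using fun i => M.exists_hasFDerivAt_autocov hθ (τ i)
  have hd : HasFDerivAt (fun γ => fun i => autocov P X (τ i) γ) (ContinuousLinearMap.pi J) θ :=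
    hasFDerivAt_pi.2 hJd
  refine exists_mul_norm_sub_le_of_injOn M.isCompact
    (continuousOn_pi.2 fun i => M.continuousOn_autocov (τ i)) hinj (interior_subset hθ) hd ?_
  -- Fréchet differentiability identifies the line derivatives in the Jacobian matrix with the
  -- values of J on the basis, so nonsingularity is injectivity of the derivative.
  have hmat : ∀ u : EuclideanSpace ℝ (Fin d),
      ContinuousLinearMap.pi J u = (autocovJacobian P X τ θ).mulVec u.ofLp := by
    intro u
    ext i
    simp only [ContinuousLinearMap.coe_pi', Matrix.mulVec, dotProduct, autocovJacobian,
      Matrix.of_apply]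
    conv_lhs => rw [euclidean_eq_sum_single u]
    rw [map_sum]
    refine Finset.sum_congr rfl fun j _ => ?_
    rw [map_smul, smul_eq_mul, ((hJd i).hasLineDerivAt _).lineDeriv, mul_comm]
  rw [injective_iff_map_eq_zero]
  intro u hu
  rw [hmat] at hu
  have := Matrix.eq_zero_of_mulVec_eq_zero hJ hu
  ext i
  exact congrFun this i

end RegularModel

end ModulatedSeries

namespace ModulatedSeries

variable {Ω : Type*} [MeasurableSpace Ω] {d : ℕ}

namespace RegularModel

variable {P : EuclideanSpace ℝ (Fin d) → Measure Ω} {X : ℕ → Ω → ℝ}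
  {Θ : Set (EuclideanSpace ℝ (Fin d))} {θ : EuclideanSpace ℝ (Fin d)}

/-! ### Expected periodograms in a regular model -/

lemma expectedPeriodogram_eq (M : RegularModel P X Θ) {γ : EuclideanSpace ℝ (Fin d)} (hγ : γ ∈ Θ)
    (g : ℕ → ℝ) (N : ℕ) (ω : ℝ) :
    expectedPeriodogram P X g N ω γ = kernelAvg g N (fun y => spectralDensity P X y γ) ω :=
  expectedPeriodogram_eq_kernelAvg (M.stationary γ hγ) (M.summable γ hγ)
    (M.continuous_spectralDensity hγ) g N ω

lemma abs_expectedPeriodogram_sub_le (M : RegularModel P X Θ) {γ γ' : EuclideanSpace ℝ (Fin d)}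
    (hγ : γ ∈ Θ) (hγ' : γ' ∈ Θ) {g : ℕ → ℝ} {G : ℝ} (hg : ∀ t, |g t| ≤ G) {C : ℝ}
    (hC : ∀ y ∈ Set.Icc (-Real.pi) Real.pi,
      |spectralDensity P X y γ - spectralDensity P X y γ'| ≤ C) (N : ℕ) (ω : ℝ) :
    |expectedPeriodogram P X g N ω γ - expectedPeriodogram P X g N ω γ'| ≤
      2 * Real.pi * G ^ 2 * C := by
  have c1 := M.continuous_spectralDensity hγ
  have c2 := M.continuous_spectralDensity hγ'
  rw [M.expectedPeriodogram_eq hγ, M.expectedPeriodogram_eq hγ', ← kernelAvg_sub g N c1 c2]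
  exact abs_kernelAvg_le hg N (c1.sub c2) hC ω

/-- Uniform bounds for the expected periodograms. -/
lemma exists_expectedPeriodogram_bounds (M : RegularModel P X Θ) (hθ : θ ∈ Θ) {g : ℕ → ℝ} {G : ℝ}
    (hg : ∀ t, |g t| ≤ G) {b : ℝ} (hb : 0 < b) :
    ∃ lo > 0, ∃ hi, lo ≤ hi ∧ ∀ N, b ≤ sampleAutocov g N 0 → ∀ γ ∈ Θ, ∀ ω,
      lo ≤ expectedPeriodogram P X g N ω γ ∧ expectedPeriodogram P X g N ω γ ≤ hi := by
  have hpi := Real.pi_pos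
  obtain ⟨m, hm, B, hB, h⟩ := M.exists_bounds hθ
  -- The lower bound is the minimum m of the spectral density times the least kernel mass 2πb; the
  -- maximum in the upper bound only secures lo ≤ hi.
  refine ⟨m * (2 * Real.pi * b), by positivity,
    max (m * (2 * Real.pi * b)) (2 * Real.pi * G ^ 2 * B), le_max_left _ _,
    fun N hN γ hγ ω => ?_⟩
  have c1 := M.continuous_spectralDensity hγ
  rw [M.expectedPeriodogram_eq hγ]
  constructor
  · have h1 := kernelAvg_mono g N continuous_const c1 (fun y hy => (h γ hγ y hy).1) ω
    rw [kernelAvg_const] at h1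
    refine le_trans ?_ h1
    gcongr
  · refine le_trans ((le_abs_self _).trans (abs_kernelAvg_le hg N c1 (C := B) ?_ ω))
      (le_max_right _ _)
    intro y hy
    rw [abs_le]
    constructor <;> linarith [(h γ hγ y hy).1, (h γ hγ y hy).2]

/-- The expected periodograms separate the parameters in mean square. -/
lemma exists_mean_sq_separation (M : RegularModel P X Θ) (hθ : θ ∈ interior Θ) {g : ℕ → ℝ} {G : ℝ}
    (hg : ∀ t, |g t| ≤ G) {τ : Fin d → ℕ}
    (hinj : Set.InjOn (fun γ => fun i => autocov P X (τ i) γ) Θ)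
    (hJ : (autocovJacobian P X τ θ).det ≠ 0) {b : ℝ} (hb : 0 < b)
    (hbN : ∀ᶠ N in atTop, ∀ i, b ≤ |sampleAutocov g N (τ i)|) :
    ∃ c > 0, ∀ᶠ N : ℕ in atTop, ∀ γ ∈ Θ, c * ‖γ - θ‖ ^ 2 ≤ (1 / (N : ℝ)) * ∑ j ∈ fourierIndices N,
      (expectedPeriodogram P X g N (fourierFreq N j) γ
        - expectedPeriodogram P X g N (fourierFreq N j) θ) ^ 2 := by
  have hpi := Real.pi_pos
  have hθ' := interior_subset hθ
  obtain ⟨κ, hκ, hsep⟩ := M.exists_separation hθ hinj hJ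
  obtain ⟨C, hC, hlip⟩ := M.exists_lipschitz hθ
  set t₀ : ℕ := ∑ i, τ i with ht₀
  have hτ₀ : ∀ i, τ i ≤ t₀ := fun i => Finset.single_le_sum (fun _ _ => Nat.zero_le _)
    (Finset.mem_univ i)
  -- By the Lipschitz bound the aliasing error is proportional to ‖γ - θ‖. For large N it therefore
  -- uses up at most half of the separation bκ‖γ - θ‖, even for γ arbitrarily close to θ.
  have hsmall : ∀ᶠ N : ℕ in atTop, G ^ 2 * t₀ * (2 * Real.pi * C) / N ≤ b * κ / 2 :=
    (tendsto_const_div_atTop_nhds_zero_nat _).eventually (ge_mem_nhds (by positivity))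
  refine ⟨(b * κ / 2) ^ 2, by positivity, ?_⟩
  filter_upwards [hbN, hsmall, eventually_gt_atTop t₀] with N hN1 hN2 hN3 γ hγ
  have hNp : (0 : ℝ) < N := by
    have : 0 < N := by omega
    positivity
  set ms := (1 / (N : ℝ)) * ∑ j ∈ fourierIndices N,
      (expectedPeriodogram P X g N (fourierFreq N j) γ
        - expectedPeriodogram P X g N (fourierFreq N j) θ) ^ 2 with hms
  have hms0 : 0 ≤ ms := mul_nonneg (by positivity) (Finset.sum_nonneg fun _ _ => sq_nonneg _)
  set A := 2 * Real.pi * (C * ‖γ - θ‖) with hA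
  have hA0 : 0 ≤ A := by positivity
  have hdiff : ∀ j, expectedPeriodogram P X g N (fourierFreq N j) γ
        - expectedPeriodogram P X g N (fourierFreq N j) θ =
      (1 / (N : ℝ)) * ∑ s ∈ Finset.range N, ∑ t ∈ Finset.range N,
        g s * g t * Real.cos (fourierFreq N j * ((s : ℝ) - t)) *
          (fun k => autocov P X k γ - autocov P X k θ) ((s : ℤ) - t).natAbs := by
    intro j
    rw [expectedPeriodogram_eq_sum (M.stationary γ hγ), expectedPeriodogram_eq_sum
      (M.stationary θ hθ'), ← mul_sub, ← Finset.sum_sub_distrib]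
    congr 1
    refine Finset.sum_congr rfl fun s _ => ?_
    rw [← Finset.sum_sub_distrib]
    exact Finset.sum_congr rfl fun t _ => by ring
  have hcoef : ∀ i, |autocov P X (τ i) γ - autocov P X (τ i) θ| ≤
      (Real.sqrt ms + G ^ 2 * t₀ / N * A) / b := by
    intro i
    have := mul_le_sqrt_mean_sq hg (fun k => M.abs_autocov_sub_le hγ hθ' (hlip γ hγ) k)
      ((hτ₀ i).trans_lt hN3) (hN1 i) hdiff
    rw [le_div_iff₀ hb, mul_comm]
    have h2 : G ^ 2 * (τ i : ℝ) / N * A ≤ G ^ 2 * t₀ / N * A := by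
      gcongr
      exact_mod_cast hτ₀ i
    linarith
  have hG : 0 ≤ G := (abs_nonneg _).trans (hg 0)
  have hnorm : ‖fun i => autocov P X (τ i) γ - autocov P X (τ i) θ‖ ≤
      (Real.sqrt ms + G ^ 2 * t₀ / N * A) / b := by
    rw [pi_norm_le_iff_of_nonneg (by positivity)]
    exact hcoef
  have h1 := (hsep γ hγ).trans hnorm
  rw [le_div_iff₀ hb] at h1
  have h2 : G ^ 2 * t₀ / N * A = G ^ 2 * t₀ * (2 * Real.pi * C) / N * ‖γ - θ‖ := by
    rw [hA]; ring
  have h3 : G ^ 2 * t₀ / N * A ≤ b * κ / 2 * ‖γ - θ‖ := by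
    rw [h2]; gcongr
  have h4 : b * κ / 2 * ‖γ - θ‖ ≤ Real.sqrt ms := by nlinarith
  calc _ = (b * κ / 2 * ‖γ - θ‖) ^ 2 := by ring
    _ ≤ Real.sqrt ms ^ 2 := by gcongr
    _ = ms := Real.sq_sqrt hms0

/-! ### Expansion of the reciprocal expected periodogram -/

/-- The `i`-th partial derivative of the expected periodogram at `θ`. -/
noncomputable def avgGrad (P : EuclideanSpace ℝ (Fin d) → Measure Ω) (X : ℕ → Ω → ℝ)
    (θ : EuclideanSpace ℝ (Fin d)) (g : ℕ → ℝ) (N : ℕ) (ω : ℝ) (i : Fin d) : ℝ :=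
  kernelAvg g N (fun y => fderiv ℝ (spectralDensity P X y) θ (EuclideanSpace.single i 1)) ω

/-- The second partial derivatives of the expected periodogram at `θ`. -/
noncomputable def avgHess (P : EuclideanSpace ℝ (Fin d) → Measure Ω) (X : ℕ → Ω → ℝ)
    (θ : EuclideanSpace ℝ (Fin d)) (g : ℕ → ℝ) (N : ℕ) (ω : ℝ) (k : Fin d × Fin d) : ℝ :=
  kernelAvg g N (fun y => fderiv ℝ (fderiv ℝ (spectralDensity P X y)) θ
    (EuclideanSpace.single k.1 1) (EuclideanSpace.single k.2 1)) ω

/-- First-order coefficients of the reciprocal expected periodogram at `θ`. -/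
noncomputable def invGrad (P : EuclideanSpace ℝ (Fin d) → Measure Ω) (X : ℕ → Ω → ℝ)
    (θ : EuclideanSpace ℝ (Fin d)) (g : ℕ → ℝ) (N : ℕ) (ω : ℝ) (i : Fin d) : ℝ :=
  -(avgGrad P X θ g N ω i / expectedPeriodogram P X g N ω θ ^ 2)

/-- Second-order coefficients of the reciprocal expected periodogram at `θ`. -/
noncomputable def invHess (P : EuclideanSpace ℝ (Fin d) → Measure Ω) (X : ℕ → Ω → ℝ)
    (θ : EuclideanSpace ℝ (Fin d)) (g : ℕ → ℝ) (N : ℕ) (ω : ℝ) (k : Fin d × Fin d) : ℝ :=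
  -((1 / 2) * avgHess P X θ g N ω k / expectedPeriodogram P X g N ω θ ^ 2)
    + avgGrad P X θ g N ω k.1 * avgGrad P X θ g N ω k.2 / expectedPeriodogram P X g N ω θ ^ 3

/-- Coordinates detach the direction u, which will be random, from coefficients that are
deterministic. -/
lemma kernelAvg_fderiv (M : RegularModel P X Θ) (hθ : θ ∈ interior Θ) (g : ℕ → ℝ) (N : ℕ) (ω : ℝ)
    (u : EuclideanSpace ℝ (Fin d)) :
    kernelAvg g N (fun y => fderiv ℝ (spectralDensity P X y) θ u) ω =
      ∑ i, u i * avgGrad P X θ g N ω i := by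
  have hc := M.continuous_fderiv hθ
  have h : ∀ y, fderiv ℝ (spectralDensity P X y) θ u =
      ∑ i, u i * fderiv ℝ (spectralDensity P X y) θ (EuclideanSpace.single i 1) := by
    intro y
    conv_lhs => rw [euclidean_eq_sum_single u]
    simp only [map_sum, map_smul, smul_eq_mul]
  simp_rw [h]
  rw [kernelAvg_sum]
  · simp_rw [kernelAvg_const_mul]; rfl
  · exact fun i => continuous_const.mul (hc.clm_apply continuous_const)

lemma kernelAvg_fderiv_two (M : RegularModel P X Θ) (hθ : θ ∈ interior Θ) (g : ℕ → ℝ) (N : ℕ)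
    (ω : ℝ) (u : EuclideanSpace ℝ (Fin d)) :
    kernelAvg g N (fun y => fderiv ℝ (fderiv ℝ (spectralDensity P X y)) θ u u) ω =
      ∑ k : Fin d × Fin d, u k.1 * u k.2 * avgHess P X θ g N ω k := by
  have hc := M.continuous_fderiv_two hθ
  have h : ∀ y, fderiv ℝ (fderiv ℝ (spectralDensity P X y)) θ u u =
      ∑ k : Fin d × Fin d, u k.1 * u k.2 * fderiv ℝ (fderiv ℝ (spectralDensity P X y)) θ
        (EuclideanSpace.single k.1 1) (EuclideanSpace.single k.2 1) := by
    intro y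
    conv_lhs => rw [euclidean_eq_sum_single u]
    simp only [map_sum, map_smul, smul_eq_mul, sum_apply, smul_apply,
      Finset.mul_sum, Fintype.sum_prod_type]
    rw [Finset.sum_comm]
    exact Finset.sum_congr rfl fun i _ => Finset.sum_congr rfl fun j _ => by ring
  simp_rw [h]
  rw [kernelAvg_sum]
  · simp_rw [kernelAvg_const_mul]; rfl
  · exact fun k => continuous_const.mul
      ((hc.clm_apply continuous_const).clm_apply continuous_const)

/-- Uniform bounds for the coefficients of the expansion. -/
lemma exists_coeff_bound (M : RegularModel P X Θ) (hθ : θ ∈ interior Θ) {g : ℕ → ℝ} {G : ℝ}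
    (hg : ∀ t, |g t| ≤ G) {lo : ℝ} (hlo : 0 < lo) :
    ∃ C, ∀ N ω, lo ≤ expectedPeriodogram P X g N ω θ →
      (∀ i, |invGrad P X θ g N ω i| ≤ C) ∧ ∀ k, |invHess P X θ g N ω k| ≤ C := by
  have hpi := Real.pi_pos
  obtain ⟨C, hC, hCb⟩ := M.exists_derivative_bound hθ
  set C' := 2 * Real.pi * G ^ 2 * C with hC'
  have hC'0 : 0 ≤ C' := by positivity
  have hA : ∀ N ω i, |avgGrad P X θ g N ω i| ≤ C' := by
    intro N ω i
    refine abs_kernelAvg_le hg N ((M.continuous_fderiv hθ).clm_apply continuous_const)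
      (fun y hy => ?_) ω
    have h := ContinuousLinearMap.le_opNorm (fderiv ℝ (spectralDensity P X y) θ)
      (EuclideanSpace.single i (1 : ℝ))
    rw [PiLp.norm_single, norm_one, mul_one] at h
    exact h.trans (hCb y hy).1
  have hB : ∀ N ω k, |avgHess P X θ g N ω k| ≤ C' := by
    intro N ω k
    refine abs_kernelAvg_le hg N (((M.continuous_fderiv_two hθ).clm_apply
      continuous_const).clm_apply continuous_const) (fun y hy => ?_) ω
    have h := ContinuousLinearMap.le_opNorm₂ (fderiv ℝ (fderiv ℝ (spectralDensity P X y)) θ)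
      (EuclideanSpace.single k.1 (1 : ℝ)) (EuclideanSpace.single k.2 (1 : ℝ))
    rw [PiLp.norm_single, PiLp.norm_single, norm_one, mul_one, mul_one] at h
    exact h.trans (hCb y hy).2
  refine ⟨C' / lo ^ 2 + C' * C' / lo ^ 3, fun N ω hs => ⟨fun i => ?_, fun k => ?_⟩⟩
  · have hs0 : 0 < expectedPeriodogram P X g N ω θ := hlo.trans_le hs
    rw [invGrad, abs_neg, abs_div,
      abs_of_pos (by positivity : 0 < expectedPeriodogram P X g N ω θ ^ 2)]
    have h1 : |avgGrad P X θ g N ω i| / expectedPeriodogram P X g N ω θ ^ 2 ≤ C' / lo ^ 2 := by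
      gcongr; exact hA N ω i
    have h2 : 0 ≤ C' * C' / lo ^ 3 := by positivity
    linarith
  · have hs0 : 0 < expectedPeriodogram P X g N ω θ := hlo.trans_le hs
    rw [invHess]
    refine (abs_add_le _ _).trans ?_
    rw [abs_neg, abs_div, abs_div, abs_mul, abs_mul,
      abs_of_pos (by positivity : 0 < expectedPeriodogram P X g N ω θ ^ 2),
      abs_of_pos (by positivity : 0 < expectedPeriodogram P X g N ω θ ^ 3)]
    gcongr
    · rw [abs_of_pos (by norm_num : (0 : ℝ) < 1 / 2)]
      linarith [hB N ω k, abs_nonneg (avgHess P X θ g N ω k)]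
    · exact hA N ω _
    · exact hA N ω _

/-- Second-order expansion of the reciprocal expected periodogram, uniform in the sample size and
in the frequency. -/
lemma exists_inv_expansion (M : RegularModel P X Θ) (hθ : θ ∈ interior Θ) {g : ℕ → ℝ} {G : ℝ}
    (hg : ∀ t, |g t| ≤ G) {lo : ℝ} (hlo : 0 < lo) {ε : ℝ} (hε : 0 < ε) :
    ∃ δ > 0, ∀ N, (∀ γ ∈ Θ, ∀ ω, lo ≤ expectedPeriodogram P X g N ω γ) →
      ∀ γ ∈ Θ, ‖γ - θ‖ < δ → ∀ ω,
        |1 / expectedPeriodogram P X g N ω γ - 1 / expectedPeriodogram P X g N ω θ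
          - ∑ i, (γ - θ) i * invGrad P X θ g N ω i
          - ∑ k : Fin d × Fin d, (γ - θ) k.1 * (γ - θ) k.2 * invHess P X θ g N ω k| ≤
        ε * ‖γ - θ‖ ^ 2 := by
  have hpi := Real.pi_pos
  have hθ' := interior_subset hθ
  obtain ⟨C, hC, hCb⟩ := M.exists_derivative_bound hθ
  set G' := 2 * Real.pi * G ^ 2 with hG'
  have hG'0 : 0 ≤ G' := by positivity
  set C' := G' * C + 1 with hC'
  have hC'0 : 0 < C' := by positivity
  -- size of the remainder of the spectral densities
  set ε₁ := min 1 (ε * lo ^ 2 / 2) / (G' + 1) with hε₁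
  have hε₁p : 0 < ε₁ := by positivity
  have hGε : G' * ε₁ ≤ min 1 (ε * lo ^ 2 / 2) := by
    rw [hε₁, mul_div_assoc', div_le_iff₀ (by positivity), mul_comm]
    gcongr
    linarith
  obtain ⟨δ₀, hδ₀, -, htay⟩ := M.exists_taylor hθ hε₁p
  -- Q is the coefficient of the cubic terms in `abs_inv_sub_inv_sub_le`. Taking ‖u‖ ≤ ε/(2Q)
  -- charges them half of ε; the choice of ε₁ charges the Taylor remainder the other half.
  set Q := 8 * C' ^ 2 / lo ^ 3 + 27 * C' ^ 3 / lo ^ 4 with hQ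
  have hQp : 0 < Q := by positivity
  refine ⟨min (min δ₀ 1) (ε / (2 * Q)), by positivity, fun N hN γ hγ hd ω => ?_⟩
  set u := γ - θ with hu
  have hd0 : ‖u‖ < δ₀ := hd.trans_le ((min_le_left _ _).trans (min_le_left _ _))
  have hd1 : ‖u‖ ≤ 1 := hd.le.trans ((min_le_left _ _).trans (min_le_right _ _))
  have hd2 : ‖u‖ ≤ ε / (2 * Q) := hd.le.trans (min_le_right _ _)
  have hγu : θ + u = γ := by rw [hu]; abel
  have c1 := M.continuous_spectralDensity hγ
  have c2 := M.continuous_spectralDensity hθ'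
  have c3 : Continuous fun y => fderiv ℝ (spectralDensity P X y) θ u :=
    (M.continuous_fderiv hθ).clm_apply continuous_const
  have c4 : Continuous fun y => fderiv ℝ (fderiv ℝ (spectralDensity P X y)) θ u u :=
    ((M.continuous_fderiv_two hθ).clm_apply continuous_const).clm_apply continuous_const
  have c5 : Continuous fun y =>
      (1 / 2) * fderiv ℝ (fderiv ℝ (spectralDensity P X y)) θ u u := continuous_const.mul c4
  have c6 : Continuous fun y => spectralDensity P X y γ - spectralDensity P X y θ := c1.sub c2
  have c7 : Continuous fun y => spectralDensity P X y γ - spectralDensity P X y θ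
      - fderiv ℝ (spectralDensity P X y) θ u := c6.sub c3
  set s := expectedPeriodogram P X g N ω γ with hs
  set s₀ := expectedPeriodogram P X g N ω θ with hs₀
  set l := kernelAvg g N (fun y => fderiv ℝ (spectralDensity P X y) θ u) ω with hl
  set q := kernelAvg g N (fun y =>
    (1 / 2) * fderiv ℝ (fderiv ℝ (spectralDensity P X y)) θ u u) ω with hq
  have hlb : |l| ≤ C' * ‖u‖ := by
    refine (abs_kernelAvg_le hg N c3 (C := C * ‖u‖) (fun y hy => ?_) ω).trans ?_
    · exact (ContinuousLinearMap.le_opNorm _ _).trans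
        (mul_le_mul_of_nonneg_right (hCb y hy).1 (norm_nonneg u))
    · rw [hC', ← hG']; nlinarith [norm_nonneg u]
  have hqb : |q| ≤ C' * ‖u‖ ^ 2 := by
    refine (abs_kernelAvg_le hg N c5 (C := C * ‖u‖ ^ 2)
      (fun y hy => ?_) ω).trans ?_
    · have : |fderiv ℝ (fderiv ℝ (spectralDensity P X y)) θ u u| ≤ C * ‖u‖ ^ 2 := by
        calc _ ≤ ‖fderiv ℝ (fderiv ℝ (spectralDensity P X y)) θ‖ * ‖u‖ * ‖u‖ :=
              ContinuousLinearMap.le_opNorm₂ _ _ _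
          _ ≤ C * ‖u‖ * ‖u‖ := by gcongr; exact (hCb y hy).2
          _ = _ := by ring
      rw [abs_mul, abs_of_pos (by norm_num : (0 : ℝ) < 1 / 2)]
      linarith [abs_nonneg (fderiv ℝ (fderiv ℝ (spectralDensity P X y)) θ u u)]
    · rw [hC', ← hG']; nlinarith [sq_nonneg ‖u‖]
  have hR : |s - s₀ - l - q| ≤ (G' * ε₁) * ‖u‖ ^ 2 := by
    rw [hs, hs₀, hl, hq, M.expectedPeriodogram_eq hγ, M.expectedPeriodogram_eq hθ',
      ← kernelAvg_sub g N c1 c2, ← kernelAvg_sub g N c6 c3,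
      ← kernelAvg_sub g N c7 c5, mul_assoc]
    refine abs_kernelAvg_le hg N (c7.sub c5)
      (fun y hy => ?_) ω
    have := htay y hy u hd0
    rwa [hγu] at this
  have hρ : G' * ε₁ ≤ C' := (hGε.trans (min_le_left _ _)).trans (by
    rw [hC']; linarith [mul_nonneg hG'0 hC.le])
  have key := abs_inv_sub_inv_sub_le hlo (hN γ hγ ω) (hN θ hθ' ω) hC'0.le (norm_nonneg u) hd1
    (G' * ε₁) hlb hqb hR hρ
  have e1 : ∑ i, u i * invGrad P X θ g N ω i = -(l / s₀ ^ 2) := by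
    rw [hl, M.kernelAvg_fderiv hθ, Finset.sum_div, ← Finset.sum_neg_distrib]
    exact Finset.sum_congr rfl fun i _ => by rw [invGrad]; ring
  have e2 : ∑ k : Fin d × Fin d, u k.1 * u k.2 * invHess P X θ g N ω k =
      -(q / s₀ ^ 2) + l ^ 2 / s₀ ^ 3 := by
    have hl2 : l ^ 2 = ∑ k : Fin d × Fin d,
        (u k.1 * avgGrad P X θ g N ω k.1) * (u k.2 * avgGrad P X θ g N ω k.2) := by
      rw [hl, M.kernelAvg_fderiv hθ, sq, Finset.sum_mul_sum, Fintype.sum_prod_type]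
    rw [hl2, hq, kernelAvg_const_mul, M.kernelAvg_fderiv_two hθ, Finset.mul_sum, Finset.sum_div,
      Finset.sum_div, ← Finset.sum_neg_distrib, ← Finset.sum_add_distrib]
    exact Finset.sum_congr rfl fun k _ => by rw [invHess]; ring
  rw [e1, e2]
  refine key.trans ?_
  gcongr
  have h1 : G' * ε₁ / lo ^ 2 ≤ ε / 2 := by
    rw [div_le_iff₀ (by positivity)]
    refine (hGε.trans (min_le_right _ _)).trans (le_of_eq (by ring))
  have h2 : Q * ‖u‖ ≤ ε / 2 := by
    calc Q * ‖u‖ ≤ Q * (ε / (2 * Q)) := by gcongr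
      _ = ε / 2 := by field_simp
  rw [hQ, add_mul] at h2
  linarith

end RegularModel

end ModulatedSeries

namespace ModulatedSeries

variable {Ω : Type*} [MeasurableSpace Ω] {d : ℕ}

/-! ### Convergence rate -/

/-- Chebyshev's inequality for a finite family of weighted means of the centred periodogram. -/
lemma measure_exists_le_abs_periodogramDeviation_le {ι : Type*} (I : Finset ι) {Y : ℕ → Ω → ℝ}
    {μ : Measure Ω} (hY : IsGaussianProcess Y μ) (h0 : ∀ t, ∫ x, Y t x ∂μ = 0) {N : ℕ}
    (hN : 0 < N) {K : ℝ}
    (hK : ∀ s ∈ Finset.range N, ∑ t ∈ Finset.range N, |∫ x, Y s x * Y t x ∂μ| ≤ K)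
    {h : ι → ℤ → ℝ} {C : ℝ} (hC : ∀ i ∈ I, ∀ j, |h i j| ≤ C) {a : ℝ} (ha : 0 < a) :
    μ {x | ∃ i ∈ I, a ≤ |periodogramDeviation μ Y N (h i) x|} ≤
      ENNReal.ofReal (I.card * (2 * K ^ 2 * C ^ 2) / (N * a ^ 2)) := by
  have hset : {x | ∃ i ∈ I, a ≤ |periodogramDeviation μ Y N (h i) x|} =
      ⋃ i ∈ I, {x | a ≤ |periodogramDeviation μ Y N (h i) x|} := by
    ext x; simp
  rw [hset]
  refine (measure_biUnion_finset_le _ _).trans ((Finset.sum_le_sum fun i hi =>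
    measure_le_abs_periodogramDeviation_le hY h0 hN hK (hC i hi) ha).trans (le_of_eq ?_))
  rw [Finset.sum_const, nsmul_eq_mul, ← ENNReal.ofReal_natCast, ← ENNReal.ofReal_mul (by positivity),
    ← mul_div_assoc]

/-- Decomposition of the pseudo-likelihood into a divergence and a centred periodogram mean. -/
lemma pseudoLikelihood_sub {P : EuclideanSpace ℝ (Fin d) → Measure Ω} {X : ℕ → Ω → ℝ} {g : ℕ → ℝ}
    {N : ℕ} {γ θ : EuclideanSpace ℝ (Fin d)}
    (hθ : ∀ ω, 0 < expectedPeriodogram P X g N ω θ) (x : Ω) :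
    pseudoLikelihood P X g N x γ - pseudoLikelihood P X g N x θ =
      (1 / (N : ℝ)) * ∑ j ∈ fourierIndices N,
        (Real.log (expectedPeriodogram P X g N (fourierFreq N j) γ)
          - Real.log (expectedPeriodogram P X g N (fourierFreq N j) θ)
          + expectedPeriodogram P X g N (fourierFreq N j) θ
            / expectedPeriodogram P X g N (fourierFreq N j) γ - 1)
      + periodogramDeviation (P θ) (modulate g X) N
        (fun j => 1 / expectedPeriodogram P X g N (fourierFreq N j) γ
          - 1 / expectedPeriodogram P X g N (fourierFreq N j) θ) x := by
  simp only [pseudoLikelihood, periodogramDeviation]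
  rw [← mul_sub, ← mul_add, ← Finset.sum_sub_distrib, ← Finset.sum_add_distrib]
  congr 1
  refine Finset.sum_congr rfl fun j _ => ?_
  -- The centring is under P θ, so the subtracted integral is the expected periodogram at θ by
  -- definition.
  change _ = _ + (_ - expectedPeriodogram P X g N (fourierFreq N j) θ) * _
  have := (hθ (fourierFreq N j)).ne'
  rw [sub_mul, mul_sub, mul_sub, mul_one_div_cancel this]
  ring

namespace RegularModel

variable {P : EuclideanSpace ℝ (Fin d) → Measure Ω} {X : ℕ → Ω → ℝ}
  {Θ : Set (EuclideanSpace ℝ (Fin d))} {θ : EuclideanSpace ℝ (Fin d)}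

/-- The basic inequality for minimizers of the pseudo-likelihood. -/
lemma exists_basic_inequality (M : RegularModel P X Θ) (hθ : θ ∈ interior Θ) {g : ℕ → ℝ} {G : ℝ}
    (hg : ∀ t, |g t| ≤ G) {τ : Fin d → ℕ}
    (hinj : Set.InjOn (fun γ => fun i => autocov P X (τ i) γ) Θ)
    (hJ : (autocovJacobian P X τ θ).det ≠ 0) {b : ℝ} (hb : 0 < b)
    (hbN : ∀ᶠ N in atTop, ∀ i, b ≤ |sampleAutocov g N (τ i)|) {lo hi : ℝ} (hlo : 0 < lo)
    (hbd : ∀ᶠ N in atTop, ∀ γ ∈ Θ, ∀ ω, lo ≤ expectedPeriodogram P X g N ω γ ∧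
      expectedPeriodogram P X g N ω γ ≤ hi) (hhi : lo ≤ hi) :
    ∃ c > 0, ∀ᶠ N : ℕ in atTop, ∀ γ ∈ Θ, ∀ x,
      pseudoLikelihood P X g N x γ ≤ pseudoLikelihood P X g N x θ →
      c * ‖γ - θ‖ ^ 2 ≤ |periodogramDeviation (P θ) (modulate g X) N
        (fun j => 1 / expectedPeriodogram P X g N (fourierFreq N j) γ
          - 1 / expectedPeriodogram P X g N (fourierFreq N j) θ) x| := by
  have hθ' := interior_subset hθ
  obtain ⟨c, hc, hsep⟩ := M.exists_mean_sq_separation hθ hg hinj hJ hb hbN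
  have hhi0 : 0 < hi := hlo.trans_le hhi
  set r := 1 / (hi ^ 2 * (Real.sqrt (hi / lo) + 1) ^ 2) with hr
  have hr0 : 0 < r := by positivity
  refine ⟨r * c, by positivity, ?_⟩
  filter_upwards [hsep, hbd] with N hN1 hN2 γ hγ x hle
  have hdec := pseudoLikelihood_sub (γ := γ)
    (fun ω => hlo.trans_le (hN2 θ hθ' ω).1) x
  have h1 : r * ((1 / (N : ℝ)) * ∑ j ∈ fourierIndices N,
      (expectedPeriodogram P X g N (fourierFreq N j) γ
        - expectedPeriodogram P X g N (fourierFreq N j) θ) ^ 2) ≤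
      (1 / (N : ℝ)) * ∑ j ∈ fourierIndices N,
        (Real.log (expectedPeriodogram P X g N (fourierFreq N j) γ)
          - Real.log (expectedPeriodogram P X g N (fourierFreq N j) θ)
          + expectedPeriodogram P X g N (fourierFreq N j) θ
            / expectedPeriodogram P X g N (fourierFreq N j) γ - 1) := by
    rw [mul_left_comm, Finset.mul_sum]
    gcongr with j _
    exact whittle_divergence_ge hlo (hN2 γ hγ _).1 (hN2 γ hγ _).2 (hN2 θ hθ' _).1 (hN2 θ hθ' _).2
  have h2 := mul_le_mul_of_nonneg_left (hN1 γ hγ) hr0.le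
  have h3 := neg_le_abs (periodogramDeviation (P θ) (modulate g X) N
        (fun j => 1 / expectedPeriodogram P X g N (fourierFreq N j) γ
          - 1 / expectedPeriodogram P X g N (fourierFreq N j) θ) x)
  rw [mul_assoc]
  linarith

/-- A finite set of parameters whose reciprocal expected periodograms approximate all others. -/
lemma exists_finite_net (M : RegularModel P X Θ) {g : ℕ → ℝ} {G : ℝ} (hg : ∀ t, |g t| ≤ G)
    {lo : ℝ} (hlo : 0 < lo) {ρ : ℝ} (hρ : 0 < ρ) :
    ∃ I : Finset (EuclideanSpace ℝ (Fin d)), (∀ γ ∈ I, γ ∈ Θ) ∧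
      ∀ N, (∀ γ ∈ Θ, ∀ ω, lo ≤ expectedPeriodogram P X g N ω γ) → ∀ γ ∈ Θ, ∃ γ' ∈ I, ∀ ω,
        |1 / expectedPeriodogram P X g N ω γ - 1 / expectedPeriodogram P X g N ω γ'| ≤ ρ := by
  have hpi := Real.pi_pos
  -- Smoothing multiplies the modulus by at most 2πG² and taking reciprocals by at most 1/lo². Since
  -- neither involves N, one net serves all sample sizes.
  set ε := ρ * lo ^ 2 / (2 * Real.pi * G ^ 2 + 1) with hε
  have hεp : 0 < ε := by positivity
  obtain ⟨δ, hδ, hmod⟩ := M.exists_uniform_modulus hεp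
  obtain ⟨t, htΘ, htf, hcov⟩ := M.isCompact.finite_cover_balls hδ
  refine ⟨htf.toFinset, fun γ hγ => htΘ (htf.mem_toFinset.1 hγ), fun N hN γ hγ => ?_⟩
  obtain ⟨γ', hγ', hball⟩ := Set.mem_iUnion₂.1 (hcov hγ)
  refine ⟨γ', htf.mem_toFinset.2 hγ', fun ω => ?_⟩
  have h1 := M.abs_expectedPeriodogram_sub_le hγ (htΘ hγ') hg
    (hmod γ hγ γ' (htΘ hγ') hball) N ω
  have hs := hN γ hγ ω
  have hs' := hN γ' (htΘ hγ') ω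
  have hsp := hlo.trans_le hs
  have hsp' := hlo.trans_le hs'
  rw [div_sub_div _ _ hsp.ne' hsp'.ne', one_mul, mul_one, abs_div, abs_of_pos (by positivity :
    0 < expectedPeriodogram P X g N ω γ * expectedPeriodogram P X g N ω γ'),
    div_le_iff₀ (by positivity), abs_sub_comm]
  calc _ ≤ 2 * Real.pi * G ^ 2 * ε := h1
    _ ≤ (2 * Real.pi * G ^ 2 + 1) * ε := by gcongr; linarith
    _ = ρ * (lo * lo) := by rw [hε]; field_simp
    _ ≤ _ := by gcongr

/-- The linear and quadratic parts of the centred periodogram mean near the true parameter. -/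
lemma abs_periodogramDeviation_inv_le {μ : Measure Ω} {Y : ℕ → Ω → ℝ} {g : ℕ → ℝ} {N : ℕ}
    {γ : EuclideanSpace ℝ (Fin d)} {x : Ω} {ε p q : ℝ}
    (hexp : ∀ ω, |1 / expectedPeriodogram P X g N ω γ - 1 / expectedPeriodogram P X g N ω θ
          - ∑ i, (γ - θ) i * invGrad P X θ g N ω i
          - ∑ k : Fin d × Fin d, (γ - θ) k.1 * (γ - θ) k.2 * invHess P X θ g N ω k| ≤
        ε * ‖γ - θ‖ ^ 2)
    (hp : ∀ i, |periodogramDeviation μ Y N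
      (fun j => invGrad P X θ g N (fourierFreq N j) i) x| ≤ p)
    (hq : ∀ k, |periodogramDeviation μ Y N
      (fun j => invHess P X θ g N (fourierFreq N j) k) x| ≤ q) :
    |periodogramDeviation μ Y N (fun j => 1 / expectedPeriodogram P X g N (fourierFreq N j) γ
      - 1 / expectedPeriodogram P X g N (fourierFreq N j) θ) x| ≤
      d * p * ‖γ - θ‖ + (d : ℝ) ^ 2 * q * ‖γ - θ‖ ^ 2
        + ε * ‖γ - θ‖ ^ 2 * periodogramAbsDeviation μ Y N x := by
  set u := γ - θ with hu
  have hui : ∀ i, |u i| ≤ ‖u‖ := fun i => PiLp.norm_apply_le u i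
  -- R still depends on the possibly random γ, so its contribution is bounded through the mean
  -- absolute deviation.
  set R : ℤ → ℝ := fun j => 1 / expectedPeriodogram P X g N (fourierFreq N j) γ
    - 1 / expectedPeriodogram P X g N (fourierFreq N j) θ
    - ∑ i, u i * invGrad P X θ g N (fourierFreq N j) i
    - ∑ k : Fin d × Fin d, u k.1 * u k.2 * invHess P X θ g N (fourierFreq N j) k with hR
  have hsplit : (fun j => 1 / expectedPeriodogram P X g N (fourierFreq N j) γ
      - 1 / expectedPeriodogram P X g N (fourierFreq N j) θ) =
      fun j => (∑ i, u i * invGrad P X θ g N (fourierFreq N j) i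
        + ∑ k : Fin d × Fin d, u k.1 * u k.2 * invHess P X θ g N (fourierFreq N j) k) + R j := by
    ext j; simp only [hR]; ring
  rw [hsplit, periodogramDeviation_add, periodogramDeviation_add, periodogramDeviation_sum,
    periodogramDeviation_sum]
  simp_rw [periodogramDeviation_const_mul]
  have h1 : |∑ i, u i * periodogramDeviation μ Y N
      (fun j => invGrad P X θ g N (fourierFreq N j) i) x| ≤ d * p * ‖u‖ := by
    calc _ ≤ ∑ i : Fin d, ‖u‖ * p := by
          refine (Finset.abs_sum_le_sum_abs _ _).trans (Finset.sum_le_sum fun i _ => ?_)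
          rw [abs_mul]
          exact mul_le_mul (hui i) (hp i) (abs_nonneg _) (norm_nonneg _)
      _ = _ := by simp; ring
  have h2 : |∑ k : Fin d × Fin d, u k.1 * u k.2 * periodogramDeviation μ Y N
      (fun j => invHess P X θ g N (fourierFreq N j) k) x| ≤ (d : ℝ) ^ 2 * q * ‖u‖ ^ 2 := by
    calc _ ≤ ∑ k : Fin d × Fin d, ‖u‖ ^ 2 * q := by
          refine (Finset.abs_sum_le_sum_abs _ _).trans (Finset.sum_le_sum fun k _ => ?_)
          rw [abs_mul, abs_mul, sq]
          exact mul_le_mul (mul_le_mul (hui _) (hui _) (abs_nonneg _) (norm_nonneg _)) (hq k)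
            (abs_nonneg _) (by positivity)
      _ = _ := by simp; ring
  have h3 := abs_periodogramDeviation_le μ Y N (h := R) (fun j => hexp (fourierFreq N j)) x
  exact (abs_add_le _ _).trans (add_le_add ((abs_add_le _ _).trans (add_le_add h1 h2)) h3)

/-- The estimator converges at the rate `N^{-1/2}`. -/
theorem isBigOInProbability_estimator (M : RegularModel P X Θ) (hθ : θ ∈ interior Θ) (hd : 0 < d)
    {g : ℕ → ℝ} {G : ℝ} (hg : ∀ t, |g t| ≤ G) {τ : Fin d → ℕ}
    (hinj : Set.InjOn (fun γ => fun i => autocov P X (τ i) γ) Θ)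
    (hJ : (autocovJacobian P X τ θ).det ≠ 0) {b : ℝ} (hb : 0 < b)
    (hbN : ∀ᶠ N in atTop, ∀ i, b ≤ |sampleAutocov g N (τ i)|)
    {θhat : ℕ → Ω → EuclideanSpace ℝ (Fin d)} (hθhat : IsSpectralEstimator P X g Θ θhat) :
    IsBigOInProbability (P θ) (fun N x => θhat N x - θ) (fun N => 1 / Real.sqrt N) := by
  intro ε hε
  have hθ' := interior_subset hθ
  have hdp : (0 : ℝ) < d := by positivity
  have hX := M.stationary θ hθ'
  have hY := isGaussianProcess_modulate hX.gaussian g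
  have hY0 := hX.integral_modulate g
  set μ := P θ with hμ
  set Y := modulate g X with hYdef
  set K := G ^ 2 * ∑' τ : ℤ, |autocov P X τ.natAbs θ| with hKdef
  have hK : ∀ N s : ℕ, s ∈ Finset.range N →
      ∑ t ∈ Finset.range N, |∫ x, Y s x * Y t x ∂μ| ≤ K :=
    fun N s _ => sum_abs_integral_modulate_le hX (M.summable θ hθ') hg N s
  obtain ⟨lo, hlo, hi, hlohi, hbounds⟩ := M.exists_expectedPeriodogram_bounds hθ' hg hb
  have hhi : 0 < hi := hlo.trans_le hlohi
  have hbd : ∀ᶠ N in atTop, ∀ γ ∈ Θ, ∀ ω, lo ≤ expectedPeriodogram P X g N ω γ ∧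
      expectedPeriodogram P X g N ω γ ≤ hi := by
    filter_upwards [hbN] with N hN
    exact hbounds N ((hN ⟨0, hd⟩).trans (abs_sampleAutocov_le g N _))
  obtain ⟨c, hc, hbasic⟩ := M.exists_basic_inequality hθ hg hinj hJ hb hbN hlo hbd hlohi
  obtain ⟨C₀, hcoef₀⟩ := M.exists_coeff_bound hθ hg hlo
  -- thresholds
  set A := 8 * hi / ε with hA
  have hAp : 0 < A := by positivity
  -- With mean absolute deviation below A, tolerance c/(4A) makes the expansion remainder at most
  -- (c/4)‖u‖², and mesh cδ²/(2A) makes the net error at most cδ²/2.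
  obtain ⟨δ, hδ, hexp⟩ := M.exists_inv_expansion hθ hg hlo (ε := c / (4 * A)) (by positivity)
  obtain ⟨I, hIΘ, hnet⟩ := M.exists_finite_net hg hlo (ρ := c * δ ^ 2 / (2 * A)) (by positivity)
  set V := 2 * K ^ 2 * C₀ ^ 2 with hV
  have hV0 : 0 ≤ V := by positivity
  set B := Real.sqrt (4 * d * V / ε) + 1 with hB
  have hBp : 0 < B := by positivity
  have hBV : d * V / B ^ 2 ≤ ε / 4 := by
    have h1 : 4 * d * V / ε ≤ B ^ 2 := by
      have h2 := Real.sq_sqrt (by positivity : 0 ≤ 4 * d * V / ε)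
      have h3 := Real.sqrt_nonneg (4 * d * V / ε)
      rw [hB]; nlinarith
    rw [div_le_iff₀ hε] at h1
    rw [div_le_iff₀ (by positivity)]
    linarith
  -- There are d² second-order coefficients, so together they contribute at most (c/4)‖u‖².
  set η := c / (4 * (d : ℝ) ^ 2) with hη
  have hηp : 0 < η := by positivity
  set η' := c * δ ^ 2 / 2 with hη'
  have hη'p : 0 < η' := by positivity
  have hev : ∀ R : ℝ, ∀ᶠ N : ℕ in atTop, R / N ≤ ε / 4 := fun R =>
    (tendsto_const_div_atTop_nhds_zero_nat R).eventually (ge_mem_nhds (by positivity))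
  refine ⟨2 * d * B / c, ?_⟩
  filter_upwards [hbd, hbasic, eventually_gt_atTop 0,
    hev (((Finset.univ : Finset (Fin d × Fin d)).card : ℝ) * V / η ^ 2),
    hev (I.card * (2 * K ^ 2 * (1 / lo) ^ 2) / η' ^ 2)] with N hN1 hN2 hN3 hN4 hN5
  have hNp : (0 : ℝ) < N := by positivity
  have hsq : 0 < Real.sqrt N := Real.sqrt_pos.2 hNp
  have hlow : ∀ γ ∈ Θ, ∀ ω, lo ≤ expectedPeriodogram P X g N ω γ := fun γ hγ ω => (hN1 γ hγ ω).1
  set hinv : EuclideanSpace ℝ (Fin d) → ℤ → ℝ := fun γ j =>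
    1 / expectedPeriodogram P X g N (fourierFreq N j) γ
      - 1 / expectedPeriodogram P X g N (fourierFreq N j) θ with hhinv
  -- exceptional events
  set E₁ := {x | A ≤ periodogramAbsDeviation μ Y N x} with hE₁
  set E₂ := {x | ∃ i ∈ (Finset.univ : Finset (Fin d)), B / Real.sqrt N ≤
    |periodogramDeviation μ Y N (fun j => invGrad P X θ g N (fourierFreq N j) i) x|} with hE₂
  set E₃ := {x | ∃ k ∈ (Finset.univ : Finset (Fin d × Fin d)), η ≤
    |periodogramDeviation μ Y N (fun j => invHess P X θ g N (fourierFreq N j) k) x|} with hE₃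
  set E₄ := {x | ∃ γ ∈ I, η' ≤ |periodogramDeviation μ Y N (hinv γ) x|} with hE₄
  -- The inclusion is deterministic, and monotonicity of the outer measure then covers a possibly
  -- nonmeasurable left side.
  have hsub : {x | 2 * d * B / c * (1 / Real.sqrt N) < ‖θhat N x - θ‖} ⊆
      (E₁ ∪ E₂) ∪ (E₃ ∪ E₄) := by
    intro x hx
    by_contra hcon
    simp only [Set.mem_union, not_or, hE₁, hE₂, hE₃, hE₄, Set.mem_ofPred_eq, not_exists, not_and,
      not_le, Finset.mem_univ, true_implies] at hcon
    obtain ⟨⟨hT, hp⟩, hq, hh⟩ := hcon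
    obtain ⟨hmem, hmin⟩ := hθhat N x
    have hT0 := periodogramAbsDeviation_nonneg μ Y N x
    have hbi := hN2 (θhat N x) hmem x (hmin hθ')
    -- the estimator is close to the true parameter
    have hclose : ‖θhat N x - θ‖ < δ := by
      obtain ⟨γ', hγ', hγ'b⟩ := hnet N hlow (θhat N x) hmem
      have hspl : hinv (θhat N x) = fun j => hinv γ' j +
          (1 / expectedPeriodogram P X g N (fourierFreq N j) (θhat N x)
            - 1 / expectedPeriodogram P X g N (fourierFreq N j) γ') := by
        ext j; simp only [hhinv]; ring
      have h1 : |periodogramDeviation μ Y N (hinv (θhat N x)) x| < c * δ ^ 2 := by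
        rw [hspl, periodogramDeviation_add]
        have h2 := abs_periodogramDeviation_le μ Y N (fun j => hγ'b (fourierFreq N j)) x
        have h3 : c * δ ^ 2 / (2 * A) * periodogramAbsDeviation μ Y N x ≤
            c * δ ^ 2 / (2 * A) * A := by gcongr
        have h4 : c * δ ^ 2 / (2 * A) * A = c * δ ^ 2 / 2 := by field_simp
        have h5 := hh γ' hγ'
        refine (abs_add_le _ _).trans_lt ?_
        linarith
      have h2 : c * ‖θhat N x - θ‖ ^ 2 < c * δ ^ 2 := hbi.trans_lt h1
      exact lt_of_pow_lt_pow_left₀ 2 hδ.le (lt_of_mul_lt_mul_left h2 hc.le)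
    have hloc := abs_periodogramDeviation_inv_le (hexp N hlow (θhat N x) hmem hclose)
      (fun i => (hp i).le) (fun k => (hq k).le)
    have h1 : c / (4 * A) * ‖θhat N x - θ‖ ^ 2 * periodogramAbsDeviation μ Y N x ≤
        c / (4 * A) * ‖θhat N x - θ‖ ^ 2 * A := by gcongr
    have h2 : c / (4 * A) * ‖θhat N x - θ‖ ^ 2 * A = c / 4 * ‖θhat N x - θ‖ ^ 2 := by
      field_simp
    have h3 : (d : ℝ) ^ 2 * η * ‖θhat N x - θ‖ ^ 2 = c / 4 * ‖θhat N x - θ‖ ^ 2 := by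
      rw [hη]; field_simp
    -- The second-order part and the remainder take c/4 each, leaving c/2 against the linear part;
    -- dividing by the norm yields the constant 2dB/c.
    have h4 : c / 2 * ‖θhat N x - θ‖ ^ 2 ≤ d * (B / Real.sqrt N) * ‖θhat N x - θ‖ := by
      linarith [hbi.trans hloc]
    have hx' : 2 * d * B / c * (1 / Real.sqrt N) < ‖θhat N x - θ‖ := hx
    have hpos : 0 < ‖θhat N x - θ‖ := lt_of_le_of_lt (by positivity) hx'
    have h5 : c / 2 * ‖θhat N x - θ‖ ≤ d * (B / Real.sqrt N) := by
      refine le_of_mul_le_mul_right ?_ hpos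
      linarith
    have h6 : c / 2 * (2 * d * B / c * (1 / Real.sqrt N)) < c / 2 * ‖θhat N x - θ‖ := by gcongr
    have h7 : c / 2 * (2 * d * B / c * (1 / Real.sqrt N)) = d * (B / Real.sqrt N) := by
      field_simp
    linarith
  have hcoef : ∀ ω, (∀ i, |invGrad P X θ g N ω i| ≤ C₀) ∧ ∀ k, |invHess P X θ g N ω k| ≤ C₀ :=
    fun ω => hcoef₀ N ω (hlow θ hθ' ω)
  have m₁ : μ E₁ ≤ ENNReal.ofReal (ε / 4) := by
    refine (measure_le_periodogramAbsDeviation_le hY hN3 (fun ω => (hN1 θ hθ' ω).2) hAp).trans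
      (ENNReal.ofReal_le_ofReal (le_of_eq ?_))
    rw [hA]; field_simp; norm_num
  -- Here the threshold shrinks like N^{-1/2} and exactly cancels the 1/N of the variance, so
  -- smallness comes from B. For the events with fixed thresholds η and η' it comes from N.
  have m₂ : μ E₂ ≤ ENNReal.ofReal (ε / 4) := by
    refine (measure_exists_le_abs_periodogramDeviation_le _ hY hY0 hN3 (hK N)
      (fun i _ j => (hcoef (fourierFreq N j)).1 i) (by positivity)).trans
      (ENNReal.ofReal_le_ofReal (le_trans (le_of_eq ?_) hBV))
    rw [div_pow, Real.sq_sqrt hNp.le, Finset.card_univ, Fintype.card_fin, ← hV]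
    field_simp
  have m₃ : μ E₃ ≤ ENNReal.ofReal (ε / 4) := by
    refine (measure_exists_le_abs_periodogramDeviation_le _ hY hY0 hN3 (hK N)
      (fun k _ j => (hcoef (fourierFreq N j)).2 k) hηp).trans
      (ENNReal.ofReal_le_ofReal (le_trans (le_of_eq ?_) hN4))
    rw [← hV]
    field_simp
  have m₄ : μ E₄ ≤ ENNReal.ofReal (ε / 4) := by
    refine (measure_exists_le_abs_periodogramDeviation_le I hY hY0 hN3 (hK N) (C := 1 / lo)
      (fun γ hγ j => ?_) hη'p).trans (ENNReal.ofReal_le_ofReal (le_trans (le_of_eq ?_) hN5))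
    · have hs := hlow γ (hIΘ γ hγ) (fourierFreq N j)
      have hs₀ := hlow θ hθ' (fourierFreq N j)
      have i1 := one_div_le_one_div_of_le hlo hs
      have i2 := one_div_le_one_div_of_le hlo hs₀
      have i3 := one_div_pos.2 (hlo.trans_le hs)
      have i4 := one_div_pos.2 (hlo.trans_le hs₀)
      simp only [hhinv]
      rw [abs_le]
      constructor <;> linarith
    · field_simp
  calc μ {x | 2 * d * B / c * (1 / Real.sqrt N) < ‖θhat N x - θ‖}
      ≤ μ ((E₁ ∪ E₂) ∪ (E₃ ∪ E₄)) := measure_mono hsub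
    _ ≤ (μ E₁ + μ E₂) + (μ E₃ + μ E₄) := (measure_union_le _ _).trans
        (add_le_add (measure_union_le _ _) (measure_union_le _ _))
    _ ≤ (ENNReal.ofReal (ε / 4) + ENNReal.ofReal (ε / 4))
        + (ENNReal.ofReal (ε / 4) + ENNReal.ofReal (ε / 4)) := by gcongr
    _ = ENNReal.ofReal ε := by
        rw [← ENNReal.ofReal_add (by positivity) (by positivity),
          ← ENNReal.ofReal_add (by positivity) (by positivity)]
        congr 1; ring

end RegularModel

end ModulatedSeries

/-! ### The convergence rate theorem -/

theorem theorem2 {Ω : Type*} [MeasurableSpace Ω] {d : ℕ}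
    -- parameter set and true parameter
    (Θ : Set (EuclideanSpace ℝ (Fin d))) (hΘ : IsCompact Θ)
    (θ : EuclideanSpace ℝ (Fin d)) (hθ : θ ∈ interior Θ)
    -- latent process, with its law under each parameter vector
    (P : EuclideanSpace ℝ (Fin d) → Measure Ω) (X : ℕ → Ω → ℝ)
    (hX : ∀ γ ∈ Θ, ModulatedSeries.IsStationaryGaussian X (P γ))
    -- short memory, continuity of the autocovariances, positivity of the spectral densities
    (hsum : ∀ γ ∈ Θ, Summable fun τ : ℕ => |ModulatedSeries.autocov P X τ γ|)
    (hcont : ∀ τ : ℕ, ContinuousOn (ModulatedSeries.autocov P X τ) Θ)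
    (hpos : ∀ γ ∈ Θ, ∀ ω : ℝ, 0 < ModulatedSeries.spectralDensity P X ω γ)
    -- the spectral densities are continuously differentiable in the frequency
    (hdiff : ∀ γ ∈ Θ, Differentiable ℝ fun ω : ℝ => ModulatedSeries.spectralDensity P X ω γ)
    (hderiv : ContinuousOn
      (fun p : ℝ × EuclideanSpace ℝ (Fin d) =>
        deriv (fun ω : ℝ => ModulatedSeries.spectralDensity P X ω p.2) p.1)
      (Set.univ ×ˢ Θ))
    -- the spectral densities are twice continuously differentiable in the parameter
    (hC2 : ∀ ω : ℝ, ContDiffOn ℝ 2 (ModulatedSeries.spectralDensity P X ω) (interior Θ))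
    (hfderiv : ContinuousOn
      (fun p : ℝ × EuclideanSpace ℝ (Fin d) =>
        fderiv ℝ (ModulatedSeries.spectralDensity P X p.1) p.2)
      (Set.univ ×ˢ interior Θ))
    (hfderiv2 : ContinuousOn
      (fun p : ℝ × EuclideanSpace ℝ (Fin d) =>
        fderiv ℝ (fderiv ℝ (ModulatedSeries.spectralDensity P X p.1)) p.2)
      (Set.univ ×ˢ interior Θ))
    -- bounded modulating sequence, significant correlation contribution
    (g : ℕ → ℝ) (hg : ∃ gmax : ℝ, ∀ t, |g t| ≤ gmax)
    (Γ : Finset ℕ) (hΓ : ModulatedSeries.SignificantCorrelation P X g Θ Γ)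
    -- `Γ` has `d` elements and the Jacobian at the true parameter is nonsingular
    (τ : Fin d ≃ Γ)
    (hJ : (ModulatedSeries.autocovJacobian P X (fun i => (τ i : ℕ)) θ).det ≠ 0)
    -- the estimator
    (θhat : ℕ → Ω → EuclideanSpace ℝ (Fin d))
    (hθhat : ModulatedSeries.IsSpectralEstimator P X g Θ θhat) :
    ModulatedSeries.IsBigOInProbability (P θ) (fun N x => θhat N x - θ)
      (fun N => 1 / Real.sqrt N) := by

  have M : ModulatedSeries.RegularModel P X Θ :=
    ⟨hΘ, hX, hsum, hcont, hpos, hdiff, hderiv, hC2, hfderiv, hfderiv2⟩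
  -- For d = 0 the parameter space is a single point and the error vanishes.
  rcases Nat.eq_zero_or_pos d with rfl | hd
  · intro ε _
    refine ⟨0, Eventually.of_forall fun N => ?_⟩
    have : {x | 0 * (1 / Real.sqrt N) < ‖θhat N x - θ‖} = ∅ := by
      ext x; simp [Subsingleton.elim (θhat N x) θ]
    rw [this]; simp
  obtain ⟨G, hG⟩ := hg
  have hinj : Set.InjOn (fun γ => fun i => ModulatedSeries.autocov P X (τ i) γ) Θ := by
    intro γ hγ γ' hγ' h
    refine hΓ.injective hγ hγ' (funext fun k => ?_)
    have := congrFun h (τ.symm k)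
    simpa using this
  -- A positive liminf yields an eventual lower bound, given that the sequence is bounded below,
  -- here by 0; the minimum over the finitely many lags then serves for all of them.
  have hlim : ∀ i, ∃ b > 0, ∀ᶠ N in atTop, b ≤ |ModulatedSeries.sampleAutocov g N (τ i)| := by
    intro i
    obtain ⟨b, hb, hb'⟩ := exists_between (hΓ.liminf_pos (τ i) (τ i).2)
    exact ⟨b, hb, (eventually_lt_of_lt_liminf hb'
      (isBoundedUnder_of ⟨0, fun N => abs_nonneg _⟩)).mono fun N hN => hN.le⟩
  choose b hb hbN using hlim
  have hne : (Finset.univ : Finset (Fin d)).Nonempty := ⟨⟨0, hd⟩, Finset.mem_univ _⟩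
  refine M.isBigOInProbability_estimator hθ hd hG hinj hJ
    (b := Finset.univ.inf' hne b) ?_ ?_ hθhat
  · exact (Finset.lt_inf'_iff hne).2 fun i _ => hb i
  · filter_upwards [eventually_all.2 hbN] with N hN i
    exact (Finset.inf'_le b (Finset.mem_univ i)).trans (hN i)
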